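/- Let $k$ be a field of characteristic zero; a variety over $k$ is a separated $k$-scheme of finite type. A scheme is normal if all its local rings are integrally closed domains. A morphism of schemes is unramified if it is locally of finite type and its sheaf of relative differentials vanishes, and ramified if it is not unramified. For a $k$-scheme $X$, density of a subset of $X(k)$ means density in $X$ for the Zariski topology. A normal projective geometrically connected variety $X$ over $k$ has the *weak-Hilbert property over $k$* if, for every integer $n\ge 1$ and all finite surjective ramified morphisms $\pi_i:Y_i\to X$ ($i=1,\dots,n$) with each $Y_i$ normal and geometrically integral over $k$, the set $X(k)\setminus\bigcup_{i=1}^n\pi_i(Y_i(k))$ is dense in $X$. It has the *very-weak-Hilbert property over $k$* if this holds for $n=1$. **Theorem.** Let $f:X\to S$ be a morphism of smooth projective integral varieties over $k$, let $Y$ be a normal integral variety over $k$, and let $\pi:Y\to X$ be a finite surjective ramified morphism of $k$-varieties. Let $D\subset X$ be the branch locus of $\pi$, that is, the set of points $x\in X$ such that the scheme-theoretic fibre $Y_x\to\operatorname{Spec}\kappa(x)$ is ramified. Let $U\subset S$ be a dense open subscheme. Assume that: 1. $S$ has the very-weak-Hilbert property over $k$; 2. for every $s\in U(k)$, the fibre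 $X_s$ is normal and integral and has the weak-Hilbert property over $k$; 3. $D$ dominates $S$, i.e. $f(D)=S$. Then $X(k)\setminus\pi(Y(k))$ is dense in $X$. -/

import Mathlib

open CategoryTheory CategoryTheory.Limits

universe u

namespace HilbertProperty

noncomputable section

attribute [local instance] MvPolynomial.gradedAlgebra

/-- The structure morphism of projective `n`-space `Proj k[x₀, …, xₙ]` over `k`. -/
def projectiveSpaceToSpec (k : Type u) [Field k] (n : ℕ) :
    AlgebraicGeometry.Proj (MvPolynomial.homogeneousSubmodule (Fin (n + 1)) k) ⟶
      AlgebraicGeometry.Spec (.of k) :=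
  AlgebraicGeometry.Proj.toSpecZero (MvPolynomial.homogeneousSubmodule (Fin (n + 1)) k) ≫
    AlgebraicGeometry.Spec.map (CommRingCat.ofHom
      (algebraMap k (MvPolynomial.homogeneousSubmodule (Fin (n + 1)) k 0)))

/-- A `k`-scheme is projective if it is isomorphic over `k` to a closed subscheme of some
projective space over `k`. -/
def IsProjective {k : Type u} [Field k] {X : AlgebraicGeometry.Scheme.{u}}
    (p : X ⟶ AlgebraicGeometry.Spec (.of k)) : Prop :=
  ∃ (n : ℕ) (i : X ⟶
      AlgebraicGeometry.Proj (MvPolynomial.homogeneousSubmodule (Fin (n + 1)) k)),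
    AlgebraicGeometry.IsClosedImmersion i ∧ i ≫ projectiveSpaceToSpec k n = p

/-- A scheme is normal if all its local rings are integrally closed domains. -/
def IsNormal (X : AlgebraicGeometry.Scheme.{u}) : Prop :=
  ∀ x : X, IsDomain (X.presheaf.stalk x) ∧ IsIntegrallyClosed (X.presheaf.stalk x)

/-- A morphism is unramified if it is locally of finite type and formally unramified
(i.e. its sheaf of relative differentials vanishes). -/
def IsUnramified {X Y : AlgebraicGeometry.Scheme.{u}} (f : X ⟶ Y) : Prop :=
  AlgebraicGeometry.LocallyOfFiniteType f ∧ AlgebraicGeometry.FormallyUnramified f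

/-- A morphism is ramified if it is not unramified. -/
def IsRamified {X Y : AlgebraicGeometry.Scheme.{u}} (f : X ⟶ Y) : Prop :=
  ¬ IsUnramified f

/-- The branch locus of `f : X ⟶ Y`: the set of points `y` of `Y` such that the
scheme-theoretic fibre of `f` over `y` is ramified over the residue field of `y`. -/
def branchLocus {X Y : AlgebraicGeometry.Scheme.{u}} (f : X ⟶ Y) : Set Y :=
  {y | IsRamified (f.fiberToSpecResidueField y)}

/-- The set `X(k)` of `k`-rational points of the `k`-scheme `p : X ⟶ Spec k`. -/
def RationalPoint {k : Type u} [Field k] {X : AlgebraicGeometry.Scheme.{u}}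
    (p : X ⟶ AlgebraicGeometry.Spec (.of k)) : Type u :=
  {x : AlgebraicGeometry.Spec (.of k) ⟶ X // x ≫ p = 𝟙 _}

/-- The point of the underlying topological space given by a rational point. -/
def RationalPoint.toPoint {k : Type u} [Field k] {X : AlgebraicGeometry.Scheme.{u}}
    {p : X ⟶ AlgebraicGeometry.Spec (.of k)} (x : RationalPoint p) : X :=
  x.1 (IsLocalRing.closedPoint k)

/-- The map `Y(k) → X(k)` induced by `π : Y ⟶ X`, where `Y` is a `k`-scheme through `π`. -/
def RationalPoint.map {k : Type u} [Field k] {X Y : AlgebraicGeometry.Scheme.{u}}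
    (p : X ⟶ AlgebraicGeometry.Spec (.of k)) (π : Y ⟶ X) (y : RationalPoint (π ≫ p)) :
    RationalPoint p :=
  ⟨y.1 ≫ π, by rw [Category.assoc]; exact y.2⟩

/-- A set of rational points of `X` is dense if it is dense in the Zariski topology of `X`. -/
def IsZariskiDense {k : Type u} [Field k] {X : AlgebraicGeometry.Scheme.{u}}
    {p : X ⟶ AlgebraicGeometry.Spec (.of k)} (A : Set (RationalPoint p)) : Prop :=
  Dense (RationalPoint.toPoint '' A)

/-- The very-weak-Hilbert property over `k` of a normal projective geometrically connected
variety `p : X ⟶ Spec k`. -/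
structure VeryWeakHilbert {k : Type u} [Field k] {X : AlgebraicGeometry.Scheme.{u}}
    (p : X ⟶ AlgebraicGeometry.Spec (.of k)) : Prop where
  isNormal : IsNormal X
  isProjective : IsProjective p
  geometricallyConnected : AlgebraicGeometry.GeometricallyConnected p
  dense : ∀ (Y : AlgebraicGeometry.Scheme.{u}) (π : Y ⟶ X),
    AlgebraicGeometry.IsFinite π → AlgebraicGeometry.Surjective π → IsRamified π →
    AlgebraicGeometry.GeometricallyIntegral (π ≫ p) → IsNormal Y →
    IsZariskiDense (Set.range (RationalPoint.map p π))ᶜ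

/-- The weak-Hilbert property over `k` of a normal projective geometrically connected
variety `p : X ⟶ Spec k`. -/
structure WeakHilbert {k : Type u} [Field k] {X : AlgebraicGeometry.Scheme.{u}}
    (p : X ⟶ AlgebraicGeometry.Spec (.of k)) : Prop where
  isNormal : IsNormal X
  isProjective : IsProjective p
  geometricallyConnected : AlgebraicGeometry.GeometricallyConnected p
  dense : ∀ (n : ℕ), 1 ≤ n →
    ∀ (Y : Fin n → AlgebraicGeometry.Scheme.{u}) (π : ∀ i, Y i ⟶ X),
    (∀ i, AlgebraicGeometry.IsFinite (π i)) → (∀ i, AlgebraicGeometry.Surjective (π i)) →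
    (∀ i, IsRamified (π i)) →
    (∀ i, AlgebraicGeometry.GeometricallyIntegral (π i ≫ p)) → (∀ i, IsNormal (Y i)) →
    IsZariskiDense (⋃ i, Set.range (RationalPoint.map p (π i)))ᶜ

end

end HilbertProperty

/-!
The fibration method for the Hilbert property. Let `T` be the algebraic closure of the function
field of `S` in that of `Y`, or rather a finite algebra over the coordinate ring `A` of a small
affine open subset `W` of `S` with this fraction field (`exists_finite_factorization`). Since `Y`
is normal, it maps over `W` to `Spec T`; this is the Stein factorization of `Y ⟶ S` over `W`, up
to shrinking `W`. For a rational point `s` of `S` in `W`, the fibre `Y_s` is thus the disjoint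
union of the fibres of `Y` over the points of `Spec T` above `s`. Every rational point of `X_s`
which lifts to `Y` lifts to the fibre of `Y` over one of the finitely many *rational* points `t`
of `Spec T` above `s`.

For `s` in a dense open subset of `S`, each of these fibres `Y_t` is a finite surjective ramified
cover of `X_s` which is normal and geometrically integral (`exists_fibres_of_cover`):

* `Y_t` is geometrically integral and normal, because `Frac T` is algebraically closed in the
  function field of the normal scheme `Y` and the characteristic is zero
  (`exists_geometricallyIntegral_isNormal_pullback`).
* `Y_t ⟶ X_s` is surjective, because the general fibres of `Y` are torsion free over those of `X`,
  so that each of their connected components dominates `X_s`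
  (`exists_injective_tensorComparison`).
* `Y_t ⟶ X_s` is ramified, because the branch locus contains a point over the generic point of
  `S`. Hence the module of differentials of `Y` over `X` is not torsion over `A`; neither is that
  over the base change of `X` to `T`, since `T` is generically étale over `A`, and therefore its
  general fibres over `Spec T` do not vanish (`exists_not_formallyUnramified_tensor`).

The weak-Hilbert property of `X_s` now yields rational points of `X_s` outside the images of all
`Y_t` (`exists_covers_of_rational_fibres`), and there is a general rational point `s` of `S`
because the very-weak-Hilbert property implies that the rational points of `S` are dense. For the
latter, as well as for those `s` which have no rational point of `Spec T` above them, one needs at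
least one ramified cover to which the property can be applied: adjoin the square root of a
uniformizer at a point of codimension one and normalize (`isZariskiDense_univ`).

The statements on general fibres are proved for the fibres `κ ⊗[A] B` of an algebra `B` of finite
type over a Noetherian domain `A`, where `κ` runs through the fields over `A` in which a suitable
nonzero element of `A` does not vanish. They rest on generic flatness (`genericTorVanishes`), from
which exactness on general fibres follows (`exists_lTensor_exact`). Integrality of the general
fibres is the Bertini–Noether theorem (`exists_isDomain_tensor`): `B` is generically a
hypersurface whose equation is irreducible over the algebraic closure of `Frac A`, and a reducible
specialization is excluded by the Nullstellensatz. Normality (`exists_isIntegrallyClosed_tensor`)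
follows from the criterion of Grauert and Remmert, which is an exactness statement.
-/

namespace HilbertProperty

section Algebra

open TensorProduct

/-! ### Generic vanishing of `Tor₁` -/

/-- `TorVanishes A κ M` says that `Tor₁^A(κ, M) = 0`, phrased without derived functors: every short
exact sequence `0 → N' → N → M → 0` stays exact on the left after applying `κ ⊗[A] -`. -/
def TorVanishes (A κ M : Type u) [CommRing A] [AddCommGroup κ] [Module A κ]
    [AddCommGroup M] [Module A M] : Prop :=
  ∀ (N' N : Type u) [AddCommGroup N'] [AddCommGroup N] [Module A N'] [Module A N]
    (i : N' →ₗ[A] N) (f : N →ₗ[A] M), Function.Injective i → Function.Exact i f →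
    Function.Surjective f → Function.Injective (i.lTensor κ)

section TorVanishes

variable {A κ M M' M'' : Type u} [CommRing A] [AddCommGroup κ] [Module A κ]
  [AddCommGroup M] [Module A M] [AddCommGroup M'] [Module A M'] [AddCommGroup M''] [Module A M'']

lemma TorVanishes.of_equiv (e : M ≃ₗ[A] M') (h : TorVanishes A κ M) : TorVanishes A κ M' := by
  intro N' N _ _ _ _ i f hi hif hf
  refine h N' N i (e.symm.toLinearMap ∘ₗ f) hi ?_ (e.symm.surjective.comp hf)
  intro x
  simp [hif x]

/-- Vanishing of `Tor₁` is inherited by extensions. -/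
lemma TorVanishes.of_exact (j : M' →ₗ[A] M) (p : M →ₗ[A] M'') (hj : Function.Injective j)
    (hjp : Function.Exact j p) (hp : Function.Surjective p) (h' : TorVanishes A κ M')
    (h'' : TorVanishes A κ M'') : TorVanishes A κ M := by
  intro N' N _ _ _ _ i f hi hif hf
  let N₁ := LinearMap.ker (p ∘ₗ f)
  have hmem : ∀ x : N₁, f x ∈ LinearMap.range j := fun x ↦ (hjp _).1 (LinearMap.mem_ker.1 x.2)
  let f₁ : N₁ →ₗ[A] M' := (LinearEquiv.ofInjective j hj).symm.toLinearMap ∘ₗ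
    (f ∘ₗ N₁.subtype).codRestrict _ hmem
  have hf₁ : ∀ x, j (f₁ x) = f x := fun x ↦ by
    have := LinearEquiv.apply_symm_apply (LinearEquiv.ofInjective j hj) ⟨f x, hmem x⟩
    exact congrArg Subtype.val this
  let i₁ : N' →ₗ[A] N₁ := i.codRestrict _ fun x ↦ by simp [N₁, hif.apply_apply_eq_zero]
  have hi₁ : Function.Injective i₁ := fun x y hxy ↦ hi (congrArg Subtype.val hxy)
  have e₁ : Function.Exact i₁ f₁ := by
    intro x
    rw [← hj.eq_iff, hf₁, map_zero, hif]
    exact ⟨fun ⟨y, hy⟩ ↦ ⟨y, Subtype.ext hy⟩, fun ⟨y, hy⟩ ↦ ⟨y, congrArg Subtype.val hy⟩⟩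
  have s₁ : Function.Surjective f₁ := fun m ↦ by
    obtain ⟨n, hn⟩ := hf (j m)
    refine ⟨⟨n, by simp [N₁, hn, hjp.apply_apply_eq_zero]⟩, hj ?_⟩
    rw [hf₁, hn]
  have H₁ := h' N' N₁ i₁ f₁ hi₁ e₁ s₁
  have H₂ := h'' N₁ N N₁.subtype (p ∘ₗ f) Subtype.val_injective
    (LinearMap.exact_subtype_ker_map _) (hp.comp hf)
  have : i = N₁.subtype ∘ₗ i₁ := rfl
  rw [this, LinearMap.lTensor_comp]
  exact H₂.comp H₁

lemma TorVanishes.of_free [Module.Free A M] : TorVanishes A κ M := by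
  intro N' N _ _ _ _ i f hi hif hf
  obtain ⟨s, hs⟩ := Module.projective_lifting_property f LinearMap.id hf
  -- the section of `f` yields a retraction of `i`
  have hr : ∃ r, r ∘ₗ i = LinearMap.id := ((hif.split_tfae hi hf).out 0 1).1
    (⟨s, hs⟩ : ∃ s, f ∘ₗ s = LinearMap.id)
  obtain ⟨r, hr⟩ := hr
  intro x y hxy
  have := congrArg (r.lTensor κ) hxy
  rw [← LinearMap.comp_apply, ← LinearMap.comp_apply, ← LinearMap.lTensor_comp, hr] at this
  simpa using this

/-- A module killed by an element acting invertibly on `κ` has vanishing `Tor₁`. -/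
lemma TorVanishes.of_smul_eq_zero {κ : Type u} [Field κ] [Algebra A κ] (a : A)
    (ha : algebraMap A κ a ≠ 0) (h : ∀ m : M, a • m = 0) : TorVanishes A κ M := by
  intro M' N _ _ _ _ i f hi hif hf
  have ha : Function.Injective fun x : κ ⊗[A] M' ↦ a • x := by
    intro x y hxy
    have : algebraMap A κ a • x = algebraMap A κ a • y := by simpa using hxy
    exact (smul_right_injective _ ha) this
  have hmem : ∀ x : N, a • x ∈ LinearMap.range i := fun x ↦ (hif _).1 (by simp [h])
  let r : N →ₗ[A] M' := (LinearEquiv.ofInjective i hi).symm.toLinearMap ∘ₗ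
    (a • LinearMap.id).codRestrict _ hmem
  have hr : r ∘ₗ i = a • LinearMap.id := by
    ext x
    apply hi
    have := LinearEquiv.apply_symm_apply (LinearEquiv.ofInjective i hi) ⟨a • i x, hmem _⟩
    rw [LinearMap.smul_apply, LinearMap.id_apply, map_smul]
    exact congrArg Subtype.val this
  intro x y hxy
  have := congrArg (r.lTensor κ) hxy
  rw [← LinearMap.comp_apply, ← LinearMap.comp_apply, ← LinearMap.lTensor_comp, hr] at this
  exact ha (by simpa using! this)

/-- `Tor₁` of an increasing union vanishes if it does for the first term and all successive
quotients. -/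
lemma TorVanishes.of_filtration (P : ℕ → Submodule A M) (hP : Monotone P)
    (htop : ∀ m, ∃ n, m ∈ P n) (h0 : TorVanishes A κ (P 0))
    (hs : ∀ n, TorVanishes A κ (P (n + 1) ⧸ (P n).submoduleOf (P (n + 1)))) :
    TorVanishes A κ M := by
  have hn : ∀ n, TorVanishes A κ (P n) := by
    intro n
    induction n with
    | zero => exact h0
    | succ n ih =>
      refine .of_exact (Submodule.inclusion (hP n.le_succ)) (Submodule.mkQ _)
        (Submodule.inclusion_injective _) ?_ (Submodule.mkQ_surjective _) ih (hs n)
      rw [LinearMap.exact_iff, Submodule.ker_mkQ, Submodule.range_inclusion]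
      rfl
  intro N' N _ _ _ _ i f hi hif hf
  rw [injective_iff_map_eq_zero]
  intro x hx
  -- `x` comes from `κ ⊗ Q₀` with `Q₀ ≤ N'` finitely generated, and dies in `κ ⊗ Q` for some
  -- finitely generated `Q ≤ N`; the latter lies over one of the `P n`
  obtain ⟨Q₀, hQ₀, hx'⟩ := TensorProduct.exists_finite_submodule_right_of_setFinite {x}
    (Set.finite_singleton x)
  obtain ⟨x', rfl⟩ := hx' rfl
  let j : Q₀ →ₗ[A] Q₀.map i := i.submoduleMap Q₀
  have hcomm : ∀ {V W : Type u} [AddCommGroup V] [AddCommGroup W] [Module A V] [Module A W]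
      (g : V →ₗ[A] W) (t : κ ⊗[A] V), g.rTensor κ (TensorProduct.comm A κ V t) =
        TensorProduct.comm A κ W (g.lTensor κ t) := by
    intro V W _ _ _ _ g t
    simp [LinearMap.rTensor, LinearMap.lTensor, TensorProduct.map_comm]
  have h0' : (Q₀.map i).subtype.rTensor κ (TensorProduct.comm A κ _ (j.lTensor κ x')) = 0 := by
    rw [hcomm, ← LinearMap.comp_apply (LinearMap.lTensor κ (Q₀.map i).subtype),
      ← LinearMap.lTensor_comp]
    have : (Q₀.map i).subtype ∘ₗ j = i ∘ₗ Q₀.subtype := rfl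
    rw [this, LinearMap.lTensor_comp, LinearMap.comp_apply, hx, map_zero]
  obtain ⟨Q, hQ₀Q, hQ, hQ0⟩ := TensorProduct.eq_zero_of_fg_of_subtype_eq_zero
    ((Module.Finite.iff_fg.1 hQ₀).map i) h0'
  rw [hcomm, EmbeddingLike.map_eq_zero_iff] at hQ0
  obtain ⟨n, hnQ⟩ : ∃ n, Q ≤ (P n).comap f := by
    obtain ⟨s, rfl⟩ := hQ
    choose d hd using htop
    refine ⟨s.sup fun x ↦ d (f x), Submodule.span_le.2 fun x hx ↦ ?_⟩
    exact hP (Finset.le_sup (f := fun x ↦ d (f x)) hx) (hd (f x))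
  let N₁ := (P n).comap f
  let i₁ : N' →ₗ[A] N₁ := i.codRestrict _ fun x ↦ by
    simp [N₁, hif.apply_apply_eq_zero]
  let f₁ : N₁ →ₗ[A] P n := (f ∘ₗ N₁.subtype).codRestrict _ fun x ↦ x.2
  have H := hn n N' N₁ i₁ f₁ (fun x y hxy ↦ hi (congrArg Subtype.val hxy)) (fun x ↦ by
      rw [← (P n).subtype_injective.eq_iff, map_zero]
      refine (hif _).trans ?_
      exact ⟨fun ⟨y, hy⟩ ↦ ⟨y, Subtype.ext hy⟩, fun ⟨y, hy⟩ ↦ ⟨y, congrArg Subtype.val hy⟩⟩)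
    (fun m ↦ by
      obtain ⟨x, hx⟩ := hf m
      exact ⟨⟨x, by simp [N₁, hx]⟩, Subtype.ext hx⟩)
  apply H
  rw [map_zero, ← LinearMap.comp_apply, ← LinearMap.lTensor_comp]
  have : i₁ ∘ₗ Q₀.subtype =
    Submodule.inclusion hnQ ∘ₗ Submodule.inclusion hQ₀Q ∘ₗ j := rfl
  rw [this, LinearMap.lTensor_comp, LinearMap.lTensor_comp, LinearMap.comp_apply,
    LinearMap.comp_apply, hQ0, map_zero]

end TorVanishes

/-- The generic vanishing of `Tor₁` for all finite modules over an algebra `B` over a domain `A`: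
for each `M` there is a nonzero `a : A` such that `Tor₁^A(κ, M) = 0` for all `A`-fields `κ` in which
`a` is nonzero. -/
def GenericTorVanishes (A B : Type u) [CommRing A] [CommRing B] [Algebra A B] : Prop :=
  ∀ (M : Type u) [AddCommGroup M] [Module A M] [Module B M] [IsScalarTower A B M]
    [Module.Finite B M], ∃ a : A, a ≠ 0 ∧ ∀ (κ : Type u) [Field κ] [Algebra A κ],
      algebraMap A κ a ≠ 0 → TorVanishes A κ M

section Generic

variable {A : Type u} [CommRing A]

/-- By dévissage it suffices to deal with the modules `A ⧸ p` for prime ideals `p`: if `p = 0` the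
module is free, otherwise it is killed by a nonzero element of `A`. -/
lemma genericTorVanishes_self (A : Type u) [CommRing A] [IsDomain A]
    [IsNoetherianRing A] : GenericTorVanishes A A := by
  intro M _ inst₁ inst₂ htower _
  have hinst : inst₁ = inst₂ := by
    ext r m
    have := htower.smul_assoc r (1 : A) m
    rw [smul_eq_mul, mul_one, one_smul] at this
    exact this.symm
  subst hinst
  have hM : Module.Finite A M := inferInstance
  induction hM using IsNoetherianRing.induction_on_isQuotientEquivQuotientPrime A with
  | subsingleton N =>
    exact ⟨1, one_ne_zero, fun κ _ _ h ↦ .of_smul_eq_zero 1 h fun m ↦ Subsingleton.elim _ _⟩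
  | quotient N p e =>
    by_cases hp : p.asIdeal = ⊥
    · refine ⟨1, one_ne_zero, fun κ _ _ h ↦ ?_⟩
      have e' : N ≃ₗ[A] A := e.trans
        ((Submodule.quotEquivOfEq _ _ hp).trans (Submodule.quotEquivOfEqBot ⊥ rfl))
      have := Module.Free.of_equiv e'.symm
      exact .of_free
    · obtain ⟨a, hap, ha⟩ := Submodule.exists_mem_ne_zero_of_ne_bot hp
      refine ⟨a, ha, fun κ _ _ h ↦ .of_smul_eq_zero a h fun m ↦ ?_⟩
      apply e.injective
      obtain ⟨x, hx⟩ := Ideal.Quotient.mk_surjective (e m)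
      rw [map_smul, map_zero, ← hx]
      exact Ideal.Quotient.eq_zero_iff_mem.2 (Ideal.mul_mem_right _ _ hap)
  | exact N₁ N₂ N₃ f g hf hg hfg h₁ h₃ =>
    obtain ⟨a, ha, h₁⟩ := h₁
    obtain ⟨b, hb, h₃⟩ := h₃
    refine ⟨a * b, mul_ne_zero ha hb, fun κ _ _ h ↦ ?_⟩
    rw [map_mul, mul_ne_zero_iff] at h
    exact .of_exact f g hf hfg hg (h₁ κ h.1) (h₃ κ h.2)

lemma GenericTorVanishes.of_surjective {B C : Type u} [CommRing B] [CommRing C] [Algebra A B]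
    [Algebra A C] (f : B →ₐ[A] C) (hf : Function.Surjective f) (h : GenericTorVanishes A B) :
    GenericTorVanishes A C := by
  intro M _ _ _ _ _
  let : Module B M := Module.compHom M f.toRingHom
  let : Algebra B C := f.toRingHom.toAlgebra
  have : IsScalarTower B C M := ⟨fun b c m ↦ by
    rw [Algebra.smul_def, mul_smul]; rfl⟩
  have : IsScalarTower A B M := ⟨fun a b m ↦ by
    change f (a • b) • m = a • (f b • m)
    rw [map_smul, smul_assoc]⟩
  have : Module.Finite B C := .of_surjective (Algebra.linearMap B C) hf
  have : Module.Finite B M := .trans C M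
  exact h M

/-- The inductive step of generic flatness: `M` is the union of the `B`-modules `P n` spanned by the
`X ^ i • M₀`, `i ≤ n`, for a finite `B`-module `M₀` generating `M`. The successive quotients are
`M₀ / K n` for an increasing and hence stationary sequence `K n`, so only finitely many modules
over `B` have to be dealt with. -/
lemma GenericTorVanishes.polynomial [IsDomain A] {B : Type u} [CommRing B] [IsNoetherianRing B]
    [Algebra A B]
    (h : GenericTorVanishes A B) : GenericTorVanishes A (Polynomial B) := by
  intro M _ _ _ _ _
  let : Module B M := Module.compHom M (Polynomial.C : B →+* Polynomial B)
  have hC : ∀ (b : B) (m : M), b • m = (Polynomial.C b : Polynomial B) • m := fun _ _ ↦ rfl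
  have : IsScalarTower B (Polynomial B) M := ⟨fun b c m ↦ by
    rw [hC, Polynomial.smul_eq_C_mul, mul_smul]⟩
  have : IsScalarTower A B M := ⟨fun a b m ↦ by
    rw [hC, hC, ← smul_assoc a, ← Polynomial.smul_C]⟩
  let x : M →ₗ[B] M := Module.toModuleEnd B (S := Polynomial B) M Polynomial.X
  have hx : ∀ m, x m = (Polynomial.X : Polynomial B) • m := fun _ ↦ rfl
  have hxn : ∀ n m, (x ^ n) m = (Polynomial.X ^ n : Polynomial B) • m := by
    intro n
    induction n with
    | zero => simp
    | succ n ih => intro m; rw [pow_succ', Module.End.mul_apply, ih, hx, pow_succ', mul_smul]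
  obtain ⟨s, hs⟩ := (Module.Finite.fg_top : (⊤ : Submodule (Polynomial B) M).FG)
  let M₀ : Submodule B M := Submodule.span B s
  have : Module.Finite B M₀ := .span_finset B s
  obtain ⟨P, hP0, hPs⟩ : ∃ P : ℕ → Submodule B M, P 0 = M₀ ∧
      ∀ n, P (n + 1) = P n ⊔ M₀.map (x ^ (n + 1)) :=
    ⟨fun n ↦ Nat.rec M₀ (fun n Q ↦ Q ⊔ M₀.map (x ^ (n + 1))) n, rfl, fun _ ↦ rfl⟩
  have hmono : Monotone P := monotone_nat_of_le_succ fun n ↦ (hPs n).ge.trans' le_sup_left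
  have hxP : ∀ n, (P n).map x ≤ P (n + 1) := by
    intro n
    induction n with
    | zero =>
      rw [hPs, hP0]
      simp
    | succ n ih =>
      rw [hPs, Submodule.map_sup, hPs (n + 1), ← Submodule.map_comp]
      refine sup_le_sup ih (le_of_eq ?_)
      rw [pow_succ' x (n + 1)]
      rfl
  have hmem : ∀ n, ∀ m ∈ M₀, (x ^ n) m ∈ P n := by
    intro n m hm
    cases n with
    | zero => simpa [hP0] using hm
    | succ n => rw [hPs]; exact Submodule.mem_sup_right ⟨m, hm, rfl⟩
  have htop : ∀ m, ∃ n, m ∈ P n := by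
    intro m
    have hm : m ∈ Submodule.span (Polynomial B) (s : Set M) := hs ▸ Submodule.mem_top
    have hadd : ∀ m₁ m₂ : M, (∃ n, m₁ ∈ P n) → (∃ n, m₂ ∈ P n) → ∃ n, m₁ + m₂ ∈ P n := by
      rintro m₁ m₂ ⟨n₁, h₁⟩ ⟨n₂, h₂⟩
      exact ⟨max n₁ n₂, add_mem (hmono (le_max_left _ _) h₁) (hmono (le_max_right _ _) h₂)⟩
    induction hm using Submodule.span_induction with
    | mem m hm => exact ⟨0, hP0 ▸ Submodule.subset_span hm⟩
    | zero => exact ⟨0, zero_mem _⟩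
    | add m₁ m₂ _ _ h₁ h₂ => exact hadd _ _ h₁ h₂
    | smul q m _ hm =>
      induction q using Polynomial.induction_on' with
      | add p q hp hq => rw [add_smul]; exact hadd _ _ hp hq
      | monomial i b =>
        obtain ⟨n, hn⟩ := hm
        refine ⟨n + i, ?_⟩
        rw [← Polynomial.C_mul_X_pow_eq_monomial, mul_smul, ← hC]
        refine Submodule.smul_mem _ _ ?_
        induction i with
        | zero => simpa using hn
        | succ i ih => rw [pow_succ', mul_smul, ← hx]; exact hxP _ ⟨_, ih, rfl⟩
  let K : ℕ →o Submodule B M₀ :=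
    ⟨fun n ↦ (P n).comap ((x ^ (n + 1)) ∘ₗ M₀.subtype), monotone_nat_of_le_succ fun n m hm ↦ by
      have hm' : (x ^ (n + 1)) m ∈ P n := hm
      change (x ^ (n + 1 + 1)) m ∈ P (n + 1)
      rw [pow_succ', Module.End.mul_apply]
      exact hxP n ⟨_, hm', rfl⟩⟩
  obtain ⟨N, hN⟩ := monotone_stabilizes_iff_noetherian.2 (inferInstance : IsNoetherian B M₀) K
  have hquot : ∀ n, Nonempty ((M₀ ⧸ K n) ≃ₗ[B] (P (n + 1) ⧸ (P n).submoduleOf (P (n + 1)))) := by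
    intro n
    let g : M₀ →ₗ[B] P (n + 1) := ((x ^ (n + 1)) ∘ₗ M₀.subtype).codRestrict _ fun m ↦
      hmem (n + 1) m m.2
    let g' := (Submodule.mkQ ((P n).submoduleOf (P (n + 1)))) ∘ₗ g
    have hker : LinearMap.ker g' = K n := by
      rw [LinearMap.ker_comp, Submodule.ker_mkQ]
      rfl
    have hsurj : Function.Surjective g' := by
      intro y
      obtain ⟨⟨y, hy⟩, rfl⟩ := Submodule.mkQ_surjective _ y
      rw [hPs] at hy
      obtain ⟨y₁, hy₁, _, ⟨m, hm, rfl⟩, rfl⟩ := Submodule.mem_sup.1 hy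
      refine ⟨⟨m, hm⟩, ?_⟩
      rw [← sub_eq_zero, LinearMap.comp_apply, ← map_sub, Submodule.mkQ_apply,
        Submodule.Quotient.mk_eq_zero]
      change _ - _ ∈ P n
      change (x ^ (n + 1)) m - (y₁ + (x ^ (n + 1)) m) ∈ P n
      simpa using hy₁
    exact ⟨(Submodule.quotEquivOfEq _ _ hker.symm).trans (g'.quotKerEquivOfSurjective hsurj)⟩
  obtain ⟨a₀, ha₀, H₀⟩ := h M₀
  have hK : ∀ n, ∃ a : A, a ≠ 0 ∧ ∀ (κ : Type u) [Field κ] [Algebra A κ],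
      algebraMap A κ a ≠ 0 → TorVanishes A κ (M₀ ⧸ K n) := fun n ↦ h (M₀ ⧸ K n)
  choose a ha H using hK
  refine ⟨a₀ * ∏ n ∈ Finset.range (N + 1), a n,
    mul_ne_zero ha₀ (Finset.prod_ne_zero_iff.2 fun n _ ↦ ha n), fun κ _ _ hκ ↦ ?_⟩
  rw [map_mul, mul_ne_zero_iff, map_prod, Finset.prod_ne_zero_iff] at hκ
  refine .of_filtration (fun n ↦ (P n).restrictScalars A) hmono htop
    (.of_equiv (LinearEquiv.ofEq _ _ (by rw [hP0])) (H₀ κ hκ.1)) fun n ↦ ?_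
  obtain ⟨e⟩ := hquot n
  refine .of_equiv (e.restrictScalars A) ?_
  by_cases hn : n ≤ N
  · exact H n κ (hκ.2 n (by simpa using! Nat.lt_succ_of_le hn))
  · rw [← hN n (le_of_not_ge hn)]
    exact H N κ (hκ.2 N (by simp))

/-- **Generic flatness**, in the form of generic vanishing of `Tor₁`. -/
theorem genericTorVanishes (A B : Type u) [CommRing A] [IsDomain A] [IsNoetherianRing A]
    [CommRing B] [Algebra A B] [Algebra.FiniteType A B] : GenericTorVanishes A B := by
  have hpoly : ∀ n : ℕ, GenericTorVanishes A (MvPolynomial (Fin n) A) := by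
    intro n
    induction n with
    | zero =>
      exact (genericTorVanishes_self A).of_surjective
        (MvPolynomial.isEmptyAlgEquiv A (Fin 0)).symm.toAlgHom (AlgEquiv.surjective _)
    | succ n ih =>
      exact ih.polynomial.of_surjective (MvPolynomial.finSuccEquiv A n).symm.toAlgHom
        (AlgEquiv.surjective _)
  obtain ⟨n, f, hf⟩ := Algebra.FiniteType.iff_quotient_mvPolynomial''.1 ‹Algebra.FiniteType A B›
  exact (hpoly n).of_surjective f hf

end Generic

/-! ### Exactness and étale coordinates on general fibres -/

section GenericExactness

variable {A : Type u} [CommRing A]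

/-- Right exactness together with `Tor₁(κ, coker v) = 0` gives exactness in the middle. -/
lemma TorVanishes.lTensor_exact {κ M N P : Type u} [AddCommGroup κ] [Module A κ]
    [AddCommGroup M] [Module A M] [AddCommGroup N] [Module A N] [AddCommGroup P] [Module A P]
    (u : M →ₗ[A] N) (v : N →ₗ[A] P) (huv : Function.Exact u v)
    (h : TorVanishes A κ (P ⧸ LinearMap.range v)) :
    Function.Exact (u.lTensor κ) (v.lTensor κ) := by
  have h₁ : Function.Exact (u.lTensor κ) (v.rangeRestrict.lTensor κ) := by
    refine _root_.lTensor_exact κ ?_ v.surjective_rangeRestrict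
    intro x
    rw [← huv x]
    exact Subtype.ext_iff
  have h₂ : Function.Injective ((LinearMap.range v).subtype.lTensor κ) :=
    h _ _ (LinearMap.range v).subtype (Submodule.mkQ _) Subtype.val_injective
      (by rw [LinearMap.exact_iff]; simp) (Submodule.mkQ_surjective _)
  have hv' : ∀ x, v.lTensor κ x =
      (LinearMap.range v).subtype.lTensor κ (v.rangeRestrict.lTensor κ x) := fun x ↦ by
    rw [← LinearMap.comp_apply, ← LinearMap.lTensor_comp]
    rfl
  intro x
  rw [hv', map_eq_zero_iff _ h₂]
  exact h₁ x

variable [IsDomain A] [IsNoetherianRing A] {B : Type u} [CommRing B] [Algebra A B]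
  [Algebra.FiniteType A B]

/-- Exactness of a sequence of modules over a finite type algebra persists on general fibres. -/
lemma exists_lTensor_exact {M N P : Type u} [AddCommGroup M] [Module A M]
    [AddCommGroup N] [Module A N] [Module B N] [IsScalarTower A B N]
    [AddCommGroup P] [Module A P] [Module B P] [IsScalarTower A B P] [Module.Finite B P]
    (u : M →ₗ[A] N) (v : N →ₗ[B] P) (huv : Function.Exact u v) :
    ∃ a : A, a ≠ 0 ∧ ∀ (κ : Type u) [Field κ] [Algebra A κ], algebraMap A κ a ≠ 0 →
      Function.Exact (u.lTensor κ) ((v.restrictScalars A).lTensor κ) := by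
  obtain ⟨a, ha, h⟩ := genericTorVanishes A B (P ⧸ LinearMap.range v)
  refine ⟨a, ha, fun κ _ _ hκ ↦ TorVanishes.lTensor_exact u (v.restrictScalars A) huv ?_⟩
  exact .of_equiv (LinearEquiv.refl A (P ⧸ LinearMap.range v)) (h κ hκ)

/-- Injectivity of a map of modules over a finite type algebra persists on general fibres. -/
lemma exists_lTensor_injective {N P : Type u}
    [AddCommGroup N] [Module A N] [Module B N] [IsScalarTower A B N]
    [AddCommGroup P] [Module A P] [Module B P] [IsScalarTower A B P] [Module.Finite B P]
    (v : N →ₗ[B] P) (hv : Function.Injective v) :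
    ∃ a : A, a ≠ 0 ∧ ∀ (κ : Type u) [Field κ] [Algebra A κ], algebraMap A κ a ≠ 0 →
      Function.Injective ((v.restrictScalars A).lTensor κ) := by
  obtain ⟨a, ha, h⟩ := exists_lTensor_exact (A := A) (B := B) (0 : PUnit.{u + 1} →ₗ[A] N) v
    (fun x ↦ by simp [map_eq_zero_iff v hv, eq_comm])
  refine ⟨a, ha, fun κ _ _ hκ ↦ ?_⟩
  rw [injective_iff_map_eq_zero]
  intro x hx
  obtain ⟨y, rfl⟩ := (h κ hκ x).1 hx
  simp

/-- Nonzerodivisors persist on general fibres. -/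
lemma exists_tmul_mem_nonZeroDivisors (g : B) (hg : g ∈ nonZeroDivisors B) :
    ∃ a : A, a ≠ 0 ∧ ∀ (κ : Type u) [Field κ] [Algebra A κ], algebraMap A κ a ≠ 0 →
      (1 ⊗ₜ g : κ ⊗[A] B) ∈ nonZeroDivisors (κ ⊗[A] B) := by
  obtain ⟨a, ha, h⟩ := exists_lTensor_injective (A := A) (B := B) (LinearMap.mulLeft B g)
    (fun x y hxy ↦ (mul_cancel_left_mem_nonZeroDivisors hg).1 hxy)
  refine ⟨a, ha, fun κ _ _ hκ ↦ ?_⟩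
  have hmul : ∀ x : κ ⊗[A] B,
      ((LinearMap.mulLeft B g).restrictScalars A).lTensor κ x = 1 ⊗ₜ g * x := by
    intro x
    induction x with
    | zero => simp
    | tmul c b => simp
    | add x y hx hy => rw [map_add, hx, hy, mul_add]
  rw [mem_nonZeroDivisors_iff_right]
  intro x hx
  refine (injective_iff_map_eq_zero _).1 (h κ hκ) x ?_
  rw [hmul, mul_comm, hx]

/-- The image of a dominant morphism of finite type contains a nonempty open subset, so that
general fibres are nonempty. -/
lemma exists_nontrivial_tensor_of_injective
    (h : Function.Injective (algebraMap A B)) :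
    ∃ a : A, a ≠ 0 ∧ ∀ (κ : Type u) [Field κ] [Algebra A κ], algebraMap A κ a ≠ 0 →
      Nontrivial (κ ⊗[A] B) := by
  have hfp : Algebra.FinitePresentation A B :=
    Algebra.FinitePresentation.of_finiteType.1 inferInstance
  obtain ⟨S, hS⟩ := PrimeSpectrum.exists_constructibleSetData_iff.2
    (PrimeSpectrum.isConstructible_range_comap
      (RingHom.finitePresentation_algebraMap.2 hfp))
  have hbot : (⊥ : PrimeSpectrum A) ∈ Set.range (PrimeSpectrum.comap (algebraMap A B)) := by
    rw [PrimeSpectrum.mem_range_comap_iff]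
    simp only [PrimeSpectrum.asIdeal_bot, Ideal.map_bot]
    rw [← RingHom.ker_eq_comap_bot, (RingHom.injective_iff_ker_eq_bot _).1 h]
  rw [← hS] at hbot
  simp only [PrimeSpectrum.ConstructibleSetData.toSet, Set.mem_iUnion] at hbot
  obtain ⟨C, hC, hbot⟩ := hbot
  refine ⟨C.f, by simpa using! hbot.2, fun κ _ _ hκ ↦ ?_⟩
  let q : PrimeSpectrum A := ⟨RingHom.ker (algebraMap A κ), RingHom.ker_isPrime _⟩
  have : q.asIdeal.IsPrime := q.isPrime
  have hq : q ∈ Set.range (PrimeSpectrum.comap (algebraMap A B)) := by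
    rw [← hS]
    simp only [PrimeSpectrum.ConstructibleSetData.toSet, Set.mem_iUnion]
    refine ⟨C, hC, ?_, by simpa [q] using! hκ⟩
    rw [PrimeSpectrum.mem_zeroLocus]
    exact ((PrimeSpectrum.mem_zeroLocus _ _).1 hbot.1).trans (bot_le (a := q.asIdeal))
  rw [← PrimeSpectrum.nontrivial_iff_mem_rangeComap] at hq
  let φ : q.asIdeal.ResidueField →+* κ := Ideal.ResidueField.lift q.asIdeal (algebraMap A κ)
    le_rfl (fun x hx ↦ (IsUnit.mk0 _ fun h ↦ hx h : IsUnit (algebraMap A κ x)))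
  let := φ.toAlgebra
  have : IsScalarTower A q.asIdeal.ResidueField κ := .of_algebraMap_eq fun x ↦ by
    exact (Ideal.ResidueField.lift_algebraMap (I := q.asIdeal) _ _ _ x).symm
  have hn : Nontrivial (κ ⊗[q.asIdeal.ResidueField] (q.asIdeal.ResidueField ⊗[A] B)) :=
    inferInstance
  exact (Algebra.TensorProduct.cancelBaseChange A q.asIdeal.ResidueField κ κ
    B).symm.toEquiv.nontrivial

/-- A module with an `A`-torsion-free element has nonzero general fibres. -/
lemma exists_nontrivial_tensor {M : Type u} [AddCommGroup M] [Module A M] [Module B M]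
    [IsScalarTower A B M] [Module.Finite B M] (m : M) (hm : ∀ a : A, a • m = 0 → a = 0) :
    ∃ a : A, a ≠ 0 ∧ ∀ (κ : Type u) [Field κ] [Algebra A κ], algebraMap A κ a ≠ 0 →
      Nontrivial (κ ⊗[A] M) := by
  let I : Ideal B := LinearMap.ker (LinearMap.toSpanSingleton B M m)
  let v : (B ⧸ I) →ₗ[B] M := I.liftQ (LinearMap.toSpanSingleton B M m) le_rfl
  have hv : Function.Injective v := by
    rw [← LinearMap.ker_eq_bot]
    exact Submodule.ker_liftQ_eq_bot _ _ _ le_rfl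
  have hinj : Function.Injective (algebraMap A (B ⧸ I)) := by
    rw [injective_iff_map_eq_zero]
    intro a ha
    apply hm
    have : algebraMap A B a ∈ I := Ideal.Quotient.eq_zero_iff_mem.1 ha
    simpa [I] using this
  obtain ⟨a, ha, h⟩ := exists_lTensor_injective (A := A) (B := B) v hv
  obtain ⟨b, hb, h'⟩ := exists_nontrivial_tensor_of_injective (A := A) (B := B ⧸ I) hinj
  refine ⟨a * b, mul_ne_zero ha hb, fun κ _ _ hκ ↦ ?_⟩
  rw [map_mul, mul_ne_zero_iff] at hκ
  have := h' κ hκ.2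
  exact (h κ hκ.1).nontrivial

end GenericExactness

section Etale

/-- An étale algebra over a domain is reduced. -/
lemma isReduced_of_etale (R S : Type u) [CommRing R] [IsDomain R] [CommRing S] [Algebra R S]
    [Algebra.Etale R S] : IsReduced S := by
  let E := FractionRing R
  have : IsReduced (E ⊗[R] S) := Algebra.FormallyUnramified.isReduced_of_field E (E ⊗[R] S)
  have hflat : Module.Flat R S := inferInstance
  exact isReduced_of_injective (Algebra.TensorProduct.includeRight : S →ₐ[R] E ⊗[R] S)
    (Algebra.TensorProduct.includeRight_injective (IsFractionRing.injective R E))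

/-- A domain which is étale over an integrally closed domain is integrally closed. -/
lemma isIntegrallyClosed_of_etale (R S : Type u) [CommRing R] [IsDomain R] [IsIntegrallyClosed R]
    [CommRing S] [IsDomain S] [Algebra R S] [Algebra.Etale R S] : IsIntegrallyClosed S := by
  let E := FractionRing R
  let L := S ⊗[R] E
  have hinj : Function.Injective (algebraMap R S) :=
    FaithfulSMul.algebraMap_injective R S
  have hloc : IsLocalization (Algebra.algebraMapSubmonoid S (nonZeroDivisors R)) L :=
    inferInstance
  have hle : Algebra.algebraMapSubmonoid S (nonZeroDivisors R) ≤ nonZeroDivisors S := by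
    rintro _ ⟨x, hx, rfl⟩
    exact mem_nonZeroDivisors_of_ne_zero
      ((map_ne_zero_iff _ hinj).2 (nonZeroDivisors.ne_zero hx))
  have hdom : IsDomain L := IsLocalization.isDomain_of_le_nonZeroDivisors L hle
  let e : E ⊗[R] S ≃ₐ[R] L := Algebra.TensorProduct.comm R E S
  have hdom' : IsDomain (E ⊗[R] S) := e.toMulEquiv.isDomain _
  have hfin : Module.Finite E (E ⊗[R] S) := Algebra.FormallyUnramified.finite_of_free E _
  have hfield : IsField (E ⊗[R] S) :=
    isField_of_isIntegral_of_isField' (Field.toIsField E)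
  have hfield' : IsField L := e.symm.toMulEquiv.isField hfield
  have hunit : ∀ y : nonZeroDivisors S, IsUnit (algebraMap S L y) := by
    intro y
    have hy : algebraMap S L y ≠ 0 := (map_ne_zero_iff _ (IsLocalization.injective L hle)).2
      (nonZeroDivisors.ne_zero y.2)
    obtain ⟨z, hz⟩ := hfield'.mul_inv_cancel hy
    exact .of_mul_eq_one _ hz
  have hfrac : IsFractionRing S L :=
    .of_le _ _ hle fun y hy ↦ hunit ⟨y, hy⟩
  rw [isIntegrallyClosed_iff L]
  intro x hx
  obtain ⟨y, hy⟩ := (TensorProduct.toIntegralClosure_bijective_of_smooth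
    (R := R) (S := S) (B := E)).2 ⟨x, hx⟩
  have hy' : (Algebra.TensorProduct.map (.id S S) (integralClosure R E).val) y = x :=
    congrArg Subtype.val hy
  rw [← hy']
  clear hy hy' hx
  induction y with
  | zero => exact ⟨0, by simp⟩
  | add y z hy hz =>
    obtain ⟨a, ha⟩ := hy
    obtain ⟨b, hb⟩ := hz
    exact ⟨a + b, by rw [map_add, map_add, ha, hb]⟩
  | tmul s r =>
    obtain ⟨r', hr'⟩ := (isIntegrallyClosed_iff E).1 inferInstance r.2
    refine ⟨r' • s, ?_⟩
    rw [Algebra.TensorProduct.map_tmul, AlgHom.id_apply, Subalgebra.coe_val, ← hr',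
      Algebra.algebraMap_eq_smul_one r', TensorProduct.tmul_smul, TensorProduct.smul_tmul']
    rfl

/-- A dominant morphism of finite type of integral affine schemes in characteristic zero is, over
a dense open subset of the source, étale over an affine space. -/
lemma exists_isStandardEtale_mvPolynomial (A B : Type u) [CommRing A] [IsDomain A] [CharZero A]
    [IsNoetherianRing A] [CommRing B] [IsDomain B] [Algebra A B] [Algebra.FiniteType A B]
    (h : Function.Injective (algebraMap A B)) :
    ∃ g : B, g ≠ 0 ∧ ∃ (n : ℕ) (_ : Algebra (MvPolynomial (Fin n) A) (Localization.Away g)),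
      IsScalarTower A (MvPolynomial (Fin n) A) (Localization.Away g) ∧
      Algebra.IsStandardEtale (MvPolynomial (Fin n) A) (Localization.Away g) := by
  have hfp : Algebra.FinitePresentation A B :=
    Algebra.FinitePresentation.of_finiteType.1 inferInstance
  have : Algebra.IsSmoothAt A (⊥ : Ideal B) := by
    let K := FractionRing A
    let L := FractionRing B
    have : FaithfulSMul A B := (faithfulSMul_iff_algebraMap_injective A B).2 h
    have : CharZero K := charZero_of_injective_algebraMap (IsFractionRing.injective A K)
    let : Algebra K L := FractionRing.liftAlgebra A L
    have : IsScalarTower A K L := FractionRing.isScalarTower_liftAlgebra A L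
    have : Algebra.FormallySmooth A K := .of_isLocalization (nonZeroDivisors A)
    have : Algebra.EssFiniteType B L := .of_isLocalization L (nonZeroDivisors B)
    have : Algebra.EssFiniteType A L := .comp A B L
    have : Algebra.EssFiniteType K L := .of_comp A K L
    have : Algebra.FormallySmooth A L := .comp A K L
    have hbot : (⊥ : Ideal B).primeCompl = nonZeroDivisors B := by
      ext x; simp [Ideal.primeCompl, mem_nonZeroDivisors_iff_ne_zero]
    have : IsLocalization (⊥ : Ideal B).primeCompl L := by
      rw [hbot]; infer_instance
    exact .of_equiv ((IsLocalization.algEquiv (⊥ : Ideal B).primeCompl L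
      (Localization.AtPrime (⊥ : Ideal B))).restrictScalars A)
  obtain ⟨f, hf, n, i, h₁, h₂⟩ :=
    Algebra.IsSmoothAt.exists_isStandardEtale_mvPolynomial (R := A) (p := (⊥ : Ideal B))
  exact ⟨f, hf, n, i, h₁, h₂⟩

lemma exists_etale_mvPolynomial (A B : Type u) [CommRing A] [IsDomain A] [CharZero A]
    [IsNoetherianRing A] [CommRing B] [IsDomain B] [Algebra A B] [Algebra.FiniteType A B]
    (h : Function.Injective (algebraMap A B)) :
    ∃ g : B, g ≠ 0 ∧ ∃ (n : ℕ) (_ : Algebra (MvPolynomial (Fin n) A) (Localization.Away g)),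
      IsScalarTower A (MvPolynomial (Fin n) A) (Localization.Away g) ∧
      Algebra.Etale (MvPolynomial (Fin n) A) (Localization.Away g) := by
  obtain ⟨f, hf, n, i, h₁, h₂⟩ := exists_isStandardEtale_mvPolynomial A B h
  exact ⟨f, hf, n, i, h₁, inferInstance⟩

variable (A κ C : Type u) [CommRing A] [Field κ] [Algebra A κ] [CommRing C] [Algebra A C]

/-- The fibres of an algebra étale over affine `n`-space are étale over affine `n`-space. -/
lemma exists_ringEquiv_etale_mvPolynomial
    (n : ℕ) [Algebra (MvPolynomial (Fin n) A) C] [IsScalarTower A (MvPolynomial (Fin n) A) C]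
    [Algebra.Etale (MvPolynomial (Fin n) A) C] :
    ∃ (S : Type u) (_ : CommRing S) (_ : Algebra (MvPolynomial (Fin n) κ) S),
      Algebra.Etale (MvPolynomial (Fin n) κ) S ∧ Nonempty (S ≃+* κ ⊗[A] C) := by
  let P := MvPolynomial (Fin n) A
  let e : P ⊗[A] κ ≃+* MvPolynomial (Fin n) κ :=
    (Algebra.TensorProduct.comm A P κ).toRingEquiv.trans
      (MvPolynomial.algebraTensorAlgEquiv A κ).toRingEquiv
  let S := (P ⊗[A] κ) ⊗[P] C
  let i : Algebra (MvPolynomial (Fin n) κ) S :=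
    ((algebraMap (P ⊗[A] κ) S).comp e.symm.toRingHom).toAlgebra
  refine ⟨S, inferInstance, i, ?_, ⟨?_⟩⟩
  · have h₁ : (algebraMap (P ⊗[A] κ) S).Etale := RingHom.etale_algebraMap.2 inferInstance
    exact RingHom.Etale.stableUnderComposition _ _ (.of_bijective e.symm.bijective) h₁
  · exact (Algebra.TensorProduct.comm P (P ⊗[A] κ) C).toRingEquiv.trans
      ((Algebra.TensorProduct.cancelBaseChange A P P C κ).toRingEquiv.trans
        (Algebra.TensorProduct.comm A C κ).toRingEquiv)

lemma isReduced_tensor_of_etale_mvPolynomial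
    (n : ℕ) [Algebra (MvPolynomial (Fin n) A) C] [IsScalarTower A (MvPolynomial (Fin n) A) C]
    [Algebra.Etale (MvPolynomial (Fin n) A) C] :
    IsReduced (κ ⊗[A] C) := by
  obtain ⟨S, _, _, _, ⟨e⟩⟩ := exists_ringEquiv_etale_mvPolynomial A κ C n
  have := isReduced_of_etale (MvPolynomial (Fin n) κ) S
  exact isReduced_of_injective e.symm e.symm.injective

lemma isIntegrallyClosed_tensor_of_etale_mvPolynomial
    (n : ℕ) [Algebra (MvPolynomial (Fin n) A) C] [IsScalarTower A (MvPolynomial (Fin n) A) C]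
    [Algebra.Etale (MvPolynomial (Fin n) A) C]
    [IsDomain (κ ⊗[A] C)] :
    IsIntegrallyClosed (κ ⊗[A] C) := by
  obtain ⟨S, _, _, _, ⟨e⟩⟩ := exists_ringEquiv_etale_mvPolynomial A κ C n
  have : IsDomain S := e.toMulEquiv.isDomain _
  have := isIntegrallyClosed_of_etale (MvPolynomial (Fin n) κ) S
  exact .of_equiv e

end Etale

/-! ### Reducedness of general fibres -/

section Reduced

/-- Localising a fibre at (the image of) `g` is the fibre of the localisation. -/
lemma isLocalization_away_tensor (A κ B : Type u) [CommRing A] [CommRing κ] [Algebra A κ]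
    [CommRing B] [Algebra A B] (g : B) (C : Type u) [CommRing C] [Algebra A C] [Algebra B C]
    [IsScalarTower A B C] [IsLocalization.Away g C] :
    @IsLocalization.Away (κ ⊗[A] B) _ (1 ⊗ₜ g) (κ ⊗[A] C) _
      (Algebra.TensorProduct.map (AlgHom.id A κ) (IsScalarTower.toAlgHom A B C)).toAlgebra := by
  let : Algebra (κ ⊗[A] B) (κ ⊗[A] C) :=
    (Algebra.TensorProduct.map (AlgHom.id A κ) (IsScalarTower.toAlgHom A B C)).toAlgebra
  have : IsScalarTower κ (κ ⊗[A] B) (κ ⊗[A] C) :=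
    .of_algebraMap_eq <| by intro; simp [RingHom.algebraMap_toAlgebra]
  have := IsLocalization.tensorProduct_tensorProduct_right A κ (Submonoid.powers g) C
    (by ext; simp [RingHom.algebraMap_toAlgebra])
  rwa [Submonoid.map_powers] at this

variable (A : Type u) [CommRing A] [IsDomain A] [CharZero A] [IsNoetherianRing A]

/-- Some localization of `B` is étale over an affine space over `A`, so that its fibres are reduced,
and the general fibres of `B` embed into them. -/
lemma exists_isReduced_tensor_of_isDomain (B : Type u) [CommRing B] [IsDomain B] [Algebra A B]
    [Algebra.FiniteType A B] :
    ∃ a : A, a ≠ 0 ∧ ∀ (κ : Type u) [Field κ] [Algebra A κ], algebraMap A κ a ≠ 0 →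
      IsReduced (κ ⊗[A] B) := by
  by_cases h : Function.Injective (algebraMap A B)
  · obtain ⟨g, hg, n, _, _, _⟩ := exists_etale_mvPolynomial A B h
    obtain ⟨a, ha, H⟩ := exists_tmul_mem_nonZeroDivisors (A := A) g
        (mem_nonZeroDivisors_of_ne_zero hg)
    refine ⟨a, ha, fun κ _ _ hκ ↦ ?_⟩
    have := isReduced_tensor_of_etale_mvPolynomial A κ (Localization.Away g) n
    let := (Algebra.TensorProduct.map (AlgHom.id A κ)
      (IsScalarTower.toAlgHom A B (Localization.Away g))).toAlgebra
    have hloc := isLocalization_away_tensor A κ B g (Localization.Away g)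
    refine isReduced_of_injective (algebraMap (κ ⊗[A] B) (κ ⊗[A] Localization.Away g))
      (IsLocalization.injective _ (Submonoid.powers_le.2 (H κ hκ)))
  · rw [injective_iff_map_eq_zero] at h
    push Not at h
    obtain ⟨a, ha, ha'⟩ := h
    refine ⟨a, ha', fun κ _ _ hκ ↦ ?_⟩
    have : Subsingleton (κ ⊗[A] B) := by
      refine subsingleton_of_zero_eq_one ?_
      have : (algebraMap A κ a)⁻¹ ⊗ₜ[A] (a • 1 : B) = 1 := by
        rw [← TensorProduct.smul_tmul, Algebra.smul_def, mul_inv_cancel₀ hκ]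
        rfl
      rw [← this, ← Algebra.algebraMap_eq_smul_one, ha, TensorProduct.tmul_zero]
    infer_instance

/-- In characteristic zero, reducedness persists on general fibres. -/
lemma exists_isReduced_tensor (B : Type u) [CommRing B] [IsReduced B] [Algebra A B]
    [Algebra.FiniteType A B] :
    ∃ a : A, a ≠ 0 ∧ ∀ (κ : Type u) [Field κ] [Algebra A κ], algebraMap A κ a ≠ 0 →
      IsReduced (κ ⊗[A] B) := by
  have hB : IsNoetherianRing B := Algebra.FiniteType.isNoetherianRing A B
  have : Finite (minimalPrimes B) := (minimalPrimes.finite_of_isNoetherianRing B).to_subtype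
  have := Fintype.ofFinite (minimalPrimes B)
  let v : B →ₗ[B] (∀ p : minimalPrimes B, B ⧸ p.1) :=
    LinearMap.pi fun p ↦ (Ideal.Quotient.mkₐ B p.1).toLinearMap
  have hv : Function.Injective v := by
    rw [injective_iff_map_eq_zero]
    intro x hx
    have : x ∈ sInf (minimalPrimes B) := by
      rw [Submodule.mem_sInf]
      intro p hp
      exact Ideal.Quotient.eq_zero_iff_mem.1 (congrFun hx ⟨p, hp⟩)
    rw [minimalPrimes, Ideal.sInf_minimalPrimes] at this
    simpa [nilradical_eq_zero] using! this
  obtain ⟨a, ha, H⟩ := exists_lTensor_injective (A := A) (B := B) v hv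
  have hp : ∀ p : minimalPrimes B, ∃ a : A, a ≠ 0 ∧ ∀ (κ : Type u) [Field κ] [Algebra A κ],
      algebraMap A κ a ≠ 0 → IsReduced (κ ⊗[A] (B ⧸ p.1)) := by
    intro p
    have : p.1.IsPrime := p.2.1.1
    exact exists_isReduced_tensor_of_isDomain A (B ⧸ p.1)
  choose b hb H' using hp
  refine ⟨a * ∏ p, b p, mul_ne_zero ha (Finset.prod_ne_zero_iff.2 fun p _ ↦ hb p),
    fun κ _ _ hκ ↦ ?_⟩
  rw [map_mul, mul_ne_zero_iff, map_prod, Finset.prod_ne_zero_iff] at hκ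
  have := fun p ↦ H' p κ (hκ.2 p (Finset.mem_univ p))
  let φ : κ ⊗[A] B →ₐ[A] (∀ p : minimalPrimes B, κ ⊗[A] (B ⧸ p.1)) :=
    AlgHom.pi fun p ↦ Algebra.TensorProduct.map (AlgHom.id A κ) (Ideal.Quotient.mkₐ A p.1)
  refine isReduced_of_injective φ ?_
  have hφ : ∀ x, φ x = TensorProduct.piRightHom A A κ _ ((v.restrictScalars A).lTensor κ x) := by
    intro x
    induction x with
    | zero => simp
    | tmul c b => rfl
    | add x y hx hy => rw [map_add, map_add, map_add, hx, hy]
  have hpi : Function.Injective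
      (TensorProduct.piRightHom A A κ fun p : minimalPrimes B ↦ B ⧸ p.1) := by
    classical
    exact (TensorProduct.piRight A A κ fun p : minimalPrimes B ↦ B ⧸ p.1).injective
  intro x y hxy
  rw [hφ, hφ] at hxy
  exact H κ hκ.1 (hpi hxy)

end Reduced

/-! ### Base change of fields over an algebraically closed subfield -/

section AlgebraicallyClosedIn

/-- An irreducible polynomial stays irreducible over an extension in which the ground field is
algebraically closed, because the coefficients of its monic factors are algebraic. -/
lemma irreducible_map_of_isIntegrallyClosedIn {K F : Type*} [Field K] [Field F] [Algebra K F]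
    [IsIntegrallyClosedIn K F] (p : Polynomial K) (hp : Irreducible p) (hm : p.Monic) :
    Irreducible (p.map (algebraMap K F)) := by
  rw [(hm.map _).irreducible_iff_natDegree']
  refine ⟨fun h ↦ hp.1 ?_, fun f g hf hg hfg ↦ ?_⟩
  · rw [hm.isUnit_iff]
    exact Polynomial.map_injective _ (algebraMap K F).injective (by rw [h, Polynomial.map_one])
  · have hlift : ∀ q : Polynomial F, q.Monic → q ∣ p.map (algebraMap K F) →
        ∃ q' : Polynomial K, q'.map (algebraMap K F) = q ∧ q'.natDegree = q.natDegree ∧ q'.Monic :=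
            by
      intro q hq hdvd
      refine Polynomial.lifts_and_natDegree_eq_and_monic ?_ hq
      rw [Polynomial.lifts_iff_coeff_lifts]
      intro n
      exact IsIntegrallyClosedIn.algebraMap_eq_of_integral
        (Polynomial.isIntegral_coeff_of_dvd p q hm hq hdvd n)
    obtain ⟨f', rfl, hfd, hf'⟩ := hlift f hf ⟨g, hfg.symm⟩
    obtain ⟨g', rfl, hgd, hg'⟩ := hlift g hg ⟨_, (mul_comm _ _).trans hfg |>.symm⟩
    rw [← Polynomial.map_mul] at hfg
    have := Polynomial.map_injective _ (algebraMap K F).injective hfg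
    rw [hm.irreducible_iff_natDegree'] at hp
    have := hp.2 f' g' hf' hg' this
    rwa [← hgd, Polynomial.natDegree_map]

/-- Extensions `F / K` in which `K` is algebraically closed stay integral under algebraic
base change. -/
lemma isDomain_tensor_of_isAlgebraic (K : Type*) [Field K] [CharZero K] (E : Type*) [Field E]
    [Algebra K E]
    [Algebra.IsAlgebraic K E] (F : Type*) [Field F] [Algebra K F] [IsIntegrallyClosedIn K F] :
    IsDomain (E ⊗[K] F) := by
  have key : ∀ E₀ : IntermediateField K E, FiniteDimensional K E₀ → IsDomain (F ⊗[K] E₀) := by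
    intro E₀ _
    obtain ⟨α, hα⟩ := Field.exists_primitive_element K E₀
    have hint : IsIntegral K α := Algebra.IsIntegral.isIntegral α
    let e₁ : AdjoinRoot (minpoly K α) ≃ₐ[K] E₀ :=
      (IntermediateField.adjoinRootEquivAdjoin K hint).trans
        ((IntermediateField.equivOfEq hα).trans IntermediateField.topEquiv)
    let i : F ≃ₐ[F] F ⊗[K] K := (Algebra.TensorProduct.rid K F F).symm
    have hi : (Algebra.TensorProduct.includeRight : K →ₐ[K] F ⊗[K] K).toRingHom =
        i.toRingEquiv.toRingHom.comp (algebraMap K F) := by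
      refine RingHom.ext fun x ↦ ?_
      change (1 : F) ⊗ₜ[K] x = algebraMap K F x ⊗ₜ[K] 1
      rw [Algebra.algebraMap_eq_smul_one, TensorProduct.smul_tmul, smul_eq_mul, mul_one]
    let q := (minpoly K α).map
      (Algebra.TensorProduct.includeRight : K →ₐ[K] F ⊗[K] K).toRingHom
    let e₂ := AdjoinRoot.tensorAlgEquiv (R := K) (T := F) (minpoly K α) q rfl
    have hq : q = ((minpoly K α).map (algebraMap K F)).map i.toRingEquiv.toRingHom := by
      rw [Polynomial.map_map, ← hi]
    have hprime : Prime q := by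
      rw [hq]
      have : Prime ((minpoly K α).map (algebraMap K F)) :=
        (irreducible_map_of_isIntegrallyClosedIn _ (minpoly.irreducible hint)
          (minpoly.monic hint)).prime
      let e₃ := Polynomial.mapEquiv i.toRingEquiv
      refine comap_prime e₃.symm e₃ e₃.apply_symm_apply ?_
      rwa [show Polynomial.map i.toRingEquiv.toRingHom _ = e₃ _ from rfl, e₃.symm_apply_apply]
    have : IsDomain (AdjoinRoot q) := AdjoinRoot.isDomain_of_prime hprime
    have : IsDomain (F ⊗[K] AdjoinRoot (minpoly K α)) := e₂.toMulEquiv.isDomain _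
    exact (Algebra.TensorProduct.congr (AlgEquiv.refl : F ≃ₐ[K] F) e₁.symm).toMulEquiv.isDomain _
  have key2 : ∀ E₀ : IntermediateField K E,
      Function.Injective (Algebra.TensorProduct.map (AlgHom.id K F) E₀.val) := fun E₀ ↦
    Module.Flat.lTensor_preserves_injective_linearMap (M := F) E₀.val.toLinearMap
      E₀.val.injective
  -- a zero divisor already lives over a finite subextension
  have key3 : ∀ x : F ⊗[K] E, ∃ E₀ : IntermediateField K E, FiniteDimensional K E₀ ∧
      ∀ E₁ : IntermediateField K E, E₀ ≤ E₁ →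
      x ∈ (Algebra.TensorProduct.map (AlgHom.id K F) E₁.val).range := by
    intro x
    induction x with
    | zero => exact ⟨⊥, inferInstance, fun E₁ _ ↦ zero_mem _⟩
    | tmul a b =>
      refine ⟨IntermediateField.adjoin K {b}, IntermediateField.adjoin.finiteDimensional
        (Algebra.IsIntegral.isIntegral b), fun E₁ h ↦ ?_⟩
      exact ⟨a ⊗ₜ ⟨b, h (IntermediateField.mem_adjoin_simple_self K b)⟩, by simp⟩
    | add x y hx hy =>
      obtain ⟨E₁, h₁, hx⟩ := hx
      obtain ⟨E₂, h₂, hy⟩ := hy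
      exact ⟨E₁ ⊔ E₂, inferInstance, fun E₀ h ↦
        add_mem (hx _ (le_sup_left.trans h)) (hy _ (le_sup_right.trans h))⟩
  have : IsDomain (F ⊗[K] E) := by
    have : NoZeroDivisors (F ⊗[K] E) := ⟨by
      intro x y hxy
      obtain ⟨E₁, h₁, hx⟩ := key3 x
      obtain ⟨E₂, h₂, hy⟩ := key3 y
      obtain ⟨x, rfl⟩ := hx (E₁ ⊔ E₂) le_sup_left
      obtain ⟨y, rfl⟩ := hy (E₁ ⊔ E₂) le_sup_right
      have := key (E₁ ⊔ E₂) inferInstance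
      have hxy : x * y = 0 := key2 (E₁ ⊔ E₂) ((map_mul _ x y).trans (hxy.trans (map_zero _).symm))
      rcases mul_eq_zero.1 hxy with h | h
      · left; exact (congrArg _ h).trans (map_zero _)
      · right; exact (congrArg _ h).trans (map_zero _)⟩
    exact NoZeroDivisors.to_isDomain _
  exact (Algebra.TensorProduct.comm K E F).toMulEquiv.isDomain _

end AlgebraicallyClosedIn

/-! ### Specialization of irreducible polynomials -/

section Irreducible

universe v

/-- A consequence of the Nullstellensatz: if a finitely generated algebra over a domain `A` has no
point over the algebraic closure of the fraction field, then it is killed by a nonzero element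
of `A`. -/
lemma exists_algebraMap_eq_zero_of_isEmpty (A : Type u) (C : Type v) [CommRing A] [IsDomain A]
    [CommRing C]
    [Algebra A C] [Algebra.FiniteType A C]
    (h : IsEmpty (C →ₐ[A] AlgebraicClosure (FractionRing A))) :
    ∃ a : A, a ≠ 0 ∧ algebraMap A C a = 0 := by
  by_contra! hC
  let K := FractionRing A
  have hinj : Function.Injective (algebraMap A C) :=
    (injective_iff_map_eq_zero _).2 fun a ha ↦ by_contra fun h ↦ hC a h ha
  have : Nontrivial (K ⊗[A] C) := by
    have := Module.Flat.lTensor_preserves_injective_linearMap (M := K) (Algebra.linearMap A C) hinj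
    have h' : Nontrivial (K ⊗[A] A) := (TensorProduct.rid A K).toEquiv.nontrivial
    exact this.nontrivial
  obtain ⟨M, hM⟩ := Ideal.exists_maximal (K ⊗[A] C)
  let : Field ((K ⊗[A] C) ⧸ M) := Ideal.Quotient.field M
  have : Module.Finite K ((K ⊗[A] C) ⧸ M) := finite_of_finite_type_of_isJacobsonRing _ _
  have hlift : ∀ (L : Type (max u v)) [Field L] [Algebra K L] [Module.Finite K L],
      Nonempty (L →ₐ[K] AlgebraicClosure K) := fun L _ _ _ ↦ ⟨IsAlgClosed.lift⟩
  obtain ⟨φ⟩ := hlift ((K ⊗[A] C) ⧸ M)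
  exact h.false (((φ.restrictScalars A).comp ((Ideal.Quotient.mkₐ K M).restrictScalars A)).comp
    Algebra.TensorProduct.includeRight)

/-- If a polynomial has no factorization with factors of given degrees over the algebraic closure
of `Frac A`, the same holds over general fields over `A`: the scheme of such factorizations is of
finite type over `A`. -/
lemma exists_forall_ne_mul {A : Type u} {σ : Type v} [CommRing A] [IsDomain A] [Finite σ]
    (P : MvPolynomial σ A) (i j : ℕ)
    (h : ∀ Q R : MvPolynomial σ (AlgebraicClosure (FractionRing A)), Q.totalDegree ≤ i →
      R.totalDegree ≤ j → P.map (algebraMap A _) ≠ Q * R) :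
    ∃ a : A, a ≠ 0 ∧ ∀ (κ : Type u) [Field κ] [Algebra A κ], algebraMap A κ a ≠ 0 →
      ∀ Q R : MvPolynomial σ κ, Q.totalDegree ≤ i → R.totalDegree ≤ j →
        P.map (algebraMap A κ) ≠ Q * R := by
  classical
  let V := (Finsupp.finite_of_degree_le (σ := σ) i).toFinset
  let W := (Finsupp.finite_of_degree_le (σ := σ) j).toFinset
  let R₀ := MvPolynomial (V ⊕ W) A
  let Q₁ : MvPolynomial σ R₀ := ∑ m : V, MvPolynomial.monomial m.1 (MvPolynomial.X (Sum.inl m))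
  let Q₂ : MvPolynomial σ R₀ := ∑ m : W, MvPolynomial.monomial m.1 (MvPolynomial.X (Sum.inr m))
  let I : Ideal R₀ := Ideal.span (Set.range fun m ↦
    (P.map (algebraMap A R₀)).coeff m - (Q₁ * Q₂).coeff m)
  let C := R₀ ⧸ I
  have hφ : ∀ (κ : Type u) [Field κ] [Algebra A κ] (φ : C →ₐ[A] κ), ∃ Q R : MvPolynomial σ κ,
      Q.totalDegree ≤ i ∧ R.totalDegree ≤ j ∧ P.map (algebraMap A κ) = Q * R := by
    intro κ _ _ φ
    let ψ : R₀ →ₐ[A] κ := φ.comp (Ideal.Quotient.mkₐ A I)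
    refine ⟨Q₁.map ψ.toRingHom, Q₂.map ψ.toRingHom, ?_, ?_, ?_⟩
    · simp only [Q₁, map_sum, MvPolynomial.map_monomial]
      refine MvPolynomial.totalDegree_finsetSum_le fun m _ ↦ ?_
      refine (MvPolynomial.totalDegree_monomial_le _ _).trans ?_
      exact (Set.Finite.mem_toFinset (Finsupp.finite_of_degree_le i)).1 m.2
    · simp only [Q₂, map_sum, MvPolynomial.map_monomial]
      refine MvPolynomial.totalDegree_finsetSum_le fun m _ ↦ ?_
      refine (MvPolynomial.totalDegree_monomial_le _ _).trans ?_
      exact (Set.Finite.mem_toFinset (Finsupp.finite_of_degree_le j)).1 m.2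
    · rw [← map_mul]
      ext m
      have h1 : ψ ((P.map (algebraMap A R₀)).coeff m - (Q₁ * Q₂).coeff m) = 0 := by
        have : Ideal.Quotient.mkₐ A I ((P.map (algebraMap A R₀)).coeff m - (Q₁ * Q₂).coeff m) = 0 :=
          Ideal.Quotient.eq_zero_iff_mem.2 (Ideal.subset_span ⟨m, rfl⟩)
        rw [AlgHom.comp_apply, this, map_zero]
      rw [MvPolynomial.coeff_map, MvPolynomial.coeff_map]
      rw [map_sub, sub_eq_zero, MvPolynomial.coeff_map, AlgHom.commutes] at h1
      exact h1
  have hpt : ∀ (κ : Type u) [Field κ] [Algebra A κ] (Q R : MvPolynomial σ κ), Q.totalDegree ≤ i →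
      R.totalDegree ≤ j → P.map (algebraMap A κ) = Q * R → Nonempty (C →ₐ[A] κ) := by
    intro κ _ _ Q R hQ hR hP
    let ψ : R₀ →ₐ[A] κ := MvPolynomial.aeval
      (Sum.elim (fun m ↦ Q.coeff m.1) (fun m ↦ R.coeff m.1))
    have hsum : ∀ (d : ℕ) (T : MvPolynomial σ κ), T.totalDegree ≤ d →
        (∑ m : (Finsupp.finite_of_degree_le (σ := σ) d).toFinset,
          MvPolynomial.monomial m.1 (T.coeff m.1)) = T := by
      intro d T hT
      rw [Finset.sum_coe_sort _ fun m ↦ MvPolynomial.monomial m (T.coeff m)]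
      conv_rhs => rw [T.as_sum]
      symm
      refine Finset.sum_subset (fun m hm ↦ ?_) fun m _ hm ↦ ?_
      · rw [Set.Finite.mem_toFinset]
        exact (MvPolynomial.le_totalDegree hm).trans hT
      · rw [MvPolynomial.notMem_support_iff.1 hm, map_zero]
    have h₁ : Q₁.map ψ.toRingHom = Q := by
      simp only [Q₁, map_sum, MvPolynomial.map_monomial]
      refine Eq.trans (Finset.sum_congr rfl fun m _ ↦ ?_) (hsum i Q hQ)
      congr 1
      exact (MvPolynomial.aeval_X _ _).trans rfl
    have h₂ : Q₂.map ψ.toRingHom = R := by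
      simp only [Q₂, map_sum, MvPolynomial.map_monomial]
      refine Eq.trans (Finset.sum_congr rfl fun m _ ↦ ?_) (hsum j R hR)
      congr 1
      exact (MvPolynomial.aeval_X _ _).trans rfl
    refine ⟨Ideal.Quotient.liftₐ I ψ fun x hx ↦ ?_⟩
    have : I ≤ RingHom.ker ψ := by
      refine Ideal.span_le.2 ?_
      rintro _ ⟨m, rfl⟩
      change ψ.toRingHom _ = 0
      rw [map_sub, sub_eq_zero, ← MvPolynomial.coeff_map, ← MvPolynomial.coeff_map,
        map_mul, h₁, h₂, ← hP, MvPolynomial.map_map]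
      congr 2
      exact congrArg _ ψ.comp_algebraMap
    exact this hx
  obtain ⟨a, ha, ha'⟩ := exists_algebraMap_eq_zero_of_isEmpty A C ⟨fun φ ↦ by
    obtain ⟨Q, R, hQ, hR, h'⟩ := hφ _ φ
    exact h Q R hQ hR h'⟩
  refine ⟨a, ha, fun κ _ _ hκ Q R hQ hR hP ↦ hκ ?_⟩
  obtain ⟨φ⟩ := hpt κ Q R hQ hR hP
  rw [← φ.commutes, ha', map_zero]

/-- **Bertini–Noether**: geometric irreducibility of a polynomial persists on specialization. -/
lemma exists_irreducible_map {A : Type u} {σ : Type v} [CommRing A] [IsDomain A] [Finite σ]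
    (P : MvPolynomial σ A)
    (h : Irreducible (P.map (algebraMap A (AlgebraicClosure (FractionRing A))))) :
    ∃ a : A, a ≠ 0 ∧ ∀ (κ : Type u) [Field κ] [Algebra A κ], algebraMap A κ a ≠ 0 →
      Irreducible (P.map (algebraMap A κ)) := by
  let Ω := AlgebraicClosure (FractionRing A)
  have hinj : Function.Injective (algebraMap A Ω) := by
    rw [IsScalarTower.algebraMap_eq A (FractionRing A) Ω]
    exact (algebraMap (FractionRing A) Ω).injective.comp (IsFractionRing.injective A _)
  let N := P.totalDegree
  have hN : (P.map (algebraMap A Ω)).totalDegree = N :=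
    congrArg (fun s ↦ s.sup fun m ↦ m.sum fun _ e ↦ e)
      (MvPolynomial.support_map_of_injective P hinj)
  have hP0 : P ≠ 0 := fun h0 ↦ h.ne_zero (by rw [h0, map_zero])
  have hNpos : N ≠ 0 := fun h0 ↦ h.1 <| by
    rw [h0, MvPolynomial.totalDegree_eq_zero_iff_eq_C] at hN
    rw [hN]
    refine (IsUnit.mk0 _ ?_).map MvPolynomial.C
    intro h0
    rw [h0, map_zero] at hN
    exact h.ne_zero hN
  have hunit : ∀ (κ : Type u) [Field κ] (Q : MvPolynomial σ κ), Q ≠ 0 → Q.totalDegree = 0 →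
      IsUnit Q := by
    intro κ _ Q hQ hd
    rw [MvPolynomial.totalDegree_eq_zero_iff_eq_C] at hd
    rw [hd]
    refine (IsUnit.mk0 _ ?_).map MvPolynomial.C
    intro h0
    rw [h0, map_zero] at hd
    exact hQ hd
  have hdeg0 : ∀ (κ : Type u) [Field κ] (Q : MvPolynomial σ κ), IsUnit Q → Q.totalDegree = 0 :=
    fun κ _ Q hQ ↦ (MvPolynomial.isUnit_iff_totalDegree_of_isReduced.1 hQ).2
  have hij : ∀ i : ℕ, ∃ a : A, a ≠ 0 ∧ ∀ (κ : Type u) [Field κ] [Algebra A κ],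
      algebraMap A κ a ≠ 0 → 0 < i → i < N → ∀ Q R : MvPolynomial σ κ,
        Q.totalDegree ≤ i → R.totalDegree ≤ N - i → P.map (algebraMap A κ) ≠ Q * R := by
    intro i
    by_cases hi : 0 < i ∧ i < N
    · obtain ⟨a, ha, H⟩ := exists_forall_ne_mul P i (N - i) fun Q R hQ hR hPQ ↦ by
        have hne : Q ≠ 0 ∧ R ≠ 0 := by
          rw [← mul_ne_zero_iff, ← hPQ]
          exact h.ne_zero
        have hd := MvPolynomial.totalDegree_mul_of_isDomain hne.1 hne.2
        rw [← hPQ, hN] at hd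
        rcases h.2 hPQ with hu | hu
        · have := hdeg0 _ _ hu
          omega
        · have := hdeg0 _ _ hu
          omega
      exact ⟨a, ha, fun κ _ _ hκ _ _ ↦ H κ hκ⟩
    · exact ⟨1, one_ne_zero, fun κ _ _ hκ h₁ h₂ ↦ absurd ⟨h₁, h₂⟩ hi⟩
  choose a ha H using hij
  -- a coefficient of top degree has to survive
  obtain ⟨m, hm, hmN⟩ : ∃ m ∈ P.support, N = m.sum fun _ e ↦ e :=
    Finset.exists_mem_eq_sup _ (MvPolynomial.support_nonempty.2 hP0) _
  refine ⟨P.coeff m * ∏ i ∈ Finset.range N, a i, mul_ne_zero (MvPolynomial.mem_support_iff.1 hm)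
    (Finset.prod_ne_zero_iff.2 fun i _ ↦ ha i), fun κ _ _ hκ ↦ ?_⟩
  rw [map_mul, mul_ne_zero_iff, map_prod, Finset.prod_ne_zero_iff] at hκ
  have hdeg : (P.map (algebraMap A κ)).totalDegree = N := by
    refine le_antisymm (Finset.sup_mono (MvPolynomial.support_map_subset _ _)) ?_
    rw [hmN]
    refine MvPolynomial.le_totalDegree ?_
    rw [MvPolynomial.mem_support_iff, MvPolynomial.coeff_map]
    exact hκ.1
  refine ⟨fun hu ↦ hNpos (by rw [← hdeg, hdeg0 _ _ hu]), fun Q R hQR ↦ ?_⟩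
  have hne : Q ≠ 0 ∧ R ≠ 0 := by
    rw [← mul_ne_zero_iff, ← hQR]
    intro h0
    rw [h0, MvPolynomial.totalDegree_zero] at hdeg
    exact hNpos hdeg.symm
  have hd := MvPolynomial.totalDegree_mul_of_isDomain hne.1 hne.2
  rw [← hQR, hdeg] at hd
  by_contra! hnu
  have hQ : 0 < Q.totalDegree := Nat.pos_of_ne_zero fun h0 ↦ hnu.1 (hunit _ _ hne.1 h0)
  have hR : 0 < R.totalDegree := Nat.pos_of_ne_zero fun h0 ↦ hnu.2 (hunit _ _ hne.2 h0)
  exact H Q.totalDegree κ (hκ.2 _ (Finset.mem_range.2 (by omega))) hQ (by omega) Q R le_rfl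
    (by omega) hQR

end Irreducible

/-! ### Fibres of generic hypersurfaces -/

section Hypersurface

universe v w x

/-- The kernel of `κ[σ] → κ ⊗ B` is generated by the kernel of `A[σ] → B`. -/
lemma ker_aeval_tensor_eq_map {A : Type u} {κ : Type w} {σ : Type v} {B : Type x} [CommRing A]
    [CommRing κ] [Algebra A κ] [CommRing B]
    [Algebra A B] (φ : MvPolynomial σ A →ₐ[A] B) (hφ : Function.Surjective φ) :
    RingHom.ker (MvPolynomial.aeval (R := κ) fun i ↦ (1 : κ) ⊗ₜ[A] φ (MvPolynomial.X i)) =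
      (RingHom.ker φ).map (MvPolynomial.map (algebraMap A κ)) := by
  let e : κ ⊗[A] MvPolynomial σ A ≃ₐ[κ] MvPolynomial σ κ :=
    MvPolynomial.algebraTensorAlgEquiv A κ
  have h₁ : ((Algebra.TensorProduct.map (AlgHom.id κ κ) φ).comp e.symm.toAlgHom) =
      MvPolynomial.aeval (R := κ) fun i ↦ (1 : κ) ⊗ₜ[A] φ (MvPolynomial.X i) := by
    ext i
    simp [e]
  have h₂ : e.toAlgHom.toRingHom.comp
      (Algebra.TensorProduct.includeRight : MvPolynomial σ A →ₐ[A] κ ⊗[A] MvPolynomial σ A).toRingHom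
      = MvPolynomial.map (algebraMap A κ) := by
    ext i
    · simp [e]
    · simp [e]
  have h₃ := Algebra.TensorProduct.lTensor_ker (A := κ) φ hφ
  rw [← h₁, ← h₂, ← Ideal.map_map]
  ext x
  obtain ⟨x, rfl⟩ := e.surjective x
  rw [RingHom.mem_ker]
  have h₄ : x ∈ RingHom.ker (Algebra.TensorProduct.map (AlgHom.id A κ) φ) ↔
      Algebra.TensorProduct.map (AlgHom.id κ κ) φ x = 0 := Iff.rfl
  have h₅ : (Algebra.TensorProduct.map (AlgHom.id κ κ) φ).comp e.symm.toAlgHom (e x) =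
    Algebra.TensorProduct.map (AlgHom.id κ κ) φ x :=
    congrArg (Algebra.TensorProduct.map (AlgHom.id κ κ) φ) (e.symm_apply_apply x)
  rw [h₅, ← h₄, h₃]
  have h₆ := Ideal.mem_map_of_equiv (I := (RingHom.ker φ).map
    (Algebra.TensorProduct.includeRight : MvPolynomial σ A →ₐ[A] κ ⊗[A] MvPolynomial σ A))
    e (e x)
  exact ⟨fun hx ↦ h₆.2 ⟨x, hx, rfl⟩, fun hx ↦ by
    obtain ⟨y, hy, hyx⟩ := h₆.1 hx
    rwa [← e.injective hyx]⟩

/-- An algebra which is generically a hypersurface with geometrically irreducible equation has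
integral general fibres. -/
lemma exists_isDomain_tensor_of_irreducible {A B : Type u} {σ : Type v} [CommRing A] [IsDomain A]
    [IsNoetherianRing A] [Finite σ] [CommRing B] [Algebra A B]
    (φ : MvPolynomial σ A →ₐ[A] B) (hφ : Function.Surjective φ)
    (P : MvPolynomial σ A) (hP : φ P = 0)
    (hker : ∀ f, φ f = 0 → ∃ a : A, a ≠ 0 ∧ P ∣ a • f)
    (h : Irreducible (P.map (algebraMap A (AlgebraicClosure (FractionRing A))))) :
    ∃ a : A, a ≠ 0 ∧ ∀ (κ : Type u) [Field κ] [Algebra A κ], algebraMap A κ a ≠ 0 →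
      IsDomain (κ ⊗[A] B) := by
  obtain ⟨a, ha, H⟩ := exists_irreducible_map P h
  have : ∃ b : A, b ≠ 0 ∧ ∀ f ∈ RingHom.ker φ, P ∣ b • f := by
    obtain ⟨s, hs⟩ := (isNoetherianRing_iff_ideal_fg (MvPolynomial σ A)).1 inferInstance
      (RingHom.ker φ)
    choose! c hc hc' using hker
    refine ⟨∏ f ∈ s, c f, Finset.prod_ne_zero_iff.2 fun f hf ↦ hc f ?_, fun f hf ↦ ?_⟩
    · exact (hs ▸ Ideal.subset_span hf : f ∈ RingHom.ker φ)
    · rw [← hs] at hf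
      induction hf using Submodule.span_induction with
      | mem f hf =>
        have hf' : f ∈ RingHom.ker φ := hs ▸ Ideal.subset_span hf
        obtain ⟨d, hd⟩ := Finset.dvd_prod_of_mem c hf
        rw [hd, mul_comm, mul_smul]
        exact (hc' f hf').trans (Dvd.intro_left (MvPolynomial.C d) (by rw [MvPolynomial.C_mul']))
      | zero => simp
      | add f g _ _ hf hg => rw [smul_add]; exact dvd_add hf hg
      | smul r f _ hf => rw [smul_comm]; exact hf.mul_left r
  obtain ⟨b, hb, hb'⟩ := this
  refine ⟨a * b, mul_ne_zero ha hb, fun κ _ _ hκ ↦ ?_⟩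
  rw [map_mul, mul_ne_zero_iff] at hκ
  have hirr := H κ hκ.1
  have hker := ker_aeval_tensor_eq_map (κ := κ) φ hφ
  have hspan : (RingHom.ker φ).map (MvPolynomial.map (algebraMap A κ)) =
      Ideal.span {P.map (algebraMap A κ)} := by
    refine le_antisymm (Ideal.map_le_iff_le_comap.2 fun f hf ↦ ?_)
      ((Ideal.span_singleton_le_iff_mem _).2 (Ideal.mem_map_of_mem _ hP))
    rw [Ideal.mem_comap, Ideal.mem_span_singleton]
    have := map_dvd (MvPolynomial.map (algebraMap A κ)) (hb' f hf)
    rw [Algebra.smul_def, map_mul] at this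
    refine (IsUnit.dvd_mul_left ?_).1 this
    rw [MvPolynomial.algebraMap_eq, MvPolynomial.map_C]
    exact (IsUnit.mk0 _ hκ.2).map MvPolynomial.C
  rw [hspan] at hker
  have hsurj : Function.Surjective
      (MvPolynomial.aeval (R := κ) fun i ↦ (1 : κ) ⊗ₜ[A] φ (MvPolynomial.X i)) := by
    rw [← AlgHom.range_eq_top, eq_top_iff]
    rintro x -
    induction x with
    | zero => exact zero_mem _
    | add x y hx hy => exact add_mem hx hy
    | tmul c y =>
      obtain ⟨f, rfl⟩ := hφ y
      refine ⟨MvPolynomial.C c * f.map (algebraMap A κ), ?_⟩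
      have : ∀ f : MvPolynomial σ A, MvPolynomial.aeval (R := κ)
          (fun i ↦ (1 : κ) ⊗ₜ[A] φ (MvPolynomial.X i)) (f.map (algebraMap A κ)) = 1 ⊗ₜ φ f := by
        intro f
        rw [MvPolynomial.aeval_map_algebraMap]
        exact DFunLike.congr_fun (MvPolynomial.algHom_ext (g :=
          (Algebra.TensorProduct.includeRight : B →ₐ[A] κ ⊗[A] B).comp φ) (by simp)) f
      change MvPolynomial.aeval _ _ = _
      rw [map_mul, this, MvPolynomial.aeval_C]
      simp
  have : (Ideal.span {P.map (algebraMap A κ)}).IsPrime :=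
    (Ideal.span_singleton_prime hirr.ne_zero).2 hirr.prime
  rw [← hker] at this
  have hdom := (Ideal.Quotient.isDomain_iff_prime _).2 this
  exact (Ideal.quotientKerAlgEquivOfSurjective hsurj).symm.toMulEquiv.isDomain _

end Hypersurface

/-! ### Integrality of general fibres -/

section BertiniNoether

attribute [local instance] MvPolynomial.algebraMvPolynomial in
/-- Clearing the denominators of a polynomial over the fraction field. -/
lemma exists_map_eq_C_mul {A K σ : Type*} [CommRing A] [IsDomain A] [Field K] [Algebra A K]
    [IsFractionRing A K] (q : MvPolynomial σ K) :
    ∃ (P : MvPolynomial σ A) (c : A), c ≠ 0 ∧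
      P.map (algebraMap A K) = MvPolynomial.C (algebraMap A K c) * q := by
  obtain ⟨⟨P, ⟨_, c, hc, rfl⟩⟩, h⟩ := IsLocalization.surj ((nonZeroDivisors A).map
    (MvPolynomial.C (σ := σ))) q
  refine ⟨P, c, nonZeroDivisors.ne_zero hc, ?_⟩
  rw [mul_comm, ← MvPolynomial.map_C]
  exact h.symm

/-- The relations between algebraically independent elements `x` and one further element `y` which
is integral over `K[x]` form a principal ideal. -/
lemma exists_aeval_eq_zero_iff_dvd {K F : Type*} [Field K] [Field F] [Algebra K F] {σ : Type*}
    (x : σ → F) (hx : AlgebraicIndependent K x) (y : F)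
    (p : Polynomial (MvPolynomial σ K)) (hp : p.Monic)
    (hy : p.eval₂ (MvPolynomial.aeval x).toRingHom y = 0) :
    ∃ q : MvPolynomial (Option σ) K, q ≠ 0 ∧
      ∀ f, MvPolynomial.aeval (fun o : Option σ ↦ o.elim y x) f = 0 ↔ q ∣ f := by
  let : Algebra (MvPolynomial σ K) F := (MvPolynomial.aeval x).toAlgebra
  have : IsScalarTower K (MvPolynomial σ K) F := .of_algebraMap_eq fun r ↦
    ((MvPolynomial.aeval x).commutes r).symm
  have : FaithfulSMul (MvPolynomial σ K) F := (faithfulSMul_iff_algebraMap_injective _ _).2 hx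
  have hint : IsIntegral (MvPolynomial σ K) y := ⟨p, hp, hy⟩
  let e := MvPolynomial.optionEquivLeft K σ
  refine ⟨e.symm (minpoly _ y), ?_, fun f ↦ ?_⟩
  · rw [Ne, EmbeddingLike.map_eq_zero_iff]
    exact (minpoly.monic hint).ne_zero
  · have h₁ : MvPolynomial.aeval (fun o : Option σ ↦ o.elim y x) =
        ((Polynomial.aeval y).restrictScalars K).comp e.toAlgHom := by
      ext o
      cases o with
      | none => simp [e]
      | some i =>
        have : e (MvPolynomial.X (some i)) = Polynomial.C (MvPolynomial.X i) :=
          MvPolynomial.optionEquivLeft_X_some K σ i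
        change _ = Polynomial.aeval y (e _)
        rw [this, Polynomial.aeval_C, MvPolynomial.aeval_X]
        exact (MvPolynomial.aeval_X x i).symm
    rw [h₁]
    change Polynomial.aeval y (e f) = 0 ↔ _
    rw [minpoly.isIntegrallyClosed_dvd_iff hint]
    constructor
    · intro h
      simpa using map_dvd e.symm h
    · intro h
      simpa using map_dvd e h

/-- A hypersurface in whose function field the ground field is algebraically closed is
geometrically irreducible. -/
lemma irreducible_map_of_aeval_eq_zero_iff_dvd {K F Ω σ : Type*} [Field K] [CharZero K] [Field F]
    [Algebra K F]
    [IsIntegrallyClosedIn K F] [Field Ω] [Algebra K Ω] [Algebra.IsAlgebraic K Ω]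
    (z : σ → F) (q : MvPolynomial σ K) (hq : q ≠ 0)
    (h : ∀ f, MvPolynomial.aeval z f = 0 ↔ q ∣ f) :
    Irreducible (q.map (algebraMap K Ω)) := by
  let φ : MvPolynomial σ K →ₐ[K] F := MvPolynomial.aeval z
  have hker : RingHom.ker φ.rangeRestrict = Ideal.span {q} := by
    ext f
    rw [Ideal.mem_span_singleton, ← h, RingHom.mem_ker, ← Subtype.val_injective.eq_iff]
    rfl
  have := isDomain_tensor_of_isAlgebraic K Ω F
  let i := Algebra.TensorProduct.map (AlgHom.id K Ω) φ.range.val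
  have hi : Function.Injective i :=
    Module.Flat.lTensor_preserves_injective_linearMap (M := Ω) φ.range.val.toLinearMap
      Subtype.val_injective
  have : IsDomain (Ω ⊗[K] φ.range) := hi.isDomain i.toRingHom
  have hprime := RingHom.ker_isPrime (MvPolynomial.aeval (R := Ω) fun i ↦
    (1 : Ω) ⊗ₜ[K] φ.rangeRestrict (MvPolynomial.X i))
  rw [ker_aeval_tensor_eq_map (κ := Ω) φ.rangeRestrict φ.rangeRestrict_surjective, hker,
    Ideal.map_span, Set.image_singleton, Ideal.span_singleton_prime] at hprime
  · exact hprime.irreducible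
  · rwa [Ne, map_eq_zero_iff _ (MvPolynomial.map_injective _ (algebraMap K Ω).injective)]

/-- The Bertini–Noether theorem for algebras which are standard étale over an affine space: these
are generically hypersurfaces. -/
lemma exists_isDomain_tensor_of_isStandardEtale (A C : Type u) [CommRing A] [IsDomain A]
    [CharZero A]
    [IsNoetherianRing A] [CommRing C] [IsDomain C] [Algebra A C] [Algebra.FiniteType A C] (n : ℕ)
    [Algebra (MvPolynomial (Fin n) A) C] [IsScalarTower A (MvPolynomial (Fin n) A) C]
    [Algebra.IsStandardEtale (MvPolynomial (Fin n) A) C]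
    (F : Type u) [Field F] [Algebra C F] [IsFractionRing C F] [Algebra A F] [IsScalarTower A C F]
    (hF : ∀ x : F, IsAlgebraic A x → ∃ a b : A, b ≠ 0 ∧ b • x = algebraMap A F a) :
    ∃ a : A, a ≠ 0 ∧ ∀ (κ : Type u) [Field κ] [Algebra A κ], algebraMap A κ a ≠ 0 →
      IsDomain (κ ⊗[A] C) := by
  let R := MvPolynomial (Fin n) A
  have hRC : Function.Injective (algebraMap R C) := FaithfulSMul.algebraMap_injective R C
  have hAC : Function.Injective (algebraMap A C) := by
    rw [IsScalarTower.algebraMap_eq A R C]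
    exact hRC.comp (MvPolynomial.C_injective _ _)
  have hCF : Function.Injective (algebraMap C F) := IsFractionRing.injective C F
  have hAF : Function.Injective (algebraMap A F) := by
    rw [IsScalarTower.algebraMap_eq A C F]
    exact hCF.comp hAC
  let K := FractionRing A
  have hAK : Function.Injective (algebraMap A K) := IsFractionRing.injective A K
  have : CharZero K := charZero_of_injective_algebraMap hAK
  have : FaithfulSMul A F := (faithfulSMul_iff_algebraMap_injective A F).2 hAF
  let : Algebra K F := FractionRing.liftAlgebra A F
  have : IsScalarTower A K F := FractionRing.isScalarTower_liftAlgebra A F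
  have : IsIntegrallyClosedIn K F := by
    rw [isIntegrallyClosedIn_iff]
    refine ⟨(algebraMap K F).injective, fun {x} hx ↦ ?_⟩
    have hx' : IsAlgebraic A x := (IsFractionRing.isAlgebraic_iff A K F).2 hx.isAlgebraic
    obtain ⟨a, b, hb, hab⟩ := hF x hx'
    refine ⟨algebraMap A K a / algebraMap A K b, ?_⟩
    rw [map_div₀, ← IsScalarTower.algebraMap_apply, ← IsScalarTower.algebraMap_apply, ← hab,
      Algebra.smul_def, mul_div_cancel_left₀]
    exact (map_ne_zero_iff _ hAF).2 hb
  obtain ⟨𝓟⟩ := Algebra.IsStandardEtale.nonempty_standardEtalePresentation (R := R) (S := C)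
  let xC : Fin n → C := fun i ↦ algebraMap R C (MvPolynomial.X i)
  let x : Fin n → F := fun i ↦ algebraMap C F (xC i)
  let y : F := algebraMap C F 𝓟.x
  let φ : MvPolynomial (Option (Fin n)) A →ₐ[A] C :=
    MvPolynomial.aeval fun o : Option (Fin n) ↦ o.elim 𝓟.x xC
  let φK : MvPolynomial (Option (Fin n)) K →ₐ[K] F :=
    MvPolynomial.aeval fun o : Option (Fin n) ↦ o.elim y x
  have hφK : ∀ f, φK (f.map (algebraMap A K)) = algebraMap C F (φ f) := by
    intro f
    rw [MvPolynomial.aeval_map_algebraMap]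
    refine DFunLike.congr_fun (f := MvPolynomial.aeval fun o : Option (Fin n) ↦ o.elim y x)
      (g := (IsScalarTower.toAlgHom A C F).comp φ) (MvPolynomial.algHom_ext fun o ↦ ?_) f
    cases o <;> simp [φ, y, x]
  have hRx : (MvPolynomial.aeval x : R →ₐ[A] F) =
      (IsScalarTower.toAlgHom A C F).comp (IsScalarTower.toAlgHom A R C) :=
    MvPolynomial.algHom_ext fun i ↦ by simp [x, xC, R]
  have hind : AlgebraicIndependent K x := by
    have : AlgebraicIndependent A x := by
      change Function.Injective (MvPolynomial.aeval x : R →ₐ[A] F)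
      rw [hRx]
      exact hCF.comp hRC
    have : Algebra.IsAlgebraic A K := IsLocalization.isAlgebraic K (nonZeroDivisors A)
    exact AlgebraicIndependent.extendScalars (R := A) K ‹_›
  obtain ⟨q, hq, hqdvd⟩ := exists_aeval_eq_zero_iff_dvd (K := K) x hind y
    (𝓟.f.map (MvPolynomial.map (algebraMap A K))) (𝓟.monic_f.map _) (by
      rw [Polynomial.eval₂_map]
      have h₁ : (MvPolynomial.aeval (R := K) x).toRingHom.comp (MvPolynomial.map (algebraMap A K)) =
          (algebraMap C F).comp (algebraMap R C) := by
        refine Eq.trans ?_ (congrArg AlgHom.toRingHom hRx)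
        refine RingHom.ext fun f ↦ ?_
        exact MvPolynomial.aeval_map_algebraMap _ _ _
      rw [h₁, ← Polynomial.hom_eval₂]
      have := 𝓟.hasMap.1
      rw [Polynomial.aeval_def] at this
      rw [this, map_zero])
  -- clear denominators
  obtain ⟨P, c, hc, hP⟩ := exists_map_eq_C_mul (A := A) q
  have hunit : ∀ {c : A}, c ≠ 0 →
      IsUnit (MvPolynomial.C (algebraMap A K c) : MvPolynomial (Option (Fin n)) K) := fun hc ↦
    (IsUnit.mk0 _ ((map_ne_zero_iff _ hAK).2 hc)).map MvPolynomial.C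
  have hPdvd : ∀ f, φK f = 0 ↔ P.map (algebraMap A K) ∣ f := by
    intro f
    rw [hP, (hunit hc).mul_left_dvd]
    exact hqdvd f
  have hirr := irreducible_map_of_aeval_eq_zero_iff_dvd (Ω := AlgebraicClosure K) _
    (P.map (algebraMap A K)) (by rw [hP]; exact mul_ne_zero (hunit hc).ne_zero hq) hPdvd
  rw [MvPolynomial.map_map, ← IsScalarTower.algebraMap_eq] at hirr
  have hrange : ∀ f, φ.rangeRestrict f = 0 ↔ φ f = 0 := fun f ↦
    Subtype.val_injective.eq_iff.symm
  have hφ0 : ∀ f, φ f = 0 ↔ P.map (algebraMap A K) ∣ f.map (algebraMap A K) := fun f ↦ by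
    rw [← hPdvd, hφK, map_eq_zero_iff _ hCF]
  obtain ⟨a, ha, H⟩ := exists_isDomain_tensor_of_irreducible φ.rangeRestrict
    φ.rangeRestrict_surjective P ((hrange P).2 ((hφ0 P).2 dvd_rfl)) (by
      intro f hf
      obtain ⟨g, hg⟩ := (hφ0 f).1 ((hrange f).1 hf)
      obtain ⟨g', d, hd, h⟩ := exists_map_eq_C_mul (A := A) g
      refine ⟨d, hd, g', ?_⟩
      apply MvPolynomial.map_injective _ hAK
      rw [Algebra.smul_def, map_mul, map_mul, hg, h, MvPolynomial.algebraMap_eq,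
        MvPolynomial.map_C]
      ring) hirr
  obtain ⟨b, hb, H'⟩ := exists_nontrivial_tensor_of_injective (A := A) (B := C) hAC
  refine ⟨a * b, mul_ne_zero ha hb, fun κ _ _ hκ ↦ ?_⟩
  rw [map_mul, mul_ne_zero_iff] at hκ
  have h₁ := H κ hκ.1
  have h₂ := H' κ hκ.2
  let D := φ.range
  have hD : ∀ p : Polynomial R, Polynomial.aeval 𝓟.x p ∈ D := by
    intro p
    refine ⟨(MvPolynomial.optionEquivLeft A (Fin n)).symm p, ?_⟩
    have h : φ = ((Polynomial.aeval 𝓟.x).restrictScalars A).comp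
        (MvPolynomial.optionEquivLeft A (Fin n)).toAlgHom := by
      refine MvPolynomial.algHom_ext fun o ↦ ?_
      cases o with
      | none => simp [φ]
      | some i =>
        have : MvPolynomial.optionEquivLeft A (Fin n) (MvPolynomial.X (some i)) =
          Polynomial.C (MvPolynomial.X i) := MvPolynomial.optionEquivLeft_X_some A _ i
        change _ = Polynomial.aeval 𝓟.x (MvPolynomial.optionEquivLeft A (Fin n) _)
        rw [this, Polynomial.aeval_C]
        exact MvPolynomial.aeval_X _ _
    refine (DFunLike.congr_fun h _).trans ?_
    exact congrArg (Polynomial.aeval 𝓟.x) ((MvPolynomial.optionEquivLeft A _).apply_symm_apply p)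
  let d : D := ⟨Polynomial.aeval 𝓟.x 𝓟.g, hD _⟩
  have hloc : IsLocalization.Away d C := by
    refine IsLocalization.Away.mk d 𝓟.hasMap.2 ?_ ?_
    · intro s
      obtain ⟨p, m, hp⟩ := 𝓟.exists_mul_aeval_x_g_pow_eq_aeval_x s
      exact ⟨m, ⟨_, hD p⟩, hp⟩
    · intro r s hrs
      exact ⟨0, by rw [Subtype.val_injective hrs]⟩
  let := (Algebra.TensorProduct.map (AlgHom.id A κ)
      (IsScalarTower.toAlgHom A D C)).toAlgebra
  have hloc' := isLocalization_away_tensor A κ D d C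
  have hd : (1 ⊗ₜ d : κ ⊗[A] D) ≠ 0 := by
    intro h0
    have := IsLocalization.Away.algebraMap_isUnit (S := κ ⊗[A] C) (1 ⊗ₜ d : κ ⊗[A] D)
    rw [h0, map_zero] at this
    exact not_isUnit_zero this
  exact IsLocalization.isDomain_of_le_nonZeroDivisors (κ ⊗[A] C)
    (Submonoid.powers_le.2 (mem_nonZeroDivisors_of_ne_zero hd))

/-- **Bertini–Noether**: if `B` is a domain of finite type over `A` and `Frac A` is algebraically
closed in `Frac B`, then the general fibres of `Spec B → Spec A` are integral. -/
lemma exists_isDomain_tensor (A B : Type u) [CommRing A] [IsDomain A] [CharZero A]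
    [IsNoetherianRing A] [CommRing B] [IsDomain B] [Algebra A B] [Algebra.FiniteType A B]
    (hAB : Function.Injective (algebraMap A B))
    (F : Type u) [Field F] [Algebra B F] [IsFractionRing B F] [Algebra A F] [IsScalarTower A B F]
    (hF : ∀ x : F, IsAlgebraic A x → ∃ a b : A, b ≠ 0 ∧ b • x = algebraMap A F a) :
    ∃ a : A, a ≠ 0 ∧ ∀ (κ : Type u) [Field κ] [Algebra A κ], algebraMap A κ a ≠ 0 →
      IsDomain (κ ⊗[A] B) := by
  obtain ⟨g, hg, n, _, _, _⟩ := exists_isStandardEtale_mvPolynomial A B hAB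
  let C := Localization.Away g
  have hle : Submonoid.powers g ≤ nonZeroDivisors B :=
    Submonoid.powers_le.2 (mem_nonZeroDivisors_of_ne_zero hg)
  have hC : IsDomain C := IsLocalization.isDomain_of_le_nonZeroDivisors C hle
  let : Algebra C F := IsLocalization.localizationAlgebraOfSubmonoidLe C F _ _ hle
  have : IsScalarTower B C F :=
      IsLocalization.localization_isScalarTower_of_submonoid_le C F _ _ hle
  have : IsFractionRing C F := .isFractionRing_of_isDomain_of_isLocalization
      (Submonoid.powers g) C F
  have : IsScalarTower A C F := .of_algebraMap_eq fun r ↦ by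
    rw [IsScalarTower.algebraMap_apply A B C, ← IsScalarTower.algebraMap_apply B C F,
      ← IsScalarTower.algebraMap_apply]
  have : Algebra.FiniteType A C := .trans (S := B) inferInstance inferInstance
  obtain ⟨a, ha, H⟩ := exists_isDomain_tensor_of_isStandardEtale A C n F hF
  obtain ⟨b, hb, H'⟩ := exists_tmul_mem_nonZeroDivisors (A := A) g
      (mem_nonZeroDivisors_of_ne_zero hg)
  refine ⟨a * b, mul_ne_zero ha hb, fun κ _ _ hκ ↦ ?_⟩
  rw [map_mul, mul_ne_zero_iff] at hκ
  let := (Algebra.TensorProduct.map (AlgHom.id A κ) (IsScalarTower.toAlgHom A B C)).toAlgebra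
  have hloc := isLocalization_away_tensor A κ B g C
  have := H κ hκ.1
  exact (IsLocalization.injective (κ ⊗[A] C) (Submonoid.powers_le.2 (H' κ hκ.2))).isDomain
    (algebraMap (κ ⊗[A] B) (κ ⊗[A] C))

end BertiniNoether

/-! ### Normality of general fibres -/

section Normal

/-- The **Grauert–Remmert criterion**: let `J` be a radical ideal of a Noetherian domain `R` and
`g ∈ J` with `J ⊆ √(g)`. If `R[1/g]` is integrally closed and `R = Hom_R(J, J)`, then `R` is
integrally closed. The last condition is expressed by means of the multiples of `g`. -/
lemma isIntegrallyClosed_of_isRadical (R : Type u) [CommRing R] [IsDomain R] [IsNoetherianRing R]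
    (g : R) (hg : g ≠ 0) (J : Ideal R) (hJ : J.IsRadical) (hgJ : g ∈ J)
    (hJg : J ≤ (Ideal.span {g}).radical) [IsIntegrallyClosed (Localization.Away g)]
    (hex : ∀ b : R, (∀ j ∈ J, ∃ j' ∈ J, b * j = g * j') → g ∣ b) : IsIntegrallyClosed R := by
  let F := FractionRing R
  let S := Localization.Away g
  have hRF : Function.Injective (algebraMap R F) := IsFractionRing.injective R F
  have hle : Submonoid.powers g ≤ nonZeroDivisors R :=
    Submonoid.powers_le.2 (mem_nonZeroDivisors_of_ne_zero hg)
  let : Algebra S F := IsLocalization.localizationAlgebraOfSubmonoidLe S F _ _ hle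
  have : IsScalarTower R S F :=
      IsLocalization.localization_isScalarTower_of_submonoid_le S F _ _ hle
  have : IsFractionRing S F := .isFractionRing_of_isDomain_of_isLocalization
      (Submonoid.powers g) S F
  -- an integral element of the fraction field outside `R` that is multiplied into `R` by `J` …
  have key : ∀ z : F, IsIntegral R z → (∀ j ∈ J, ∃ r, algebraMap R F r = j • z) →
      ∃ r, algebraMap R F r = z := by
    intro z hz hzJ
    -- … is even multiplied into `J` by `J`
    have hzJ' : ∀ j ∈ J, ∃ r ∈ J, algebraMap R F r = j • z := by
      intro j hj
      obtain ⟨r, hr⟩ := hzJ j hj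
      refine ⟨r, ?_, hr⟩
      obtain ⟨p, hp, hpz⟩ := hz
      refine hJ ⟨p.natDegree, ?_⟩
      have hev := Polynomial.eval₂_eq_sum_range (algebraMap R F) z (p := p)
      rw [Polynomial.eval₂_eq_sum_range, Finset.sum_range_succ, hp.coeff_natDegree, map_one,
        one_mul] at hpz
      have h1 : algebraMap R F (r ^ p.natDegree) = algebraMap R F
          (-∑ i ∈ Finset.range p.natDegree, p.coeff i * (j ^ (p.natDegree - i) * r ^ i)) := by
        rw [map_neg, map_pow, hr, map_sum, eq_neg_iff_add_eq_zero, add_comm]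
        have : ∀ i ∈ Finset.range p.natDegree,
            algebraMap R F (p.coeff i * (j ^ (p.natDegree - i) * r ^ i)) =
              algebraMap R F j ^ p.natDegree * (algebraMap R F (p.coeff i) * z ^ i) := by
          intro i hi
          rw [Finset.mem_range] at hi
          rw [map_mul, map_mul, map_pow, map_pow, hr, Algebra.smul_def, mul_pow,
            ← pow_sub_mul_pow _ hi.le]
          ring
        rw [Finset.sum_congr rfl this, ← Finset.mul_sum, Algebra.smul_def, mul_pow, ← mul_add, hpz,
          mul_zero]
      rw [hRF h1]
      refine neg_mem (sum_mem fun i hi ↦ Ideal.mul_mem_left _ _ (Ideal.mul_mem_right _ _ ?_))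
      rw [Finset.mem_range] at hi
      exact Ideal.pow_mem_of_mem _ hj _ (by omega)
    obtain ⟨b, hb⟩ := hzJ g hgJ
    have hgb : g ∣ b := by
      refine hex b fun j hj ↦ ?_
      obtain ⟨r, hr, hrz⟩ := hzJ' j hj
      refine ⟨r, hr, hRF ?_⟩
      rw [map_mul, map_mul, hrz, hb, Algebra.smul_def, Algebra.smul_def]
      ring
    obtain ⟨r, rfl⟩ := hgb
    refine ⟨r, ?_⟩
    rw [map_mul, Algebra.smul_def] at hb
    exact mul_left_cancel₀ ((map_ne_zero_iff _ hRF).2 hg) hb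
  rw [isIntegrallyClosed_iff F]
  intro x hx
  let I : Ideal R := (1 : Submodule R F).comap (LinearMap.toSpanSingleton R F x)
  have hI : ∀ r, r ∈ I ↔ ∃ t, algebraMap R F t = r • x := fun r ↦ by
    rw [Submodule.mem_comap, LinearMap.toSpanSingleton_apply, Submodule.mem_one]
  have hN : ∃ N, J ^ N ≤ I := by
    obtain ⟨s, hs⟩ := (isIntegrallyClosed_iff F).1 ‹IsIntegrallyClosed S› (x := x) (hx.tower_top)
    obtain ⟨n, a, ha⟩ := IsLocalization.Away.surj g s
    obtain ⟨M, hM⟩ := Ideal.exists_pow_le_of_le_radical_of_fg hJg (IsNoetherian.noetherian J)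
    refine ⟨M * n, ?_⟩
    rw [pow_mul]
    refine (Ideal.pow_right_mono hM n).trans ?_
    rw [Ideal.span_singleton_pow, Ideal.span_singleton_le_iff_mem, hI]
    refine ⟨a, ?_⟩
    rw [IsScalarTower.algebraMap_apply R S F, ← ha, map_mul, hs, map_pow,
      ← IsScalarTower.algebraMap_apply, Algebra.smul_def, map_pow, mul_comm]
  suffices h1 : (1 : R) ∈ I by
    obtain ⟨t, ht⟩ := (hI 1).1 h1
    exact ⟨t, by rw [ht, one_smul]⟩
  obtain ⟨N, hN⟩ := hN
  induction N with
  | zero => exact hN (by simp)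
  | succ N ih =>
    refine ih fun r hr ↦ ?_
    refine (hI r).2 (key (r • x) (hx.smul r) fun j hj ↦ ?_)
    obtain ⟨t, ht⟩ := (hI (j * r)).1 (hN (by rw [pow_succ']; exact Ideal.mul_mem_mul hj hr))
    exact ⟨t, by rw [ht, mul_smul]⟩

/-- The converse direction of the criterion: an element of the fraction field that multiplies a
nonzero finitely generated ideal into itself is integral. -/
lemma dvd_of_forall_mul_mem {B : Type u} [CommRing B] [IsDomain B] [IsIntegrallyClosed B]
    (g : B) (hg : g ≠ 0) (J : Ideal B) (hJ : J.FG) (hgJ : g ∈ J) (b : B)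
    (hb : ∀ j ∈ J, ∃ j' ∈ J, b * j = g * j') : g ∣ b := by
  let F := FractionRing B
  have hBF : Function.Injective (algebraMap B F) := IsFractionRing.injective B F
  have hg' : algebraMap B F g ≠ 0 := (map_ne_zero_iff _ hBF).2 hg
  have hint : IsIntegral B (algebraMap B F b / algebraMap B F g) := by
    refine isIntegral_of_smul_mem_submodule (Submodule.map (Algebra.linearMap B F) J) ?_
      (Submodule.FG.map _ hJ) _ ?_
    · rw [Submodule.ne_bot_iff]
      exact ⟨_, ⟨g, hgJ, rfl⟩, hg'⟩
    · rintro _ ⟨j, hj, rfl⟩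
      obtain ⟨j', hj', h⟩ := hb j hj
      refine ⟨j', hj', ?_⟩
      rw [Algebra.linearMap_apply, Algebra.linearMap_apply, smul_eq_mul, div_mul_eq_mul_div,
        eq_div_iff hg', ← map_mul, ← map_mul, h, mul_comm]
  obtain ⟨r, hr⟩ := (isIntegrallyClosed_iff F).1 ‹_› hint
  refine ⟨r, hBF ?_⟩
  rw [map_mul, hr, mul_div_cancel₀ _ hg']

/-- Normality persists on general fibres in characteristic zero, provided that they are integral. -/
lemma exists_isIntegrallyClosed_tensor (A B : Type u) [CommRing A] [IsDomain A] [CharZero A]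
    [IsNoetherianRing A] [CommRing B] [IsDomain B] [IsIntegrallyClosed B] [Algebra A B]
    [Algebra.FiniteType A B] (hAB : Function.Injective (algebraMap A B))
    (hdom : ∃ a : A, a ≠ 0 ∧ ∀ (κ : Type u) [Field κ] [Algebra A κ], algebraMap A κ a ≠ 0 →
      IsDomain (κ ⊗[A] B)) :
    ∃ a : A, a ≠ 0 ∧ ∀ (κ : Type u) [Field κ] [Algebra A κ], algebraMap A κ a ≠ 0 →
      IsIntegrallyClosed (κ ⊗[A] B) := by
  obtain ⟨g, hg, n, _, _, _⟩ := exists_etale_mvPolynomial A B hAB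
  have hnoeth : IsNoetherianRing B := Algebra.FiniteType.isNoetherianRing A B
  let J := (Ideal.span {g}).radical
  have hgJ : g ∈ J := Ideal.le_radical (Ideal.mem_span_singleton_self g)
  have hJfg : J.FG := IsNoetherian.noetherian J
  let gJ : Ideal B := Ideal.span {g} * J
  obtain ⟨s, hs⟩ := hJfg
  have hsJ : ∀ j ∈ s, j ∈ J := fun j hj ↦ hs ▸ Ideal.subset_span hj
  let v : B →ₗ[B] (s → B ⧸ gJ) := LinearMap.pi fun j ↦
    gJ.mkQ ∘ₗ LinearMap.mulRight B (j : B)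
  let u : B →ₗ[A] B := LinearMap.mulLeft A g
  have huv : Function.Exact u v := by
    intro b
    constructor
    · intro hb
      have : g ∣ b := by
        refine dvd_of_forall_mul_mem g hg J ⟨s, hs⟩ hgJ b fun j hj ↦ ?_
        suffices h : b * j ∈ gJ by
          obtain ⟨j', hj', h⟩ := Ideal.mem_span_singleton_mul.1 h
          exact ⟨j', hj', h.symm⟩
        rw [← hs] at hj
        induction hj using Submodule.span_induction with
        | mem j hj =>
          have := congrFun hb ⟨j, hj⟩
          exact (Submodule.Quotient.mk_eq_zero gJ).1 this
        | zero => rw [mul_zero]; exact zero_mem _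
        | add x y _ _ hx hy => rw [mul_add]; exact add_mem hx hy
        | smul r x _ hx => rw [smul_eq_mul, mul_left_comm]; exact Ideal.mul_mem_left _ _ hx
      obtain ⟨c, rfl⟩ := this
      exact ⟨c, rfl⟩
    · rintro ⟨c, rfl⟩
      ext j
      refine (Submodule.Quotient.mk_eq_zero gJ).2 ?_
      change g * c * j ∈ gJ
      rw [mul_assoc]
      exact Ideal.mul_mem_mul (Ideal.mem_span_singleton_self g) (J.mul_mem_left c (hsJ _ j.2))
  have hred : IsReduced (B ⧸ J) :=
    (Ideal.isRadical_iff_quotient_reduced J).1 (Ideal.radical_isRadical _)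
  obtain ⟨a₁, ha₁, H₁⟩ := hdom
  obtain ⟨a₂, ha₂, H₂⟩ := exists_isReduced_tensor A (B ⧸ J)
  obtain ⟨a₃, ha₃, H₃⟩ := exists_tmul_mem_nonZeroDivisors (A := A) g
      (mem_nonZeroDivisors_of_ne_zero hg)
  obtain ⟨a₄, ha₄, H₄⟩ := exists_lTensor_exact u v huv
  refine ⟨a₁ * a₂ * a₃ * a₄, by simp [ha₁, ha₂, ha₃, ha₄], fun κ _ _ hκ ↦ ?_⟩
  simp only [map_mul, mul_ne_zero_iff] at hκ
  obtain ⟨⟨⟨h₁, h₂⟩, h₃⟩, h₄⟩ := hκ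
  replace H₁ := H₁ κ h₁
  replace H₂ := H₂ κ h₂
  replace H₃ := H₃ κ h₃
  replace H₄ := H₄ κ h₄
  let R := κ ⊗[A] B
  let γ : R := 1 ⊗ₜ g
  have hγ : γ ≠ 0 := nonZeroDivisors.ne_zero H₃
  let ι : B →ₐ[A] R := Algebra.TensorProduct.includeRight
  let Jκ : Ideal R := J.map ι
  have hnoethR : IsNoetherianRing R := Algebra.FiniteType.isNoetherianRing κ R
  have hloc : IsIntegrallyClosed (Localization.Away γ) := by
    let C := Localization.Away g
    let := (Algebra.TensorProduct.map (AlgHom.id A κ) (IsScalarTower.toAlgHom A B C)).toAlgebra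
    have hloc := isLocalization_away_tensor A κ B g C
    let e : (κ ⊗[A] C) ≃ₐ[R] Localization.Away γ :=
      IsLocalization.algEquiv (Submonoid.powers γ) _ _
    have : IsDomain (κ ⊗[A] C) := IsLocalization.isDomain_of_le_nonZeroDivisors (κ ⊗[A] C)
      (Submonoid.powers_le.2 H₃)
    have := isIntegrallyClosed_tensor_of_etale_mvPolynomial A κ C n
    exact .of_equiv e.toRingEquiv
  refine isIntegrallyClosed_of_isRadical R γ hγ Jκ ?_ (Ideal.mem_map_of_mem ι hgJ) ?_ ?_
  · have hker := Algebra.TensorProduct.lTensor_ker (A := κ) (Ideal.Quotient.mkₐ A J)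
      (Ideal.Quotient.mkₐ_surjective A J)
    have hJ : RingHom.ker (Ideal.Quotient.mkₐ A J) = J := Ideal.Quotient.mkₐ_ker A J
    rw [hJ] at hker
    change (J.map ι).IsRadical
    rw [← hker]
    have hsurj : Function.Surjective
        (Algebra.TensorProduct.map (AlgHom.id A κ) (Ideal.Quotient.mkₐ A J)) :=
      Algebra.TensorProduct.map_surjective (AlgHom.id A κ) (Ideal.Quotient.mkₐ A J)
        Function.surjective_id (Ideal.Quotient.mkₐ_surjective A J)
    exact (RingHom.ker_isRadical_iff_reduced_of_surjective hsurj).2 H₂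
  · refine Ideal.map_le_iff_le_comap.2 fun j hj ↦ ?_
    obtain ⟨m, hm⟩ := hj
    refine ⟨m, ?_⟩
    obtain ⟨c, hc⟩ := Ideal.mem_span_singleton.1 hm
    rw [← map_pow, hc, map_mul]
    exact Ideal.mul_mem_right _ _ (Ideal.mem_span_singleton_self γ)
  · intro b hb
    have hzero : (v.restrictScalars A).lTensor κ b = 0 := by
      classical
      apply (TensorProduct.piRight A A κ fun _ : s ↦ B ⧸ gJ).injective
      rw [map_zero]
      ext j
      let m : R →ₐ[A] κ ⊗[A] (B ⧸ gJ) :=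
        Algebra.TensorProduct.map (AlgHom.id A κ) (Ideal.Quotient.mkₐ A gJ)
      have hcomp : ∀ x : κ ⊗[A] B, TensorProduct.piRight A A κ (fun _ : s ↦ B ⧸ gJ)
          ((v.restrictScalars A).lTensor κ x) j = m (x * ι j) := by
        intro x
        induction x with
        | zero => rw [map_zero, map_zero, zero_mul, map_zero]; rfl
        | add x y hx hy => rw [map_add, map_add, add_mul, map_add, ← hx, ← hy]; rfl
        | tmul c y =>
          change c ⊗ₜ _ = m ((c ⊗ₜ y) * (1 ⊗ₜ (j : B)))
          rw [Algebra.TensorProduct.tmul_mul_tmul, mul_one]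
          rfl
      rw [hcomp]
      obtain ⟨j', hj', h⟩ := hb (ι j) (Ideal.mem_map_of_mem ι (hsJ _ j.2))
      rw [h]
      have hm : ∀ x ∈ Jκ, m (γ * x) = 0 := by
        intro x hx
        induction hx using Submodule.span_induction with
        | zero => rw [mul_zero, map_zero]
        | add x y _ _ hx hy => rw [mul_add, map_add, hx, hy, add_zero]
        | mem x hx =>
          obtain ⟨y, hy, rfl⟩ := hx
          change m ((1 ⊗ₜ g) * (1 ⊗ₜ y)) = 0
          rw [Algebra.TensorProduct.tmul_mul_tmul]
          change _ ⊗ₜ _ = 0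
          have : gJ.mkQ (g * y) = 0 := (Submodule.Quotient.mk_eq_zero gJ).2
            (Ideal.mul_mem_mul (Ideal.mem_span_singleton_self g) hy)
          exact (congrArg _ this).trans (TensorProduct.tmul_zero _ _)
        | smul r x _ hx =>
          rw [smul_eq_mul, mul_left_comm, map_mul, hx, mul_zero]
      exact hm j' hj'
    obtain ⟨c, hc⟩ := (H₄ b).1 hzero
    have hmul : ∀ x : κ ⊗[A] B, u.lTensor κ x = γ * x := by
      intro x
      induction x with
      | zero => rw [map_zero, mul_zero]
      | tmul c b =>
        change c ⊗ₜ (g * b) = (1 ⊗ₜ g) * (c ⊗ₜ b)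
        rw [Algebra.TensorProduct.tmul_mul_tmul, one_mul]
      | add x y hx hy => rw [map_add, hx, hy, mul_add]
    exact ⟨c, by rw [← hc, hmul]⟩

end Normal

/-! ### The algebraic closure of the base in an extension -/

section AlgebraicClosure

/-- If `B` is an integrally closed domain of finite type over a domain `A`, then the algebraic
closure of `Frac A` in `Frac B` is finite over `Frac A`: it is contained in `Frac A ⊗ B`, hence
embeds into the residue fields of that ring. -/
lemma finite_algebraicClosure (A B F : Type u) [CommRing A] [IsDomain A] [CommRing B] [IsDomain B]
    [IsIntegrallyClosed B] [Algebra A B] [Algebra.FiniteType A B] [Field F] [Algebra B F]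
    [IsFractionRing B F] [Algebra A F] [IsScalarTower A B F]
    (K : Type u) [Field K] [Algebra A K] [IsFractionRing A K] [Algebra K F] [IsScalarTower A K F] :
    Module.Finite K (algebraicClosure K F) := by
  let φ : K ⊗[A] B →ₐ[K] F := Algebra.TensorProduct.lift (Algebra.ofId K F)
    (IsScalarTower.toAlgHom A B F) fun _ _ ↦ .all _ _
  let E := φ.range
  have : Algebra.FiniteType K E := .of_surjective φ.rangeRestrict φ.rangeRestrict_surjective
  obtain ⟨M, hM⟩ := Ideal.exists_maximal E
  let : Field (E ⧸ M) := Ideal.Quotient.field M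
  have : Module.Finite K (E ⧸ M) := finite_of_finite_type_of_isJacobsonRing _ _
  have hle : (algebraicClosure K F).toSubalgebra ≤ E := by
    intro x hx
    have hx' : IsAlgebraic A x := (IsFractionRing.isAlgebraic_iff A K F).2
      (mem_algebraicClosure_iff.1 hx)
    obtain ⟨d, hd, hint⟩ := hx'.exists_integral_multiple
    obtain ⟨b, hb⟩ := (isIntegrallyClosed_iff F).1 ‹IsIntegrallyClosed B› (x := d • x)
      (hint.tower_top)
    have hd' : algebraMap A F d ≠ 0 := by
      rw [IsScalarTower.algebraMap_apply A K F]
      exact (map_ne_zero_iff _ (algebraMap K F).injective).2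
        ((map_ne_zero_iff _ (IsFractionRing.injective A K)).2 hd)
    refine ⟨(algebraMap A K d)⁻¹ ⊗ₜ b, ?_⟩
    change algebraMap K F _ * algebraMap B F b = x
    rw [hb, map_inv₀, ← IsScalarTower.algebraMap_apply, Algebra.smul_def, inv_mul_cancel_left₀ hd']
  let ψ : algebraicClosure K F →ₐ[K] E ⧸ M :=
    (Ideal.Quotient.mkₐ K M).comp (Subalgebra.inclusion hle)
  exact Module.Finite.of_injective ψ.toLinearMap ψ.toRingHom.injective

/-- Under the assumptions of `finite_algebraicClosure`, the algebraic closure of `Frac A` in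
`Frac B` is the fraction field of a finite `A`-algebra. -/
lemma exists_finite_subalgebra (A B F : Type u) [CommRing A] [IsDomain A] [CommRing B] [IsDomain B]
    [IsIntegrallyClosed B] [Algebra A B] [Algebra.FiniteType A B] [Field F] [Algebra B F]
    [IsFractionRing B F] [Algebra A F] [IsScalarTower A B F]
    (hAB : Function.Injective (algebraMap A B)) :
    ∃ T : Subalgebra A F, Module.Finite A T ∧
      ∀ x : F, IsAlgebraic A x → ∃ a : A, a ≠ 0 ∧ a • x ∈ T := by
  have hAF : Function.Injective (algebraMap A F) := by
    rw [IsScalarTower.algebraMap_eq A B F]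
    exact (IsFractionRing.injective B F).comp hAB
  have : FaithfulSMul A F := (faithfulSMul_iff_algebraMap_injective A F).2 hAF
  let K := FractionRing A
  let : Algebra K F := FractionRing.liftAlgebra A F
  have : IsScalarTower A K F := FractionRing.isScalarTower_liftAlgebra A F
  have := finite_algebraicClosure A B F K
  let b := Module.finBasis K (algebraicClosure K F)
  have hb : ∀ i, ∃ c : A, c ≠ 0 ∧ IsIntegral A (c • (b i : F)) := by
    intro i
    exact ((IsFractionRing.isAlgebraic_iff A K F).2
      (mem_algebraicClosure_iff.1 (b i).2)).exists_integral_multiple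
  choose c hc hint using hb
  refine ⟨Algebra.adjoin A (Set.range fun i ↦ c i • (b i : F)),
    Algebra.finite_adjoin_of_finite_of_isIntegral (Set.finite_range _) ?_, fun x hx ↦ ?_⟩
  · rintro _ ⟨i, rfl⟩
    exact hint i
  have hx' : x ∈ algebraicClosure K F :=
    mem_algebraicClosure_iff.2 ((IsFractionRing.isAlgebraic_iff A K F).1 hx)
  -- clear the denominators of the coordinates of `x` with respect to the basis `c i • b i`
  obtain ⟨⟨d, hd⟩, hd'⟩ := IsLocalization.exist_integer_multiples_of_finite (nonZeroDivisors A)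
    fun i ↦ b.repr ⟨x, hx'⟩ i / algebraMap A K (c i)
  choose r hr using hd'
  refine ⟨d, nonZeroDivisors.ne_zero hd, ?_⟩
  have hsum : d • x = ∑ i, r i • (c i • (b i : F)) := by
    have h1 := congrArg Subtype.val (b.sum_repr ⟨x, hx'⟩)
    rw [← show (_ : F) = x from h1, AddSubmonoidClass.coe_finsetSum, Finset.smul_sum]
    refine Finset.sum_congr rfl fun i _ ↦ ?_
    have h2 := hr i
    have h3 : algebraMap A K (c i) ≠ 0 :=
      (map_ne_zero_iff _ (IsFractionRing.injective A K)).2 (hc i)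
    have h4 : (r i • c i • (b i : F)) = (algebraMap A K (r i) * algebraMap A K (c i)) • (b i : F) :=
        by
      rw [mul_smul, algebraMap_smul, algebraMap_smul]
    rw [h4, h2]
    change d • (_ • (b i : F)) = _
    rw [smul_mul_assoc, div_mul_cancel₀ _ h3, smul_assoc]
  rw [hsum]
  exact sum_mem fun i _ ↦ Subalgebra.smul_mem _ (Algebra.subset_adjoin (Set.mem_range_self i)) _

end AlgebraicClosure

/-! ### General fibres of finite extensions -/

section TorsionFree

/-- A domain which is finite over a subring embeds, as a module, into a free module of finite
rank. -/
lemma exists_injective_pi (C B : Type u) [CommRing C] [IsDomain C] [CommRing B] [IsDomain B]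
    [Algebra C B] [Module.Finite C B] (hCB : Function.Injective (algebraMap C B)) :
    ∃ (n : ℕ) (v : B →ₗ[C] (Fin n → C)), Function.Injective v := by
  let K := FractionRing C
  let ι : B →ₗ[C] K ⊗[C] B := TensorProduct.mk C K B 1
  have hloc : IsLocalizedModule (nonZeroDivisors C) ι :=
    (isLocalizedModule_iff_isBaseChange (nonZeroDivisors C) K _).2
        (TensorProduct.isBaseChange C B K)
  have hι : Function.Injective ι := by
    rw [injective_iff_map_eq_zero]
    intro x hx
    obtain ⟨c, hc⟩ := (IsLocalizedModule.eq_zero_iff (nonZeroDivisors C) ι).1 hx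
    rw [Submonoid.smul_def, Algebra.smul_def, mul_eq_zero] at hc
    exact hc.resolve_left fun h ↦ nonZeroDivisors.ne_zero c.2 (hCB (h.trans (map_zero _).symm))
  let b := Module.finBasis K (K ⊗[C] B)
  obtain ⟨s, hs⟩ := Module.Finite.fg_top (R := C) (M := B)
  obtain ⟨c, hc⟩ := IsLocalization.exist_integer_multiples_of_finite (nonZeroDivisors C)
    (fun x : s × Fin (Module.finrank K (K ⊗[C] B)) ↦ b.repr (ι x.1) x.2)
  let w (i) : B →ₗ[C] K := c.1 • ((b.coord i).restrictScalars C ∘ₗ ι)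
  have hw : ∀ i x, w i x ∈ LinearMap.range (Algebra.linearMap C K) := by
    intro i x
    have hx : x ∈ Submodule.span C (s : Set B) := hs ▸ trivial
    induction hx using Submodule.span_induction with
    | mem x hx => exact hc (⟨x, hx⟩, i)
    | zero => rw [map_zero]; exact zero_mem _
    | add x y _ _ hx hy => rw [map_add]; exact add_mem hx hy
    | smul r x _ hx => rw [map_smul]; exact Submodule.smul_mem _ r hx
  let e := LinearEquiv.ofInjective (Algebra.linearMap C K) (IsFractionRing.injective C K)
  refine ⟨_, LinearMap.pi fun i ↦ e.symm.toLinearMap ∘ₗ (w i).codRestrict _ (hw i), ?_⟩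
  rw [injective_iff_map_eq_zero]
  intro x hx
  refine hι ((b.ext_elem fun i ↦ ?_).trans (map_zero ι).symm)
  have h₁ : (w i).codRestrict _ (hw i) x = 0 := by
    simpa using congrFun hx i
  have h₂ : c.1 • b.repr (ι x) i = 0 := congrArg Subtype.val h₁
  rw [map_zero]
  rw [Algebra.smul_def, mul_eq_zero] at h₂
  exact h₂.resolve_left fun h ↦ nonZeroDivisors.ne_zero c.2
    (IsFractionRing.injective C K (h.trans (map_zero _).symm))

variable {A : Type u} [CommRing A] [IsDomain A] [IsNoetherianRing A]

/-- If `B` is a domain which is finite over a subring `C`, then a general fibre of `B` is torsion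
free over the corresponding fibre of `C`. -/
lemma exists_forall_mul_eq_zero_tensor (C B : Type u) [CommRing C] [IsDomain C] [CommRing B]
    [IsDomain B] [Algebra A C] [Algebra.FiniteType A C] [Algebra C B] [Module.Finite C B]
    [Algebra A B] [IsScalarTower A C B] (hCB : Function.Injective (algebraMap C B)) :
    ∃ a : A, a ≠ 0 ∧ ∀ (κ : Type u) [Field κ] [Algebra A κ], algebraMap A κ a ≠ 0 →
      IsDomain (κ ⊗[A] C) → ∀ (d : κ ⊗[A] C) (z : κ ⊗[A] B),
        Algebra.TensorProduct.map (AlgHom.id A κ) (IsScalarTower.toAlgHom A C B) d * z = 0 →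
          d = 0 ∨ z = 0 := by
  obtain ⟨n, v, hv⟩ := exists_injective_pi C B hCB
  obtain ⟨a, ha, H⟩ := exists_lTensor_injective (A := A) (B := C) v hv
  refine ⟨a, ha, fun κ _ _ hκ hdom d z hdz ↦ or_iff_not_imp_left.2 fun hd ↦ H κ hκ ?_⟩
  rw [map_zero]
  apply (TensorProduct.piRight A κ κ (fun _ : Fin n ↦ C)).injective
  rw [map_zero]
  ext i
  let w : κ ⊗[A] B →ₗ[A] κ ⊗[A] C := (((LinearMap.proj i).comp v).restrictScalars A).lTensor κ
  have hw : ∀ z, TensorProduct.piRight A κ κ (fun _ : Fin n ↦ C)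
      ((v.restrictScalars A).lTensor κ z) i = w z := by
    intro z
    induction z with
    | zero => simp
    | add x y hx hy => simp only [map_add, Pi.add_apply, hx, hy]
    | tmul x y => simp [w]
  have hmul : ∀ d z, w (Algebra.TensorProduct.map (AlgHom.id A κ)
      (IsScalarTower.toAlgHom A C B) d * z) = d * w z := by
    intro d z
    induction z with
    | zero => simp
    | add x y hx hy => simp only [map_add, mul_add, hx, hy]
    | tmul x y =>
      induction d with
      | zero => simp
      | add d e hd he => simp only [map_add, add_mul, hd, he]
      | tmul d e =>
        simp [w, ← Algebra.smul_def]
  have h := hmul d z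
  rw [hdz, map_zero, eq_comm, mul_eq_zero] at h
  exact (hw z).trans (h.resolve_left hd)

end TorsionFree

section Components

/-- The points of the spectrum of a reduced artinian ring are open. -/
lemma exists_mul_eq_zero_of_isArtinianRing {R : Type*} [CommRing R] [IsArtinianRing R]
    [IsReduced R] (m : Ideal R) [hm : m.IsMaximal] : ∃ e : R, e ∉ m ∧ ∀ x ∈ m, x * e = 0 := by
  classical
  let M : MaximalSpectrum R := ⟨m, hm⟩
  obtain ⟨e, he⟩ := (IsArtinianRing.equivPi R).surjective (Pi.single M 1)
  refine ⟨e, fun h ↦ ?_, fun x hx ↦ (IsArtinianRing.equivPi R).injective ?_⟩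
  · have h₁ := congrFun he M
    rw [IsArtinianRing.equivPi_apply, Pi.single_eq_same] at h₁
    have h₂ : Ideal.Quotient.mk m e = 0 := Ideal.Quotient.eq_zero_iff_mem.2 h
    have : Nontrivial (R ⧸ m) := inferInstance
    exact zero_ne_one (h₂.symm.trans h₁)
  · rw [map_mul, he, map_zero]
    ext I
    rw [Pi.mul_apply]
    by_cases hI : I = M
    · subst hI
      have h₂ : Ideal.Quotient.mk m x = 0 := Ideal.Quotient.eq_zero_iff_mem.2 hx
      rw [Pi.single_eq_same, mul_one]
      exact h₂
    · rw [Pi.single_eq_of_ne hI, mul_zero]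
      rfl

/-- A nonzero element of an integral extension of domains divides a nonzero element of the base. -/
lemma exists_dvd_algebraMap {A T : Type*} [CommRing A] [Nontrivial A] [CommRing T] [IsDomain T]
    [Algebra A T] [Algebra.IsIntegral A T] {τ : T} (hτ : τ ≠ 0) :
    ∃ a : A, a ≠ 0 ∧ τ ∣ algebraMap A T a := by
  obtain ⟨a, ha, ha0⟩ := Submodule.exists_mem_ne_zero_of_ne_bot
    (Ideal.comap_ne_bot_of_integral_mem (R := A) hτ (Ideal.mem_span_singleton_self τ)
      (Algebra.IsIntegral.isIntegral τ))
  exact ⟨a, ha0, Ideal.mem_span_singleton.1 ha⟩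

lemma exists_ringHom_tensor {A κ B E : Type*} [CommRing A] [CommRing κ] [CommRing B] [CommRing E]
    [Algebra A κ] [Algebra A B] (f : κ →+* E) (h : B →+* E)
    (hfh : f.comp (algebraMap A κ) = h.comp (algebraMap A B)) :
    ∃ g : κ ⊗[A] B →+* E, (∀ x, g (x ⊗ₜ 1) = f x) ∧ ∀ b, g (1 ⊗ₜ b) = h b := by
  let : Algebra A E := (f.comp (algebraMap A κ)).toAlgebra
  let f' : κ →ₐ[A] E := { f with commutes' _ := rfl }
  let h' : B →ₐ[A] E := { h with commutes' a := (DFunLike.congr_fun hfh a).symm }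
  refine ⟨(Algebra.TensorProduct.lift f' h' fun _ _ ↦ .all _ _).toRingHom, fun x ↦ ?_, fun b ↦ ?_⟩
  · simp [f']
  · simp [h']

variable {A T C B : Type u} [CommRing A] [CommRing T] [CommRing C] [CommRing B] [Algebra A T]
  [Algebra A C] [Algebra A B] [Algebra T B] [Algebra C B] [IsScalarTower A T B]
  [IsScalarTower A C B] {κ : Type u} [Field κ] [Algebra A κ] [Algebra T κ] [IsScalarTower A T κ]

variable (A T C B κ) in
/-- For a finite extension `T` of `A` and an extension `B` of both `T` and `C`, the fibre of `Spec
B` over a point of `Spec T` maps to the fibre of `Spec C` over the image of this point in `Spec A`.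
-/
lemma exists_tensorComparison : ∃ g : κ ⊗[A] C →+* κ ⊗[T] B,
    (∀ x, g (x ⊗ₜ 1) = x ⊗ₜ 1) ∧ ∀ c, g (1 ⊗ₜ c) = 1 ⊗ₜ algebraMap C B c := by
  refine exists_ringHom_tensor (Algebra.TensorProduct.includeLeftRingHom : κ →+* κ ⊗[T] B)
    ((Algebra.TensorProduct.includeRight : B →ₐ[T] κ ⊗[T] B).toRingHom.comp (algebraMap C B)) ?_
  ext a
  change algebraMap A κ a ⊗ₜ 1 = (1 : κ) ⊗ₜ[T] algebraMap C B (algebraMap A C a)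
  rw [← IsScalarTower.algebraMap_apply A C B, IsScalarTower.algebraMap_apply A T B,
    IsScalarTower.algebraMap_apply A T κ, Algebra.TensorProduct.tmul_one_eq_one_tmul]

/-- The fibre of `B` over a point of a finite extension `T` of `A` is a union of connected
components of the fibre over the image of that point in `A`. Hence it is torsion free over a subring
of the latter over which the latter is. -/
lemma injective_tensorComparison [Module.Finite A T] [IsReduced (κ ⊗[A] T)]
    (H : ∀ (d : κ ⊗[A] C) (z : κ ⊗[A] B),
        Algebra.TensorProduct.map (AlgHom.id A κ) (IsScalarTower.toAlgHom A C B) d * z = 0 →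
          d = 0 ∨ z = 0) [Nontrivial (κ ⊗[T] B)] (g : κ ⊗[A] C →+* κ ⊗[T] B)
    (hg₁ : ∀ x, g (x ⊗ₜ 1) = x ⊗ₜ 1) (hg₂ : ∀ c, g (1 ⊗ₜ c) = 1 ⊗ₜ algebraMap C B c) :
    Function.Injective g := by
  rw [injective_iff_map_eq_zero]
  intro d hd
  let χ : κ ⊗[A] T →ₐ[κ] κ := Algebra.TensorProduct.lift (AlgHom.id κ κ)
    (IsScalarTower.toAlgHom A T κ) fun _ _ ↦ .all _ _
  have hχ : Function.Surjective χ := fun x ↦ ⟨x ⊗ₜ 1, by simp [χ]⟩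
  have : IsArtinianRing (κ ⊗[A] T) := IsArtinianRing.of_finite κ _
  have hmax : (RingHom.ker χ).IsMaximal := RingHom.ker_isMaximal_of_surjective χ hχ
  obtain ⟨e, he, he'⟩ := exists_mul_eq_zero_of_isArtinianRing (RingHom.ker χ)
  let μ : κ ⊗[A] T →ₐ[κ] κ ⊗[A] B :=
    Algebra.TensorProduct.map (AlgHom.id κ κ) (IsScalarTower.toAlgHom A T B)
  let R := (κ ⊗[A] B) ⧸ (Ideal.span {μ e}).annihilator
  have hR : ∀ z : κ ⊗[A] B, Ideal.Quotient.mk (Ideal.span {μ e}).annihilator z = 0 ↔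
      z * μ e = 0 := fun z ↦ by
    rw [Ideal.Quotient.eq_zero_iff_mem]
    exact Submodule.mem_annihilator_span_singleton _ _
  let r : B →+* R := (Ideal.Quotient.mk _).comp
    (Algebra.TensorProduct.includeRight : B →ₐ[A] κ ⊗[A] B).toRingHom
  obtain ⟨h, hh₁, hh₂⟩ := exists_ringHom_tensor (A := T) ((Ideal.Quotient.mk
      (Ideal.span {μ e}).annihilator).comp
      (Algebra.TensorProduct.includeLeftRingHom : κ →+* κ ⊗[A] B)) r (by
    ext τ
    change Ideal.Quotient.mk _ (algebraMap T κ τ ⊗ₜ[A] 1) =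
      Ideal.Quotient.mk _ (1 ⊗ₜ[A] algebraMap T B τ)
    rw [← sub_eq_zero, ← map_sub, hR]
    have h : algebraMap T κ τ ⊗ₜ[A] 1 - 1 ⊗ₜ[A] τ ∈ RingHom.ker χ := by
      simp [RingHom.mem_ker, χ]
    have := congrArg μ (he' _ h)
    rw [map_mul, map_zero] at this
    rw [← this]
    simp [μ])
  have hcomp : ∀ d, h (g d) = Ideal.Quotient.mk _
      (Algebra.TensorProduct.map (AlgHom.id A κ) (IsScalarTower.toAlgHom A C B) d) := by
    intro d
    induction d with
    | zero => simp
    | add x y hx hy => simp only [map_add, hx, hy]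
    | tmul x c =>
      have : (x ⊗ₜ[A] c : κ ⊗[A] C) = x ⊗ₜ 1 * 1 ⊗ₜ c := by simp
      rw [this, map_mul, map_mul, map_mul, map_mul, hg₁, hg₂, hh₁, hh₂]
      simp [r]
  have hzero := hcomp d
  rw [hd, map_zero, eq_comm, hR] at hzero
  refine (H _ _ hzero).resolve_right fun h0 ↦ ?_
  obtain ⟨g', hg₁', hg₂'⟩ := exists_tensorComparison A T B B κ
  have hχe : ∀ e, g' (μ e) = χ e ⊗ₜ 1 := by
    intro e
    induction e with
    | zero => simp
    | add x y hx hy => simp only [map_add, hx, hy, TensorProduct.add_tmul]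
    | tmul x τ =>
      have : μ (x ⊗ₜ[A] τ) = x ⊗ₜ 1 * 1 ⊗ₜ algebraMap T B τ := by simp [μ]
      rw [this, map_mul, hg₁', hg₂', Algebra.algebraMap_self_apply,
        ← Algebra.TensorProduct.tmul_one_eq_one_tmul]
      simp [χ]
  have h1 := hχe e
  rw [h0, map_zero] at h1
  have h2 : (χ e)⁻¹ ⊗ₜ[T] (1 : B) * χ e ⊗ₜ 1 = 1 := by
    rw [Algebra.TensorProduct.tmul_mul_tmul, inv_mul_cancel₀ he, mul_one]
    rfl
  rw [← h1, mul_zero] at h2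
  exact zero_ne_one h2

end Components

section Surjectivity

variable (A T C B : Type u) [CommRing A] [CommRing T] [CommRing C] [CommRing B] [Algebra A T]
  [Algebra A C] [Algebra A B] [Algebra T B] [Algebra C B] [IsScalarTower A T B]
  [IsScalarTower A C B] [IsDomain A] [IsNoetherianRing A] [CharZero A] [IsDomain T] [IsDomain C]
  [IsDomain B] [Module.Finite A T] [Algebra.FiniteType A C] [Module.Finite C B]

lemma exists_injective_tensorComparison (hTB : Function.Injective (algebraMap T B))
    (hCB : Function.Injective (algebraMap C B)) :
    ∃ a : A, a ≠ 0 ∧ ∀ (κ : Type u) [Field κ] [Algebra A κ] [Algebra T κ] [IsScalarTower A T κ],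
      algebraMap A κ a ≠ 0 → IsDomain (κ ⊗[A] C) → ∀ (g : κ ⊗[A] C →+* κ ⊗[T] B),
        (∀ x, g (x ⊗ₜ 1) = x ⊗ₜ 1) → (∀ c, g (1 ⊗ₜ c) = 1 ⊗ₜ algebraMap C B c) →
          Function.Injective g := by
  have : IsNoetherianRing T := IsNoetherianRing.of_finite A T
  have : Algebra.FiniteType A B := .trans (S := C) inferInstance inferInstance
  have : Algebra.FiniteType T B := .of_restrictScalars_finiteType A T B
  obtain ⟨a, ha, Ha⟩ := exists_forall_mul_eq_zero_tensor (A := A) C B hCB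
  obtain ⟨b, hb, Hb⟩ := exists_isReduced_tensor A T
  obtain ⟨τ, hτ, Hτ⟩ := exists_nontrivial_tensor_of_injective (A := T) (B := B) hTB
  obtain ⟨c, hc, τ', hc'⟩ := exists_dvd_algebraMap (A := A) hτ
  refine ⟨a * b * c, mul_ne_zero (mul_ne_zero ha hb) hc, fun κ _ _ _ _ hκ hdom g hg₁ hg₂ ↦ ?_⟩
  rw [map_mul, map_mul, mul_ne_zero_iff, mul_ne_zero_iff] at hκ
  have := Hb κ hκ.1.2
  have := Hτ κ fun h0 ↦ hκ.2 (by
    rw [IsScalarTower.algebraMap_apply A T κ, hc', map_mul, h0, zero_mul])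
  exact injective_tensorComparison (Ha κ hκ.1.1 hdom) g hg₁ hg₂

end Surjectivity

/-! ### Ramification of general fibres -/

section Ramification

/-- In characteristic zero, the differentials coming from a finite subextension are torsion. -/
lemma exists_forall_smul_derivation_eq_zero {A T B M : Type*} [CommRing A] [IsDomain A] [CharZero A]
    [CommRing T] [IsDomain T] [Algebra A T] [Module.Finite A T]
    (hAT : Function.Injective (algebraMap A T)) [CommRing B] [Algebra A B] [Algebra T B]
    [IsScalarTower A T B] [AddCommGroup M] [Module A M] [Module B M] [IsScalarTower A B M]
    (D : Derivation A B M) :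
    ∃ e : T, e ≠ 0 ∧ ∀ τ, algebraMap T B e • D (algebraMap T B τ) = 0 := by
  classical
  have hone : ∀ τ : T, ∃ e : T, e ≠ 0 ∧ algebraMap T B e • D (algebraMap T B τ) = 0 := by
    intro τ
    let S : Set (Polynomial A) := {P | P ≠ 0 ∧ Polynomial.aeval τ P = 0}
    have hS : S.Nonempty := (Algebra.IsIntegral.isIntegral (R := A) τ).isAlgebraic
    obtain ⟨P, ⟨hP0, hP⟩, hmin⟩ := (measure Polynomial.natDegree).wf.has_min S hS
    have hdeg : P.natDegree ≠ 0 := by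
      intro h
      rw [Polynomial.eq_C_of_natDegree_eq_zero h, Polynomial.aeval_C] at hP
      refine hP0 ?_
      rw [Polynomial.eq_C_of_natDegree_eq_zero h, hAT (hP.trans (map_zero _).symm), map_zero]
    refine ⟨Polynomial.aeval τ P.derivative, fun h ↦ hmin P.derivative ⟨fun h0 ↦ hdeg ?_, h⟩
      (Polynomial.natDegree_derivative_lt hdeg), ?_⟩
    · exact Polynomial.derivative_eq_zero.1 h0
    · rw [← Polynomial.aeval_algebraMap_apply, ← D.map_aeval, Polynomial.aeval_algebraMap_apply, hP,
        map_zero, map_zero]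
  choose e he he' using hone
  obtain ⟨s, hs⟩ := Module.Finite.fg_top (R := A) (M := T)
  refine ⟨∏ x ∈ s, e x, Finset.prod_ne_zero_iff.2 fun x _ ↦ he x, fun τ ↦ ?_⟩
  have hτ : τ ∈ Submodule.span A (s : Set T) := hs ▸ trivial
  induction hτ using Submodule.span_induction with
  | mem x hx =>
    rw [← Finset.prod_erase_mul _ _ hx, map_mul, mul_smul, he', smul_zero]
  | zero => simp
  | add x y _ _ hx hy => rw [map_add, map_add, smul_add, hx, hy, add_zero]
  | smul a x _ hx =>
    rw [Algebra.smul_def, map_mul, ← IsScalarTower.algebraMap_apply A T B, ← Algebra.smul_def,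
      D.map_smul, smul_comm, hx, smul_zero]

attribute [local instance] Algebra.TensorProduct.rightAlgebra

/-- A derivation of `B` over `C` with values in a module over `κ ⊗ B`, which vanishes on the base of
the tensor product, induces a derivation of `κ ⊗ B`. Hence it is zero if `κ ⊗ B` is formally
unramified over `C`. -/
lemma derivation_eq_zero_of_formallyUnramified_tensor {T C B κ N : Type*} [CommRing T] [CommRing C]
    [CommRing B] [Algebra T B] [Algebra C B] [CommRing κ] [Algebra T κ] [AddCommGroup N]
    [Module (κ ⊗[T] B) N] [Module B N] [IsScalarTower B (κ ⊗[T] B) N] [Module C N]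
    [IsScalarTower C B N] (D : Derivation C B N)
    (hD : ∀ τ : T, D (algebraMap T B τ) = 0)
    (H : ((algebraMap B (κ ⊗[T] B)).comp (algebraMap C B)).FormallyUnramified) : D = 0 := by
  let : Module (κ ⊗[T] B)ᵐᵒᵖ N :=
    Module.compHom N ((RingHom.id (κ ⊗[T] B)).fromOpposite mul_comm)
  have : IsCentralScalar (κ ⊗[T] B) N := ⟨fun _ _ ↦ rfl⟩
  let h : B →+* TrivSqZeroExt (κ ⊗[T] B) N :=
    { toFun b := TrivSqZeroExt.inl (algebraMap B (κ ⊗[T] B) b) + TrivSqZeroExt.inr (D b)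
      map_one' := by simp
      map_mul' x y := by
        ext
        · simp
        · simp [algebraMap_smul]
      map_zero' := by simp
      map_add' x y := by
        ext
        · simp
        · simp }
  obtain ⟨φ, hφ₁, hφ₂⟩ := exists_ringHom_tensor (A := T)
    ((TrivSqZeroExt.inlHom (κ ⊗[T] B) N).comp Algebra.TensorProduct.includeLeftRingHom) h (by
      ext τ
      · simp [h, Algebra.TensorProduct.tmul_one_eq_one_tmul]
        rfl
      · simp [h, hD])
  let : Algebra C (κ ⊗[T] B) := ((algebraMap B (κ ⊗[T] B)).comp (algebraMap C B)).toAlgebra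
  have : Algebra.FormallyUnramified C (κ ⊗[T] B) := H
  let : Algebra C (TrivSqZeroExt (κ ⊗[T] B) N) :=
    ((TrivSqZeroExt.inlHom (κ ⊗[T] B) N).comp (algebraMap C (κ ⊗[T] B))).toAlgebra
  let ψ₁ : κ ⊗[T] B →ₐ[C] TrivSqZeroExt (κ ⊗[T] B) N :=
    { TrivSqZeroExt.inlHom (κ ⊗[T] B) N with commutes' _ := rfl }
  let ψ₂ : κ ⊗[T] B →ₐ[C] TrivSqZeroExt (κ ⊗[T] B) N :=
    { φ with
      commutes' c := by
        refine (hφ₂ (algebraMap C B c)).trans ?_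
        ext
        · simp [h]
          rfl
        · simp [h]
          rfl }
  have hψ : ψ₁ = ψ₂ := by
    refine Algebra.FormallyUnramified.ext' (TrivSqZeroExt.fstHom (κ ⊗[T] B) (κ ⊗[T] B) N).toRingHom
      ⟨2, TrivSqZeroExt.kerIdeal_sq (κ ⊗[T] B) N⟩ _ _ fun z ↦ ?_
    change z = TrivSqZeroExt.fst (φ z)
    induction z with
    | zero => simp
    | add x y hx hy => rw [map_add, TrivSqZeroExt.fst_add, ← hx, ← hy]
    | tmul x b =>
      have : (x ⊗ₜ[T] b : κ ⊗[T] B) = x ⊗ₜ 1 * 1 ⊗ₜ b := by simp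
      rw [this, map_mul, hφ₁, hφ₂, TrivSqZeroExt.fst_mul]
      simp only [h, RingHom.comp_apply, RingHom.coe_mk, MonoidHom.coe_mk, OneHom.coe_mk]
      simp only [TrivSqZeroExt.fst_add, TrivSqZeroExt.fst_inl, TrivSqZeroExt.fst_inr, add_zero]
      exact congrArg _ (TrivSqZeroExt.fst_inl N _).symm |>.trans rfl
  ext b
  have h₁ := DFunLike.congr_fun hψ (1 ⊗ₜ b)
  have h₂ : TrivSqZeroExt.inl (1 ⊗ₜ b) = h b := h₁.trans (hφ₂ b)
  simpa [h] using (congrArg TrivSqZeroExt.snd h₂).symm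

/-- If the differentials of `B` over `C` are not torsion over `A`, then the general fibres of `B`
over a finite extension `T` of `A` contained in `B` are ramified over `C`. -/
lemma exists_not_formallyUnramified_tensor (A T C B : Type u) [CommRing A] [CommRing T]
    [CommRing C] [CommRing B] [Algebra A T]
    [Algebra A C] [Algebra A B] [Algebra T B] [Algebra C B] [IsScalarTower A T B]
    [IsScalarTower A C B] [IsDomain A] [IsNoetherianRing A] [CharZero A] [IsDomain T]
    [Module.Finite A T] [Algebra.FiniteType A C] [Module.Finite C B]
    (hAT : Function.Injective (algebraMap A T))
    (m : Ω[B⁄C]) (hm : ∀ a : A, algebraMap A B a • m = 0 → a = 0) :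
    ∃ a : A, a ≠ 0 ∧ ∀ (κ : Type u) [Field κ] [Algebra A κ] [Algebra T κ] [IsScalarTower A T κ],
      algebraMap A κ a ≠ 0 →
        ¬ ((Algebra.TensorProduct.includeRight : B →ₐ[T] κ ⊗[T] B).toRingHom.comp
          (algebraMap C B)).FormallyUnramified := by
  have : IsNoetherianRing T := IsNoetherianRing.of_finite A T
  have : Algebra.FiniteType A B := .trans (S := C) inferInstance inferInstance
  have : Algebra.FiniteType T B := .of_restrictScalars_finiteType A T B
  obtain ⟨τ, hτ, Hτ⟩ := exists_nontrivial_tensor (A := T) (B := B) m (by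
    intro τ hτm
    by_contra hτ
    obtain ⟨a, ha, τ', ha'⟩ := exists_dvd_algebraMap (A := A) hτ
    refine ha (hm a ?_)
    rw [IsScalarTower.algebraMap_apply A T B, ha', map_mul, mul_comm, mul_smul,
      algebraMap_smul B τ, hτm, smul_zero])
  obtain ⟨e, he, He⟩ := exists_forall_smul_derivation_eq_zero hAT
    ((KaehlerDifferential.D C B).restrictScalars A)
  obtain ⟨a, ha, τ', ha'⟩ := exists_dvd_algebraMap (A := A) hτ
  obtain ⟨b, hb, e', hb'⟩ := exists_dvd_algebraMap (A := A) he
  refine ⟨a * b, mul_ne_zero ha hb, fun κ _ _ _ _ hκ H ↦ ?_⟩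
  rw [map_mul, mul_ne_zero_iff] at hκ
  have hnt := Hτ κ fun h0 ↦ hκ.1 (by
    rw [IsScalarTower.algebraMap_apply A T κ, ha', map_mul, h0, zero_mul])
  have heκ : algebraMap T κ e ≠ 0 := fun h0 ↦ hκ.2 (by
    rw [IsScalarTower.algebraMap_apply A T κ, hb', map_mul, h0, zero_mul])
  let : Algebra C (κ ⊗[T] B) := ((algebraMap B (κ ⊗[T] B)).comp (algebraMap C B)).toAlgebra
  have : IsScalarTower C B (κ ⊗[T] B) := .of_algebraMap_eq fun _ ↦ rfl
  let D : Derivation C B ((κ ⊗[T] B) ⊗[B] Ω[B⁄C]) :=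
    (TensorProduct.mk B (κ ⊗[T] B) Ω[B⁄C] 1).compDer (KaehlerDifferential.D C B)
  have hD : D = 0 := derivation_eq_zero_of_formallyUnramified_tensor D (fun τ ↦ by
    have hu : IsUnit (algebraMap B (κ ⊗[T] B) (algebraMap T B e)) := by
      rw [← IsScalarTower.algebraMap_apply T B, IsScalarTower.algebraMap_apply T κ]
      exact (IsUnit.mk0 _ heκ).map _
    rw [← hu.smul_eq_zero, algebraMap_smul]
    change algebraMap T B e • (1 : κ ⊗[T] B) ⊗ₜ[B] (KaehlerDifferential.D C B (algebraMap T B τ)) =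
        0
    rw [← tmul_smul]
    exact (congrArg _ (He τ)).trans (tmul_zero _ _)) H
  have hzero : ∀ ω : Ω[B⁄C], (1 : κ ⊗[T] B) ⊗ₜ[B] ω = 0 := by
    intro ω
    have hω : ω ∈ Submodule.span B (Set.range (KaehlerDifferential.D C B)) :=
      (KaehlerDifferential.span_range_derivation C B).ge trivial
    induction hω using Submodule.span_induction with
    | mem x hx =>
      obtain ⟨b, rfl⟩ := hx
      exact DFunLike.congr_fun hD b
    | zero => rw [tmul_zero]
    | add x y _ _ hx hy => rw [tmul_add, hx, hy, add_zero]
    | smul b x _ hx => rw [tmul_smul, hx, smul_zero]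
  let eqv := Algebra.IsPushout.cancelBaseChange T κ B (κ ⊗[T] B) Ω[B⁄C]
  refine not_subsingleton (κ ⊗[T] Ω[B⁄C]) ⟨fun x y ↦ eqv.symm.injective ?_⟩
  have : ∀ z : (κ ⊗[T] B) ⊗[B] Ω[B⁄C], z = 0 := by
    intro z
    induction z with
    | zero => rfl
    | add x y hx hy => rw [hx, hy, add_zero]
    | tmul x ω =>
      have : x ⊗ₜ[B] ω = x • (1 ⊗ₜ[B] ω) := by rw [smul_tmul', smul_eq_mul, mul_one]
      rw [this, hzero, smul_zero]
  rw [this (eqv.symm x), this (eqv.symm y)]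

end Ramification

/-! ### Ramified quadratic extensions -/

section QuadraticExtension

/-- In a valuation ring, an irreducible element times a square of the fraction field lies in the
ring only if the square does. -/
lemma exists_algebraMap_eq_of_mul_sq {R K : Type*} [CommRing R] [IsDomain R] [ValuationRing R]
    [Field K] [Algebra R K] [IsFractionRing R K] {g : R} (hg : Irreducible g) (c : R) (w : K)
    (h : algebraMap R K g * w ^ 2 = algebraMap R K c) : ∃ r : R, algebraMap R K r = w := by
  obtain ⟨r, hr⟩ | ⟨r, hr⟩ := ValuationRing.isInteger_or_isInteger R w
  · exact ⟨r, hr⟩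
  by_cases hw : w = 0
  · exact ⟨0, by rw [map_zero, hw]⟩
  have hgr : g = r * (c * r) := by
    apply IsFractionRing.injective R K
    rw [map_mul, map_mul, ← h, hr]
    field_simp
  have hru : IsUnit r := by
    rcases hg.isUnit_or_isUnit hgr with h | h
    · exact h
    · exact isUnit_of_mul_isUnit_right h
  obtain ⟨v, rfl⟩ := hru
  refine ⟨↑v⁻¹, ?_⟩
  have := congrArg (algebraMap R K) v.inv_mul
  rw [map_mul, map_one, hr] at this
  exact (mul_inv_eq_one₀ hw).1 this

lemma not_isUnit_of_mul_sq {R K : Type*} [CommRing R] [IsDomain R] [ValuationRing R]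
    [Field K] [Algebra R K] [IsFractionRing R K] {g : R} (hg : Irreducible g) (c : R) (w : K)
    (h : algebraMap R K g * w ^ 2 = algebraMap R K c) : ¬ IsUnit c := by
  obtain ⟨r, rfl⟩ := exists_algebraMap_eq_of_mul_sq hg c w h
  rw [← map_pow, ← map_mul] at h
  rw [← IsFractionRing.injective R K h]
  exact fun h ↦ hg.not_isUnit (isUnit_of_mul_isUnit_left h)

/-- Adjoining the square root of an element which is not a square. -/
lemma exists_quadratic_extension {K : Type u} [Field K] (g : K) (hg : ∀ w, w ^ 2 ≠ g) :
    ∃ (L : Type u) (_ : Field L) (_ : Algebra K L) (_ : FiniteDimensional K L) (h : L)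
      (σ : L →ₐ[K] L), h ^ 2 = algebraMap K L g ∧ σ h = -h ∧
      ∀ x, ∃ u w : K, x = algebraMap K L u + algebraMap K L w * h := by
  let p : Polynomial K := .X ^ 2 - .C g
  have hdeg : p.natDegree = 2 := Polynomial.natDegree_X_pow_sub_C
  have hmonic : p.Monic := Polynomial.monic_X_pow_sub_C g two_ne_zero
  have hp : Irreducible p := by
    rw [hmonic.irreducible_iff_roots_eq_zero_of_degree_le_three (by omega) (by omega)]
    refine Multiset.eq_zero_of_forall_notMem fun w hw ↦ hg w ?_
    have := (Polynomial.mem_roots'.1 hw).2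
    simpa [p, sub_eq_zero] using this
  have : Fact (Irreducible p) := ⟨hp⟩
  have hroot : (AdjoinRoot.root p) ^ 2 = algebraMap K (AdjoinRoot p) g := by
    have := AdjoinRoot.aeval_eq (f := p) p
    rw [AdjoinRoot.mk_self] at this
    simpa [p, sub_eq_zero] using this
  refine ⟨AdjoinRoot p, inferInstance, inferInstance, hmonic.finite_adjoinRoot, AdjoinRoot.root p,
    AdjoinRoot.liftAlgHom p (Algebra.ofId _ _) (-AdjoinRoot.root p) ?_, hroot, ?_, fun x ↦ ?_⟩
  · simp [p, hroot]
  · simp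
  · obtain ⟨q, rfl⟩ := AdjoinRoot.mk_surjective x
    have hq := Polynomial.modByMonic_add_div q p
    have hd : (q %ₘ p).natDegree < 2 := hdeg ▸
      Polynomial.natDegree_modByMonic_lt q hmonic (fun h ↦ by simp [h] at hdeg)
    refine ⟨(q %ₘ p).coeff 0, (q %ₘ p).coeff 1, ?_⟩
    conv_lhs => rw [← hq, map_add, map_mul, AdjoinRoot.mk_self, zero_mul, add_zero,
      (q %ₘ p).as_sum_range' 2 hd]
    simp [Finset.sum_range_succ, ← Polynomial.C_mul_X_pow_eq_monomial, AdjoinRoot.algebraMap_eq]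

variable {k B R K L : Type u} [CommRing B] [CommRing R] [IsDomain R] [ValuationRing R]
  [Field K] [Field L] [Algebra R K] [IsFractionRing R K] [Algebra K L]
  {g : R} {h : L} {σ : L →ₐ[K] L}

/-- Adjoining the square root `h` of a uniformizer `g` of a valuation ring over `k` adds no elements
which are algebraic over `k`: the trace of such an element `u + w * h` and the square `4 * g * w ^
2` of its difference with its conjugate are constants, and the latter can only be zero. -/
lemma mem_range_of_isIntegral_quadratic [CharZero K] [Field k] [Algebra k R] [Algebra k K]
    [Algebra k L]
    [IsScalarTower k R K] [IsScalarTower k K L]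
    (hK : ∀ x : K, IsIntegral k x → x ∈ (algebraMap k K).range)
    (hg : Irreducible g) (hh : h ^ 2 = algebraMap K L (algebraMap R K g)) (hσ : σ h = -h)
    (hL : ∀ x, ∃ u w : K, x = algebraMap K L u + algebraMap K L w * h) (x : L)
    (hx : IsIntegral k x) : x ∈ (algebraMap k L).range := by
  have hinj : Function.Injective (algebraMap K L) := (algebraMap K L).injective
  obtain ⟨u, w, rfl⟩ := hL x
  have hx' : IsIntegral k (σ (algebraMap K L u + algebraMap K L w * h)) :=
    hx.map (σ.restrictScalars k)
  have h₁ : IsIntegral k (algebraMap K L (2 * u)) := by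
    have e : algebraMap K L u + algebraMap K L w * h + σ (algebraMap K L u + algebraMap K L w * h) =
        algebraMap K L (2 * u) := by
      rw [map_add σ, map_mul σ, AlgHom.commutes, AlgHom.commutes, hσ, map_mul, map_ofNat]
      ring
    exact e ▸ hx.add hx'
  have h₂ : IsIntegral k (algebraMap K L (4 * (algebraMap R K g * w ^ 2))) := by
    have e : (algebraMap K L u + algebraMap K L w * h -
        σ (algebraMap K L u + algebraMap K L w * h)) ^ 2 =
        algebraMap K L (4 * (algebraMap R K g * w ^ 2)) := by
      rw [map_add σ, map_mul σ, AlgHom.commutes, AlgHom.commutes, hσ, map_mul, map_mul, map_pow,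
        ← hh, map_ofNat]
      ring
    exact e ▸ (hx.sub hx').pow 2
  obtain ⟨c, hc⟩ := hK _ ((isIntegral_algebraMap_iff hinj).1 h₁)
  obtain ⟨d, hd⟩ := hK _ ((isIntegral_algebraMap_iff hinj).1 h₂)
  have hw : w = 0 := by
    by_contra hw
    have hg0 : algebraMap R K g ≠ 0 := fun h0 ↦ hg.ne_zero
        (IsFractionRing.injective R K (by rw [h0, map_zero]))
    have hd0 : d ≠ 0 := fun h0 ↦ by
      rw [h0, map_zero] at hd
      simp [hw, hg0] at hd
    refine not_isUnit_of_mul_sq hg (algebraMap k R d) (2 * w) ?_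
      ((Ne.isUnit hd0).map (algebraMap k R))
    rw [← IsScalarTower.algebraMap_apply, hd]
    ring
  subst hw
  refine ⟨c / 2, ?_⟩
  have : CharZero k := (algebraMap k K).charZero_iff (algebraMap k K).injective |>.2 inferInstance
  rw [IsScalarTower.algebraMap_apply k K L, map_div₀, hc, map_ofNat,
    mul_div_cancel_left₀ _ two_ne_zero]
  simp

/-- Adjoining the square root of a uniformizer ramifies. The conjugation and the inclusion of the
integral closure of `B` into the integral closure `C` of `R` agree modulo `h`, hence, if the former
is formally unramified over `B`, modulo `h ^ 2`. -/
lemma not_formallyUnramified_quadratic [IsIntegrallyClosed R] [Algebra B R] [Algebra B K]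
    [Algebra B L] [IsScalarTower B R K] [IsScalarTower B K L] (b : B) (hb : algebraMap B R b = g)
    (hg : Irreducible g) (hh : h ^ 2 = algebraMap K L (algebraMap R K g)) (hσ : σ h = -h)
    (h2 : IsUnit (2 : R))
    (hL : ∀ x, ∃ u w : K, x = algebraMap K L u + algebraMap K L w * h) :
    ¬ Algebra.FormallyUnramified B (integralClosure B L) := by
  intro H
  have hinj : Function.Injective (algebraMap K L) := (algebraMap K L).injective
  let : Algebra R L := ((algebraMap K L).comp (algebraMap R K)).toAlgebra
  have : IsScalarTower R K L := .of_algebraMap_eq' rfl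
  have : IsScalarTower B R L := .of_algebraMap_eq fun x ↦ by
    rw [IsScalarTower.algebraMap_apply B K L, IsScalarTower.algebraMap_apply B R K]
    rfl
  let C := integralClosure R L
  let ι : integralClosure B L →ₐ[B] C :=
    AlgHom.codRestrict (S := C.restrictScalars B) (integralClosure B L).val
      fun x ↦ (mem_integralClosure_iff R L).2 ((mem_integralClosure_iff B L).1 x.2).tower_top
  have hhB : IsIntegral B h := by
    refine .of_pow two_pos ?_
    rw [hh, ← hb, ← IsScalarTower.algebraMap_apply B R K, ← IsScalarTower.algebraMap_apply B K L]
    exact isIntegral_algebraMap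
  let hB : integralClosure B L := ⟨h, hhB⟩
  let s : integralClosure B L →ₐ[B] integralClosure B L :=
    (σ.restrictScalars B).mapIntegralClosure
  let J : Ideal C := Ideal.span {ι hB ^ 2}
  let I : Ideal (C ⧸ J) := (Ideal.span {ι hB}).map (Ideal.Quotient.mk J)
  have hI : IsNilpotent I := by
    refine ⟨2, ?_⟩
    rw [← Ideal.map_pow, Ideal.span_singleton_pow, Ideal.map_quotient_self]
    rfl
  have key : (Ideal.Quotient.mkₐ B J).comp ι = (Ideal.Quotient.mkₐ B J).comp (ι.comp s) := by
    refine Algebra.FormallyUnramified.ext I hI fun x ↦ ?_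
    rw [Ideal.Quotient.eq]
    change Ideal.Quotient.mk J (ι x) - Ideal.Quotient.mk J (ι (s x)) ∈ I
    rw [← map_sub]
    refine Ideal.mem_map_of_mem _ (Ideal.mem_span_singleton.2 ?_)
    obtain ⟨u, w, hx⟩ := hL x.1
    have hsub : x.1 - σ x.1 = algebraMap K L (2 * w) * h := by
      rw [hx]
      simp only [map_add, map_mul, AlgHom.commutes, hσ, map_ofNat]
      ring
    obtain ⟨r, hr⟩ : ∃ r : R, algebraMap R K r = 2 * w := by
      have hint : IsIntegral R (algebraMap K L (algebraMap R K g * (2 * w) ^ 2)) := by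
        have h₂ : IsIntegral R ((x.1 - σ x.1) ^ 2) :=
          (mem_integralClosure_iff R L).1 ((ι x - ι (s x)) ^ 2).2
        convert h₂ using 1
        rw [hsub, map_mul, ← hh, map_pow]
        ring
      rw [isIntegral_algebraMap_iff hinj,
        IsIntegrallyClosed.isIntegral_iff] at hint
      obtain ⟨c, hc⟩ := hint
      exact exists_algebraMap_eq_of_mul_sq hg c _ hc.symm
    refine ⟨algebraMap R C r, Subtype.ext ?_⟩
    change x.1 - σ x.1 = h * algebraMap R L r
    rw [hsub, ← hr, mul_comm]
    rfl
  have h₁ := DFunLike.congr_fun key hB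
  change Ideal.Quotient.mk J (ι hB) = Ideal.Quotient.mk J (ι (s hB)) at h₁
  rw [Ideal.Quotient.eq, Ideal.mem_span_singleton] at h₁
  obtain ⟨c, hc⟩ := h₁
  have hc' : h - σ h = h ^ 2 * c.1 := congrArg Subtype.val hc
  have hg0 : algebraMap R K g ≠ 0 := fun h0 ↦ hg.ne_zero
      (IsFractionRing.injective R K (by rw [h0, map_zero]))
  have hh0 : h ≠ 0 := by
    rintro rfl
    rw [zero_pow two_ne_zero, eq_comm, map_eq_zero] at hh
    exact hg0 hh
  have hc2 : h * c.1 = 2 := by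
    apply mul_left_cancel₀ hh0
    rw [hσ] at hc'
    linear_combination -hc'
  have hint : IsIntegral R (algebraMap K L (4 / algebraMap R K g)) := by
    have h₂ : IsIntegral R (c.1 ^ 2) := (mem_integralClosure_iff R L).1 (c ^ 2).2
    convert h₂ using 1
    rw [map_div₀, ← hh, map_ofNat, div_eq_iff (pow_ne_zero 2 hh0)]
    linear_combination (-2 - h * c.1) * hc2
  rw [isIntegral_algebraMap_iff hinj,
    IsIntegrallyClosed.isIntegral_iff] at hint
  obtain ⟨y, hy⟩ := hint
  have : g * y = 2 * 2 := by
    apply IsFractionRing.injective R K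
    rw [map_mul, hy, mul_div_cancel₀ _ hg0, map_mul, map_ofNat]
    norm_num
  exact hg.not_isUnit (isUnit_of_mul_isUnit_left (this ▸ h2.mul h2))

end QuadraticExtension

section Uniformizer

/-- A noetherian normal domain which is not a field contains a uniformizer of a discrete valuation
ring of its fraction field. -/
lemma exists_valuationRing_uniformizer (B : Type u) [CommRing B] [IsDomain B] [IsNoetherianRing B]
    [IsIntegrallyClosed B] (hB : ¬ IsField B) :
    ∃ (q : Ideal B) (_ : q.IsPrime) (b : B), ValuationRing (Localization.AtPrime q) ∧
      Irreducible (algebraMap B (Localization.AtPrime q) b) := by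
  obtain ⟨b, hb0, hbu⟩ := Ring.exists_not_isUnit_of_not_isField hB
  obtain ⟨q, hq⟩ := Ideal.nonempty_minimalPrimes (I := Ideal.span {b})
    (by rwa [Ne, Ideal.span_singleton_eq_top])
  have hqp : q.IsPrime := hq.1.1
  have hbq : b ∈ q := hq.1.2 (Ideal.mem_span_singleton_self b)
  have hht : q.height ≤ 1 := Ideal.height_le_one_of_isPrincipal_of_mem_minimalPrimes _ q hq
  let R := Localization.AtPrime q
  have hle : q.primeCompl ≤ nonZeroDivisors B := Ideal.primeCompl_le_nonZeroDivisors _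
  have : IsDomain R := IsLocalization.isDomain_of_le_nonZeroDivisors R hle
  have : IsIntegrallyClosed R := isIntegrallyClosed_of_isLocalization R _ hle
  have hval : ValuationRing R := by
    refine ((tfae_of_isNoetherianRing_of_isLocalRing_of_isDomain R).out 3 1).1
      (⟨inferInstance, ?_⟩ : IsIntegrallyClosed R ∧ _)
    intro P hP hPp
    have : Ring.KrullDimLE 1 R := by
      rw [Ring.krullDimLE_iff, IsLocalization.AtPrime.ringKrullDim_eq_height q R]
      exact_mod_cast hht
    have := Ideal.isMaximal_of_isPrime_of_ne_bot P hP
    exact IsLocalRing.eq_maximalIdeal this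
  have hnf : ¬ IsField R := by
    intro h
    refine hb0 (IsLocalization.injective R hle ?_)
    by_contra hne
    obtain ⟨r, hr⟩ := h.mul_inv_cancel (fun h0 ↦ hne (h0.trans (map_zero _).symm))
    exact (IsLocalization.AtPrime.isUnit_to_map_iff R q b).1 (.of_mul_eq_one r hr) hbq
  obtain ⟨ϖ, hϖ⟩ : ∃ ϖ : R, Irreducible ϖ := by
    have : IsPrincipalIdealRing R :=
        ((tfae_of_isNoetherianRing_of_isLocalRing_of_isDomain R).out 1 0).1 hval
    obtain ⟨x, hx0, hxu⟩ := Ring.exists_not_isUnit_of_not_isField hnf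
    exact (WfDvdMonoid.exists_irreducible_factor hxu hx0).imp fun _ h ↦ h.1
  obtain ⟨c, s, rfl⟩ := IsLocalization.exists_mk'_eq q.primeCompl ϖ
  refine ⟨q, hqp, c, hval, ?_⟩
  rw [← IsLocalization.mk'_spec R c s]
  exact (irreducible_mul_isUnit (IsLocalization.map_units R s)).2 hϖ

end Uniformizer

end Algebra

section Geometry

open TensorProduct AlgebraicGeometry

/-! ### Charts, normal schemes and rational functions -/

section Charts

variable {X Y : Scheme.{u}}

lemma isIntegral_of_isOpenImmersion_of_inter_nonempty {ι : Type*} [Nonempty ι] (W : ι → Scheme.{u})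
    (j : ∀ i, W i ⟶ X) [∀ i, IsOpenImmersion (j i)] [∀ i, IsIntegral (W i)]
    (hcov : ∀ x, ∃ i, x ∈ Set.range (j i))
    (hne : ∀ i i', (Set.range (j i) ∩ Set.range (j i')).Nonempty) : IsIntegral X := by
  have hred : IsReduced X := by
    have : ∀ x, _root_.IsReduced (X.presheaf.stalk x) := by
      intro x
      obtain ⟨i, y, rfl⟩ := hcov x
      have := isReduced_stalk_of_isReduced (W i) y
      exact isReduced_of_injective ((j i).stalkMap y).hom
        (ConcreteCategory.bijective_of_isIso ((j i).stalkMap y)).1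
    exact isReduced_of_isReduced_stalk X
  have hopen : ∀ i, IsOpen (Set.range (j i)) := fun i ↦ (j i).isOpenEmbedding.isOpen_range
  have hirr : ∀ i, IsPreirreducible (Set.range (j i)) := fun i ↦ by
    rw [← Set.image_univ]
    exact (PreirreducibleSpace.isPreirreducible_univ).image _ (j i).continuous.continuousOn
  have : PreirreducibleSpace X := ⟨fun U V hU hV ⟨x, _, hx⟩ ⟨y, _, hy⟩ ↦ by
    obtain ⟨i, hi⟩ := hcov x
    obtain ⟨i', hi'⟩ := hcov y
    obtain ⟨z, hz, hz'⟩ := hne i i'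
    obtain ⟨w, hw, hwU, hwi⟩ := hirr i U (Set.range (j i')) hU (hopen _) ⟨x, hi, hx⟩ ⟨z, hz, hz'⟩
    obtain ⟨v, _, hv, hv'⟩ := hirr i' U V hU hV ⟨w, hwi, hwU⟩ ⟨y, hi', hy⟩
    exact ⟨v, trivial, hv, hv'⟩⟩
  have : Nonempty X := ⟨(hne (Classical.arbitrary ι) (Classical.arbitrary ι)).some⟩
  have : IrreducibleSpace X := ⟨this⟩
  exact isIntegral_of_irreducibleSpace_of_isReduced X

lemma isNormal_Spec (R : Type u) [CommRing R] [IsDomain R] [IsIntegrallyClosed R] :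
    IsNormal (Spec (.of R)) := by
  intro x
  let p : PrimeSpectrum R := x
  let S := (Spec.structureSheaf R).presheaf.stalk p
  have : IsLocalization.AtPrime S p.asIdeal := StructureSheaf.IsLocalization.to_stalk R p
  have hle : p.asIdeal.primeCompl ≤ nonZeroDivisors R := Ideal.primeCompl_le_nonZeroDivisors _
  have h₁ : IsDomain S := IsLocalization.isDomain_of_le_nonZeroDivisors S hle
  have h₂ : IsIntegrallyClosed S := isIntegrallyClosed_of_isLocalization S _ hle
  exact ⟨h₁, h₂⟩

lemma IsNormal.of_isOpenImmersion (f : X ⟶ Y) [IsOpenImmersion f] (h : IsNormal Y) :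
    IsNormal X := by
  intro x
  obtain ⟨h₁, h₂⟩ := h (f x)
  have e : Y.presheaf.stalk (f x) ≃+* X.presheaf.stalk x :=
    (asIso (f.stalkMap x)).commRingCatIsoToRingEquiv
  exact ⟨e.symm.toMulEquiv.isDomain _, .of_equiv e⟩

lemma IsNormal.of_forall_exists_isOpenImmersion (h : ∀ x : X, ∃ (W : Scheme.{u}) (j : W ⟶ X),
      IsOpenImmersion j ∧ x ∈ Set.range j ∧ IsNormal W) : IsNormal X := by
  intro x
  obtain ⟨W, j, _, ⟨y, rfl⟩, hW⟩ := h x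
  obtain ⟨h₁, h₂⟩ := hW y
  have e : X.presheaf.stalk (j y) ≃+* W.presheaf.stalk y :=
    (asIso (j.stalkMap y)).commRingCatIsoToRingEquiv
  exact ⟨e.toMulEquiv.isDomain _, .of_equiv e.symm⟩

/-- A rational function which is regular at all points of an open set is a section over it. -/
lemma exists_germToFunctionField_eq [IsIntegral X] (U : X.Opens) [Nonempty U] (f : X.functionField)
    (h : ∀ x ∈ U, ∃ s : X.presheaf.stalk x, algebraMap _ X.functionField s = f) :
    ∃ s : Γ(X, U), X.germToFunctionField U s = f := by
  have hloc : ∀ x : U, ∃ (V : X.Opens) (_ : x.1 ∈ V) (_ : V ≤ U) (_ : Nonempty V) (s : Γ(X, V)),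
      X.germToFunctionField V s = f := by
    intro x
    obtain ⟨s, hs⟩ := h x x.2
    obtain ⟨V, hxV, s, rfl⟩ := X.presheaf.exists_germ_eq s
    have hV : Nonempty V := ⟨⟨x, hxV⟩⟩
    have hVU : Nonempty ↥(V ⊓ U) := ⟨⟨x, hxV, x.2⟩⟩
    refine ⟨V ⊓ U, ⟨hxV, x.2⟩, inf_le_right, hVU, X.presheaf.map (homOfLE inf_le_left).op s, ?_⟩
    rw [← hs, Scheme.algebraMap_germ_eq_germToFunctionField]
    exact TopCat.Presheaf.germ_res_apply _ _ _ _ _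
  choose V hxV hVU hV s hs using hloc
  have hcompat : TopCat.Presheaf.IsCompatible X.presheaf V s := by
    intro x y
    let W : X.Opens := V x ⊓ V y
    by_cases hxy : Nonempty W
    · apply X.germToFunctionField_injective W
      trans f
      · rw [← hs x]
        exact TopCat.Presheaf.germ_res_apply _ _ _ _ _
      · rw [← hs y]
        exact (TopCat.Presheaf.germ_res_apply _ _ _ _ _).symm
    · have : W = ⊥ := by
        ext z
        exact ⟨fun hz ↦ (hxy ⟨⟨z, hz⟩⟩).elim, fun hz ↦ hz.elim⟩
      have : Subsingleton Γ(X, W) := by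
        rw [this]
        infer_instance
      exact Subsingleton.elim _ _
  obtain ⟨t, ht, -⟩ := TopCat.Sheaf.existsUnique_gluing' X.sheaf V U (fun x ↦ homOfLE (hVU x))
    (fun x hx ↦ TopologicalSpace.Opens.mem_iSup.2 ⟨⟨x, hx⟩, hxV _⟩) s hcompat
  obtain ⟨x⟩ := (inferInstance : Nonempty U)
  refine ⟨t, ?_⟩
  rw [← hs x, ← ht x]
  exact (TopCat.Presheaf.germ_res_apply _ _ _ _ _).symm

/-- Rational functions on a normal scheme which are integral over the ring of global functions on
an open set are regular there. -/
lemma IsNormal.exists_germToFunctionField_eq_of_isIntegral [IsIntegral X] (hX : IsNormal X)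
    (U : X.Opens) [Nonempty U] (f : X.functionField) (hf : IsIntegral Γ(X, U) f) :
    ∃ s : Γ(X, U), X.germToFunctionField U s = f := by
  refine exists_germToFunctionField_eq U f fun x hx ↦ ?_
  have := (hX x).2
  let := X.presheaf.algebra_section_stalk (U := U) ⟨x, hx⟩
  have : IsScalarTower Γ(X, U) (X.presheaf.stalk x) X.functionField :=
    functionField_isScalarTower X U ⟨x, hx⟩
  exact (isIntegrallyClosed_iff X.functionField).1 ‹_› hf.tower_top

lemma IsNormal.isIntegrallyClosed [IsIntegral X] (hX : IsNormal X) (U : X.Opens)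
    (hU : IsAffineOpen U) [Nonempty U] : IsIntegrallyClosed Γ(X, U) := by
  have := functionField_isFractionRing_of_isAffineOpen X U hU
  rw [isIntegrallyClosed_iff X.functionField]
  intro x hx
  exact hX.exists_germToFunctionField_eq_of_isIntegral U x hx

/-- The charts of a base change. -/
lemma exists_isPullback_Spec_tensor {T κ B : Type u} [CommRing T] [CommRing κ] [CommRing B]
    [Algebra T κ] [Algebra T B] {Y Z : Scheme.{u}} {q : Y ⟶ Spec (.of T)} {fst : Z ⟶ Y}
    {snd : Z ⟶ Spec (.of κ)}
    (h : IsPullback fst snd q (Spec.map (CommRingCat.ofHom (algebraMap T κ))))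
    (j : Spec (.of B) ⟶ Y) (hj : j ≫ q = Spec.map (CommRingCat.ofHom (algebraMap T B))) :
    ∃ w : Spec (.of (κ ⊗[T] B)) ⟶ Z,
      w ≫ snd = Spec.map (CommRingCat.ofHom Algebra.TensorProduct.includeLeftRingHom) ∧
      IsPullback w (Spec.map (CommRingCat.ofHom
        (Algebra.TensorProduct.includeRight : B →ₐ[T] κ ⊗[T] B).toRingHom)) fst j := by
  have hpush := isPullback_SpecMap_of_isPushout _ _ _ _
    (CommRingCat.isPushout_tensorProduct T κ B)
  have hw : (Spec.map (CommRingCat.ofHom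
      (Algebra.TensorProduct.includeRight : B →ₐ[T] κ ⊗[T] B).toRingHom) ≫ j) ≫ q =
      Spec.map (CommRingCat.ofHom Algebra.TensorProduct.includeLeftRingHom) ≫
        Spec.map (CommRingCat.ofHom (algebraMap T κ)) := by
    rw [Category.assoc, hj]
    exact hpush.w.symm
  refine ⟨h.lift _ _ hw, h.lift_snd _ _ hw, ?_⟩
  refine (IsPullback.of_right ?_ (h.lift_fst _ _ hw) h.flip)
  rw [h.lift_snd, hj]
  exact hpush

lemma range_eq_preimage_range_of_isPullback {P X Y Z : Scheme.{u}} {w : P ⟶ Z} {v : P ⟶ Y}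
    {fst : Z ⟶ X} {j : Y ⟶ X} (h : IsPullback w v fst j) :
    Set.range w = fst ⁻¹' Set.range j := by
  rw [← Set.image_univ, ← Set.image_univ]
  exact Scheme.image_preimage_eq_of_isPullback h.flip Set.univ

end Charts

/-! ### General fibres over an affine base -/

section GenericFibres

variable {T : Type u} [CommRing T] {Y : Scheme.{u}} (q : Y ⟶ Spec (.of T))

/-- The map from the coordinate ring of an affine base to the function field. -/
noncomputable def toFunctionField [IrreducibleSpace Y] : T →+* Y.functionField :=
  (Spec.preimage (Y.fromSpecStalk (genericPoint Y) ≫ q)).hom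

/-- The map from the coordinate ring of an affine base to that of an affine open subset. -/
noncomputable def toSections {U : Y.Opens} (hU : IsAffineOpen U) : T →+* Γ(Y, U) :=
  (Spec.preimage (hU.fromSpec ≫ q)).hom

lemma SpecMap_toSections {U : Y.Opens} (hU : IsAffineOpen U) :
    Spec.map (CommRingCat.ofHom (toSections q hU)) = hU.fromSpec ≫ q :=
  Spec.map_preimage _

lemma germToFunctionField_comp_toSections [IrreducibleSpace Y] {U : Y.Opens} (hU : IsAffineOpen U)
    [hne : Nonempty U] :
    (Y.germToFunctionField U).hom.comp (toSections q hU) = toFunctionField q := by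
  have hmem : genericPoint Y ∈ U := (genericPoint_spec Y).mem_open_set_iff U.isOpen |>.2
    ⟨_, trivial, hne.some.2⟩
  suffices h : CommRingCat.ofHom (toSections q hU) ≫ Y.germToFunctionField U =
      Spec.preimage (Y.fromSpecStalk (genericPoint Y) ≫ q) from congrArg CommRingCat.Hom.hom h
  apply Spec.map_injective
  rw [Spec.map_preimage, Spec.map_comp, SpecMap_toSections,
    ← hU.fromSpecStalk_eq_fromSpecStalk hmem, IsAffineOpen.fromSpecStalk, Category.assoc]

lemma finiteType_toSections [LocallyOfFiniteType q] {U : Y.Opens} (hU : IsAffineOpen U) :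
    (toSections q hU).FiniteType := by
  have : LocallyOfFiniteType (Spec.map (CommRingCat.ofHom (toSections q hU))) := by
    rw [SpecMap_toSections]
    infer_instance
  exact (HasRingHomProperty.Spec_iff (P := @LocallyOfFiniteType)).1 this

/-- The fraction field of the base is algebraically closed in the function field. -/
def IsAlgClosedInFunctionField [IsIntegral Y] : Prop :=
  ∀ x : Y.functionField, (∃ p : Polynomial T, p ≠ 0 ∧ p.eval₂ (toFunctionField q) x = 0) →
    ∃ a b : T, b ≠ 0 ∧ toFunctionField q b * x = toFunctionField q a

variable [IsDomain T] [CharZero T] [IsNoetherianRing T] [IsIntegral Y] [LocallyOfFiniteType q]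

lemma exists_isDomain_isIntegrallyClosed_tensor_sections (hn : IsNormal Y)
    (hq : Function.Injective (toFunctionField q)) (hF : IsAlgClosedInFunctionField q)
    {U : Y.Opens} (hU : IsAffineOpen U) [Nonempty U] :
    let := (toSections q hU).toAlgebra
    ∃ a : T, a ≠ 0 ∧ ∀ (κ : Type u) [Field κ] [Algebra T κ], algebraMap T κ a ≠ 0 →
      IsDomain (κ ⊗[T] Γ(Y, U)) ∧ IsIntegrallyClosed (κ ⊗[T] Γ(Y, U)) := by
  let := (toSections q hU).toAlgebra
  let : Algebra T Y.functionField := (toFunctionField q).toAlgebra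
  have : IsScalarTower T Γ(Y, U) Y.functionField :=
    .of_algebraMap_eq' (germToFunctionField_comp_toSections q hU).symm
  have : Algebra.FiniteType T Γ(Y, U) := finiteType_toSections q hU
  have := functionField_isFractionRing_of_isAffineOpen Y U hU
  have := hn.isIntegrallyClosed U hU
  have hinj : Function.Injective (algebraMap T Γ(Y, U)) := by
    have := hq
    rw [← germToFunctionField_comp_toSections q hU, RingHom.coe_comp] at this
    exact this.of_comp
  obtain ⟨a, ha, H⟩ := exists_isDomain_tensor T Γ(Y, U) hinj Y.functionField (by
    rintro x ⟨p, hp, hpx⟩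
    obtain ⟨a, b, hb, hab⟩ := hF x ⟨p, hp, hpx⟩
    exact ⟨a, b, hb, (Algebra.smul_def b x).trans hab⟩)
  obtain ⟨b, hb, H'⟩ := exists_isIntegrallyClosed_tensor T Γ(Y, U) hinj ⟨a, ha, H⟩
  refine ⟨a * b, mul_ne_zero ha hb, fun κ _ _ hκ ↦ ?_⟩
  rw [map_mul, mul_ne_zero_iff] at hκ
  exact ⟨H κ hκ.1, H' κ hκ.2⟩

/-- In characteristic zero, the general fibres of a dominant morphism of finite type from a normal
integral scheme are integral and normal, provided that the fraction field of the base is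
algebraically closed in the function field. -/
lemma exists_isIntegral_isNormal_pullback [CompactSpace Y] (hn : IsNormal Y)
    (hq : Function.Injective (toFunctionField q)) (hF : IsAlgClosedInFunctionField q) :
    ∃ a : T, a ≠ 0 ∧ ∀ (κ : Type u) [Field κ] (φ : T →+* κ), φ a ≠ 0 →
      ∀ (Z : Scheme.{u}) (fst : Z ⟶ Y) (snd : Z ⟶ Spec (.of κ)),
        IsPullback fst snd q (Spec.map (CommRingCat.ofHom φ)) → IsIntegral Z ∧ IsNormal Z := by
  have hcov : ∀ y : Y, ∃ U : Y.Opens, IsAffineOpen U ∧ y ∈ U := fun y ↦ by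
    obtain ⟨U, hU, hy, -⟩ := exists_isAffineOpen_mem_and_subset (U := ⊤) (x := y) trivial
    exact ⟨U, hU, hy⟩
  choose U hU hyU using hcov
  obtain ⟨t, ht⟩ := CompactSpace.elim_nhds_subcover (fun y ↦ (U y : Set Y))
    fun y ↦ (U y).isOpen.mem_nhds (hyU y)
  have hne : ∀ y, Nonempty (U y) := fun y ↦ ⟨⟨y, hyU y⟩⟩
  have hgen : ∀ y, genericPoint Y ∈ U y := fun y ↦
    (genericPoint_spec Y).mem_open_set_iff (U y).isOpen |>.2 ⟨_, trivial, hyU y⟩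
  have hgen' : genericPoint Y ∈ t.inf U := by
    rw [← SetLike.mem_coe, TopologicalSpace.Opens.coe_finset_inf]
    simp [hgen]
  obtain ⟨V, hV, hgV, hVt⟩ := exists_isAffineOpen_mem_and_subset hgen'
  have hVne : Nonempty V := ⟨⟨_, hgV⟩⟩
  choose a ha H using fun y ↦ exists_isDomain_isIntegrallyClosed_tensor_sections q hn hq hF (hU y)
  obtain ⟨b, hb, H'⟩ := exists_isDomain_isIntegrallyClosed_tensor_sections q hn hq hF hV
  refine ⟨(∏ y ∈ t, a y) * b, mul_ne_zero (Finset.prod_ne_zero_iff.2 fun y _ ↦ ha y) hb,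
    fun κ _ φ hκ Z fst snd hZ ↦ ?_⟩
  rw [map_mul, mul_ne_zero_iff, map_prod, Finset.prod_ne_zero_iff] at hκ
  let : Algebra T κ := φ.toAlgebra
  have hchart : ∀ (W : Y.Opens) (hW : IsAffineOpen W),
      let := (toSections q hW).toAlgebra
      IsDomain (κ ⊗[T] Γ(Y, W)) ∧ IsIntegrallyClosed (κ ⊗[T] Γ(Y, W)) →
        ∃ (W' : Scheme.{u}) (w : W' ⟶ Z), IsOpenImmersion w ∧ IsIntegral W' ∧ IsNormal W' ∧
          Set.range w = fst ⁻¹' W := by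
    intro W hW _ ⟨h₁, h₂⟩
    let := (toSections q hW).toAlgebra
    obtain ⟨w, -, hw⟩ := exists_isPullback_Spec_tensor hZ hW.fromSpec (SpecMap_toSections q hW).symm
    refine ⟨_, w, MorphismProperty.of_isPullback hw.flip
      (inferInstanceAs (IsOpenImmersion hW.fromSpec)), inferInstance, isNormal_Spec _, ?_⟩
    rw [range_eq_preimage_range_of_isPullback hw, hW.range_fromSpec]
  choose W w hw hWi hWn hwr using fun y : t ↦ hchart (U y) (hU y) (H y.1 κ (hκ.1 y.1 y.2))
  obtain ⟨W', v, -, hv, -, hvr⟩ := hchart V hV (H' κ hκ.2)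
  have hcov : ∀ z, ∃ y, z ∈ Set.range (w y) := fun z ↦ by
    obtain ⟨y, hy, hzy⟩ := Set.mem_iUnion₂.1 (ht.ge (Set.mem_univ (fst z)))
    exact ⟨⟨y, hy⟩, by rwa [hwr]⟩
  obtain ⟨z⟩ : Nonempty W' := inferInstance
  have hz : fst (v z) ∈ V := by
    have : v z ∈ Set.range v := ⟨z, rfl⟩
    rwa [hvr] at this
  have hzU : ∀ y : t, v z ∈ Set.range (w y) := fun y ↦ by
    rw [hwr]
    have : t.inf U ≤ U y.1 := Finset.inf_le y.2
    exact this (hVt hz)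
  have : Nonempty t := ⟨(hcov (v z)).choose⟩
  refine ⟨isIntegral_of_isOpenImmersion_of_inter_nonempty W w hcov
    fun i j ↦ ⟨_, hzU i, hzU j⟩, .of_forall_exists_isOpenImmersion fun z ↦ ?_⟩
  obtain ⟨y, hy⟩ := hcov z
  exact ⟨_, w y, hw y, hy, hWn y⟩

/-- The general fibres are even geometrically integral, because an extension of the residue field
yields another point of the base with the same property. -/
lemma exists_geometricallyIntegral_isNormal_pullback [CompactSpace Y] (hn : IsNormal Y)
    (hq : Function.Injective (toFunctionField q)) (hF : IsAlgClosedInFunctionField q) :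
    ∃ a : T, a ≠ 0 ∧ ∀ (κ : Type u) [Field κ] (φ : T →+* κ), φ a ≠ 0 →
      ∀ (Z : Scheme.{u}) (fst : Z ⟶ Y) (snd : Z ⟶ Spec (.of κ)),
        IsPullback fst snd q (Spec.map (CommRingCat.ofHom φ)) →
          GeometricallyIntegral snd ∧ IsNormal Z := by
  obtain ⟨a, ha, H⟩ := exists_isIntegral_isNormal_pullback q hn hq hF
  refine ⟨a, ha, fun κ _ φ hκ Z fst snd hZ ↦ ⟨⟨?_⟩, (H κ φ hκ Z fst snd hZ).2⟩⟩
  intro K _ y P fst' snd' hP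
  obtain ⟨ψ, rfl⟩ : ∃ ψ : κ →+* K, Spec.map (CommRingCat.ofHom ψ) = y :=
    ⟨(Spec.preimage y).hom, Spec.map_preimage y⟩
  refine (H K (ψ.comp φ) (by simpa using hκ) P (fst' ≫ fst) snd' ?_).1
  rw [CommRingCat.ofHom_comp, Spec.map_comp]
  exact (hP.flip.paste_vert hZ.flip).flip

end GenericFibres

/-! ### Normalization in an extension of the function field -/

lemma toSections_comp {T : Type u} [CommRing T] {X Y : Scheme.{u}} (π : Y ⟶ X)
    (q : X ⟶ Spec (.of T)) {U : X.Opens} (hU : IsAffineOpen U) {V : Y.Opens} (hV : IsAffineOpen V)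
    (h : V ≤ π ⁻¹ᵁ U) :
    toSections (π ≫ q) hV = (π.appLE U V h).hom.comp (toSections q hU) := by
  suffices h' : CommRingCat.ofHom (toSections (π ≫ q) hV) =
      CommRingCat.ofHom (toSections q hU) ≫ π.appLE U V h from congrArg CommRingCat.Hom.hom h'
  apply Spec.map_injective
  rw [SpecMap_toSections, Spec.map_comp, SpecMap_toSections,
      IsAffineOpen.SpecMap_appLE_fromSpec_assoc]

section Normalization

variable {X : Scheme.{u}} [IsIntegral X] (L : Type u) [Field L] [Algebra X.functionField L]

/-- The spectrum of an extension of the function field, as a scheme over `X`. -/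
noncomputable def fromSpecExtension : Spec (.of L) ⟶ X :=
  Spec.map (CommRingCat.ofHom (algebraMap X.functionField L)) ≫ X.fromSpecStalk (genericPoint X)

/-- The map from the sections over an open set to an extension of the function field. -/
noncomputable def sectionsToExtension (U : X.Opens) [Nonempty U] : Γ(X, U) →+* L :=
  (algebraMap X.functionField L).comp (X.germToFunctionField U).hom

lemma fromSpecExtension_eq {U : X.Opens} (hU : IsAffineOpen U) [hne : Nonempty U] :
    fromSpecExtension L = Spec.map (CommRingCat.ofHom (sectionsToExtension L U)) ≫ hU.fromSpec := by
  have hmem : genericPoint X ∈ U := (genericPoint_spec X).mem_open_set_iff U.isOpen |>.2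
    ⟨_, trivial, hne.some.2⟩
  rw [fromSpecExtension, ← hU.fromSpecStalk_eq_fromSpecStalk hmem, IsAffineOpen.fromSpecStalk,
    ← Category.assoc, ← Spec.map_comp]
  rfl

lemma fromSpecExtension_preimage {U : X.Opens} (hU : IsAffineOpen U) [Nonempty U] :
    fromSpecExtension L ⁻¹ᵁ U = ⊤ := by
  rw [fromSpecExtension_eq L hU, Scheme.Hom.comp_preimage, hU.fromSpec_preimage_self]
  rfl

lemma fromSpecExtension_app {U : X.Opens} (hU : IsAffineOpen U) [Nonempty U] :
    (fromSpecExtension L).app U = CommRingCat.ofHom (sectionsToExtension L U) ≫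
      (Scheme.ΓSpecIso (.of L)).inv ≫
        (Spec (.of L)).presheaf.map (eqToHom (fromSpecExtension_preimage L hU)).op := by
  rw [Scheme.Hom.congr_app (fromSpecExtension_eq L hU) U, Scheme.Hom.comp_app,
    hU.fromSpec_app_self]
  simp only [Scheme.Hom.app_eq_appLE, Category.assoc]
  simp
  rfl

lemma isIntegralElem_of_eval₂_eq_zero {k A : Type*} [Field k] [CommRing A] (f : k →+* A) {x : A}
    {P : Polynomial k} (hP : P ≠ 0) (hPx : P.eval₂ f x = 0) : f.IsIntegralElem x := by
  refine ⟨P * Polynomial.C P.leadingCoeff⁻¹, Polynomial.monic_mul_leadingCoeff_inv hP, ?_⟩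
  rw [Polynomial.eval₂_mul, hPx, zero_mul]

/-- If the function field of a normal scheme `Y` over `X` embeds over `X` into an extension `L` of
the function field of `X` in which `k` is algebraically closed, then `k` is algebraically closed in
the function field of `Y`. The embedding is only given on the sections over one affine open subset.
-/
lemma isAlgClosedInFunctionField_of_injective {X Y : Scheme.{u}} [IsIntegral X] [IsIntegral Y]
    (hY : IsNormal Y) (π : Y ⟶ X) {k L : Type u} [Field k] [Field L]
    [Algebra X.functionField L] (p : X ⟶ Spec (.of k))
    (hL : ∀ x : L, ((algebraMap X.functionField L).comp (toFunctionField p)).IsIntegralElem x →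
      ∃ c : k, algebraMap X.functionField L (toFunctionField p c) = x)
    {U : X.Opens} (hU : IsAffineOpen U) [Nonempty U] {V : Y.Opens}
    (hV : IsAffineOpen V) [hVne : Nonempty V] (hUV : V ≤ π ⁻¹ᵁ U) (ψ : Γ(Y, V) →+* L)
        (hψi : Function.Injective ψ)
    (hψc : ψ.comp (π.appLE U V hUV).hom = sectionsToExtension L U) :
    IsAlgClosedInFunctionField (π ≫ p) := by
  rintro x ⟨P, hP, hPx⟩
  have hcomp := germToFunctionField_comp_toSections (π ≫ p) hV
  have hint : RingHom.IsIntegralElem (toFunctionField (π ≫ p)) x :=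
      isIntegralElem_of_eval₂_eq_zero _ hP hPx
  obtain ⟨Q, hQ, hQx⟩ := hint
  have hx : (Y.germToFunctionField V).hom.IsIntegralElem x :=
    ⟨Q.map (toSections (π ≫ p) hV), hQ.map _, by rw [Polynomial.eval₂_map, hcomp, hQx]⟩
  obtain ⟨s, rfl⟩ := hY.exists_germToFunctionField_eq_of_isIntegral
    V x hx
  have hQs : Q.eval₂ (toSections (π ≫ p) hV) s = 0 := by
    apply Y.germToFunctionField_injective V
    rw [map_zero, ← hQx, ← hcomp]
    exact Polynomial.hom_eval₂ _ _ _ _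
  have hψ : ψ.comp (toSections (π ≫ p) hV) =
      (algebraMap X.functionField L).comp (toFunctionField p) := by
    rw [toSections_comp π p hU hV hUV, ← germToFunctionField_comp_toSections p hU,
        ← RingHom.comp_assoc, hψc]
    rfl
  obtain ⟨c, hc⟩ := hL (ψ s) ⟨Q, hQ, by rw [← hψ, ← Polynomial.hom_eval₂, hQs, map_zero]⟩
  have hsc : toSections (π ≫ p) hV c = s := hψi ((DFunLike.congr_fun hψ c).trans hc)
  refine ⟨c, 1, one_ne_zero, ?_⟩
  rw [map_one, one_mul, ← hsc]
  exact DFunLike.congr_fun hcomp c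

variable [QuasiCompact (fromSpecExtension (X := X) L)]
    [QuasiSeparated (fromSpecExtension (X := X) L)]

/-- The sections of the normalization of `X` in an extension `L` of its function field over the
preimage of an affine open set form the integral closure in `L` of its coordinate ring. -/
lemma exists_ringEquiv_integralClosure {U : X.Opens} (hU : IsAffineOpen U) [Nonempty U] :
    let := (sectionsToExtension L U).toAlgebra
    ∃ e : Γ((fromSpecExtension (X := X) L).normalization,
        (fromSpecExtension (X := X) L).fromNormalization ⁻¹ᵁ U) ≃+* integralClosure Γ(X, U) L,
      e.toRingHom.comp ((fromSpecExtension (X := X) L).fromNormalization.app U).hom =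
        algebraMap _ _ := by
  let j := fromSpecExtension (X := X) L
  let := (sectionsToExtension L U).toAlgebra
  let := (j.app U).hom.toAlgebra
  let e₁ : L ≃+* Γ(Spec (.of L), j ⁻¹ᵁ U) :=
    ((Scheme.ΓSpecIso (.of L)).symm ≪≫ (Spec (.of L)).presheaf.mapIso
      (eqToIso (fromSpecExtension_preimage L hU)).op).commRingCatIsoToRingEquiv
  let e₂ : L ≃ₐ[Γ(X, U)] Γ(Spec (.of L), j ⁻¹ᵁ U) := AlgEquiv.ofRingEquiv (f := e₁) fun x ↦
    (DFunLike.congr_fun (congrArg CommRingCat.Hom.hom (fromSpecExtension_app L hU)) x).symm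
  refine ⟨(j.normalizationObjIso hU).commRingCatIsoToRingEquiv.trans
    e₂.symm.mapIntegralClosure.toRingEquiv, ?_⟩
  ext x
  have h : (j.normalizationObjIso hU).hom (j.fromNormalization.app U x) = algebraMap _ _ x := by
    rw [j.fromNormalization_app hU]
    simp
  have h' := congrArg (fun y ↦ e₂.symm.mapIntegralClosure y) h
  exact congrArg Subtype.val (h'.trans (AlgEquiv.commutes _ x))

lemma range_fromNormalization_eq_univ :
    Set.range (fromSpecExtension (X := X) L).fromNormalization = Set.univ := by
  let j := fromSpecExtension (X := X) L
  have hcl : IsClosed (Set.range j.fromNormalization) := by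
    exact j.fromNormalization.isClosedMap.isClosed_range
  have hgen : genericPoint X ∈ Set.range j.fromNormalization := by
    refine ⟨j.toNormalization (IsLocalRing.closedPoint L), ?_⟩
    have hj : ∀ z, j.fromNormalization (j.toNormalization z) = j z := fun z ↦ by
      rw [← Scheme.Hom.comp_apply, j.toNormalization_fromNormalization]
    refine (hj _).trans ?_
    change X.fromSpecStalk (genericPoint X) (Spec.map
      (CommRingCat.ofHom (algebraMap X.functionField L)) (IsLocalRing.closedPoint L)) = _
    have : Spec.map (CommRingCat.ofHom (algebraMap X.functionField L)) (IsLocalRing.closedPoint L) =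
      IsLocalRing.closedPoint (X.presheaf.stalk (genericPoint X)) := Subsingleton.elim
          (α := PrimeSpectrum X.functionField) _ _
    rw [this]
    exact Scheme.fromSpecStalk_closedPoint
  rw [← Set.univ_subset_iff, ← genericPoint_closure]
  exact hcl.closure_subset_iff.2 (by simpa using hgen)

lemma isNormal_normalization [FiniteDimensional X.functionField L] :
    IsNormal (fromSpecExtension (X := X) L).normalization := by
  refine .of_forall_exists_isOpenImmersion fun y ↦ ?_
  let π := (fromSpecExtension (X := X) L).fromNormalization
  obtain ⟨U, hU, hy, -⟩ := exists_isAffineOpen_mem_and_subset (U := ⊤) (x := π y) trivial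
  have hne : Nonempty U := ⟨⟨_, hy⟩⟩
  have hV : IsAffineOpen (π ⁻¹ᵁ U) := hU.preimage π
  obtain ⟨e, -⟩ := exists_ringEquiv_integralClosure L hU
  let := (sectionsToExtension L U).toAlgebra
  have : IsScalarTower Γ(X, U) X.functionField L := .of_algebraMap_eq' rfl
  have := functionField_isFractionRing_of_isAffineOpen X U hU
  have : IsIntegrallyClosed (integralClosure Γ(X, U) L) :=
    integralClosure.isIntegrallyClosedOfFiniteExtension X.functionField
  have : IsDomain Γ((fromSpecExtension (X := X) L).normalization, π ⁻¹ᵁ U) :=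
      e.toMulEquiv.isDomain _
  have : IsIntegrallyClosed Γ((fromSpecExtension (X := X) L).normalization, π ⁻¹ᵁ U) :=
    .of_equiv e.symm
  refine ⟨_, hV.fromSpec, inferInstance, ?_, isNormal_Spec _⟩
  rw [hV.range_fromSpec]
  exact hy

lemma isFinite_fromNormalization [FiniteDimensional X.functionField L] [CharZero X.functionField]
    (hX : IsNormal X) (hN : ∀ (U : X.Opens), IsAffineOpen U → IsNoetherianRing Γ(X, U)) :
    IsFinite (fromSpecExtension (X := X) L).fromNormalization := by
  let π := (fromSpecExtension (X := X) L).fromNormalization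
  rw [isFinite_iff]
  refine ⟨inferInstance, fun U hU ↦ ?_⟩
  by_cases hne : Nonempty U
  · obtain ⟨e, he⟩ := exists_ringEquiv_integralClosure L hU
    let := (sectionsToExtension L U).toAlgebra
    have : IsScalarTower Γ(X, U) X.functionField L := .of_algebraMap_eq' rfl
    have := functionField_isFractionRing_of_isAffineOpen X U hU
    have := hX.isIntegrallyClosed U hU
    have := hN U hU
    have hfin : Module.Finite Γ(X, U) (integralClosure Γ(X, U) L) :=
      IsIntegralClosure.finite Γ(X, U) X.functionField L _
    have he' : (π.app U).hom = e.symm.toRingHom.comp (algebraMap _ _) := by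
      rw [← he]
      ext x
      simp [π]
    change (π.app U).hom.Finite
    rw [he']
    exact .comp (.of_surjective _ e.symm.surjective) (RingHom.finite_algebraMap.2 hfin)
  · have hU' : U = ⊥ := by
      ext x
      exact ⟨fun hx ↦ (hne ⟨⟨x, hx⟩⟩).elim, fun hx ↦ hx.elim⟩
    subst hU'
    have : Subsingleton Γ((fromSpecExtension (X := X) L).normalization, π ⁻¹ᵁ ⊥) :=
      inferInstanceAs (Subsingleton Γ((fromSpecExtension (X := X) L).normalization, ⊥))
    exact .of_surjective _ fun x ↦ ⟨0, Subsingleton.elim _ _⟩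

lemma formallyUnramified_integralClosure {U : X.Opens} (hU : IsAffineOpen U) [Nonempty U]
    (h : FormallyUnramified (fromSpecExtension (X := X) L).fromNormalization) :
    let := (sectionsToExtension L U).toAlgebra
    Algebra.FormallyUnramified Γ(X, U) (integralClosure Γ(X, U) L) := by
  let π := (fromSpecExtension (X := X) L).fromNormalization
  obtain ⟨e, he⟩ := exists_ringEquiv_integralClosure L hU
  let := (sectionsToExtension L U).toAlgebra
  have h' := h.formallyUnramified_appLE hU (hU.preimage π) le_rfl
  rw [← Scheme.Hom.app_eq_appLE] at h'
  have := RingHom.FormallyUnramified.respectsIso.1 _ e h'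
  rw [he] at this
  exact RingHom.formallyUnramified_algebraMap.1 this

/-- A field which is algebraically closed in the extension is algebraically closed in the function
field of the normalization. -/
lemma isAlgClosedInFunctionField_normalization [FiniteDimensional X.functionField L]
    {k : Type u} [Field k] (p : X ⟶ Spec (.of k))
    (hL : ∀ x : L, ((algebraMap X.functionField L).comp (toFunctionField p)).IsIntegralElem x →
      ∃ c : k, algebraMap X.functionField L (toFunctionField p c) = x) :
    IsAlgClosedInFunctionField ((fromSpecExtension (X := X) L).fromNormalization ≫ p) := by
  obtain ⟨U, hU, hgU, -⟩ := exists_isAffineOpen_mem_and_subset (U := ⊤)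
      (x := genericPoint X) trivial
  have hne : Nonempty U := ⟨⟨_, hgU⟩⟩
  obtain ⟨y, hy⟩ : genericPoint X ∈ Set.range (fromSpecExtension (X := X) L).fromNormalization :=
    (range_fromNormalization_eq_univ L).ge (Set.mem_univ _)
  obtain ⟨e, he⟩ := exists_ringEquiv_integralClosure L hU
  let := (sectionsToExtension L U).toAlgebra
  refine isAlgClosedInFunctionField_of_injective (isNormal_normalization L) _ p hL hU
    (hU.preimage _) (hVne := ⟨⟨y, show (fromSpecExtension (X := X) L).fromNormalization y ∈ U by
      rwa [hy]⟩⟩) le_rfl ((algebraMap (integralClosure Γ(X, U) L) L).comp e.toRingHom)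
    (Subtype.val_injective.comp e.injective) ?_
  rw [← Scheme.Hom.app_eq_appLE, RingHom.comp_assoc, he]
  rfl

end Normalization

/-! ### Geometrically connected schemes -/

section Connected

lemma mem_range_of_tmul_comm {k K : Type*} [Field k] [Field K] [Algebra k K] {x : K}
    (h : (x ⊗ₜ[k] 1 : K ⊗[k] K) = 1 ⊗ₜ[k] x) : x ∈ (algebraMap k K).range := by
  obtain ⟨l, hl⟩ := (Algebra.linearMap k K).exists_leftInverse_of_injective
    (LinearMap.ker_eq_bot.2 (algebraMap k K).injective)
  have hl1 : l 1 = 1 := by simpa using DFunLike.congr_fun hl 1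
  refine ⟨l x, ?_⟩
  have := congrArg (TensorProduct.lid k K ∘ l.rTensor K) h
  simpa [hl1, Algebra.smul_def] using this

/-- A geometrically connected scheme over a field does not live over a proper finite separable
extension: the spectrum of `K ⊗ K` is the image of the base change to `K`. -/
lemma mem_range_of_geometricallyConnected {k K : Type u} [Field k] [CharZero k] [Field K]
    [Algebra k K] [FiniteDimensional k K] {X : Scheme.{u}} [Nonempty X] (p : X ⟶ Spec (.of k))
    [GeometricallyConnected p] (h : X ⟶ Spec (.of K))
    (hp : h ≫ Spec.map (CommRingCat.ofHom (algebraMap k K)) = p) (x : K) :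
    x ∈ (algebraMap k K).range := by
  subst hp
  have hpush := (isPullback_SpecMap_of_isPushout _ _ _ _
    (CommRingCat.isPushout_tensorProduct k K K))
  have hP := IsPullback.of_hasPullback (h ≫ Spec.map (CommRingCat.ofHom (algebraMap k K)))
      (Spec.map (CommRingCat.ofHom (algebraMap k K)))
  have hconn : ConnectedSpace ↥(pullback (h ≫ Spec.map (CommRingCat.ofHom (algebraMap k K)))
      (Spec.map (CommRingCat.ofHom (algebraMap k K)))) :=
    GeometricallyConnected.geometrically_connectedSpace _ _ _ hP
  have hsurj : Surjective h :=
    ⟨fun y ↦ ⟨Classical.arbitrary X, Subsingleton.elim (α := PrimeSpectrum K) _ _⟩⟩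
  have hQ := IsPullback.of_right' hP.flip hpush
  have hs : Surjective (hpush.lift _ _ _) := MorphismProperty.of_isPullback hQ.flip hsurj
  have hconn' : ConnectedSpace (PrimeSpectrum (K ⊗[k] K)) :=
    hs.1.connectedSpace (Scheme.Hom.continuous _)
  have : IsArtinianRing (K ⊗[k] K) := IsArtinianRing.of_finite K _
  have hsub : Subsingleton (PrimeSpectrum (K ⊗[k] K)) := PreconnectedSpace.trivial_of_discrete
  have : Algebra.FormallyUnramified k K := .of_isSeparable k K
  have hred : _root_.IsReduced (K ⊗[k] K) := Algebra.FormallyUnramified.isReduced_of_field K _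
  refine mem_range_of_tmul_comm (sub_eq_zero.1 (hred.eq_zero _ ?_))
  rw [nilpotent_iff_mem_prime]
  intro J hJ
  have hJ' : (RingHom.ker (Algebra.TensorProduct.lmul' k (S := K))).IsPrime := RingHom.ker_isPrime _
  have : (⟨J, hJ⟩ : PrimeSpectrum (K ⊗[k] K)) = ⟨_, hJ'⟩ := Subsingleton.elim _ _
  rw [show J = _ from congrArg PrimeSpectrum.asIdeal this]
  simp [RingHom.mem_ker]

instance {X : Scheme.{u}} [Nonempty X] : Nonempty (⊤ : X.Opens) :=
  ⟨⟨Classical.arbitrary X, trivial⟩⟩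

lemma toSpecΓ_comp_SpecMap {k : Type u} [CommRing k] {X : Scheme.{u}} (p : X ⟶ Spec (.of k)) :
    X.toSpecΓ ≫ Spec.map ((Scheme.ΓSpecIso (.of k)).inv ≫ p.appTop) = p := by
  rw [Spec.map_comp, ← Scheme.toSpecΓ_naturality_assoc, toSpecΓ_SpecMap_ΓSpecIso_inv,
    Category.comp_id]

lemma toFunctionField_eq_comp {k : Type u} [CommRing k] {X : Scheme.{u}} [IsIntegral X]
    (p : X ⟶ Spec (.of k)) :
    toFunctionField p = (X.germToFunctionField ⊤).hom.comp
      ((Scheme.ΓSpecIso (.of k)).inv ≫ p.appTop).hom := by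
  suffices h : Spec.preimage (X.fromSpecStalk (genericPoint X) ≫ p) =
      ((Scheme.ΓSpecIso (.of k)).inv ≫ p.appTop) ≫ X.germToFunctionField ⊤ from
    congrArg CommRingCat.Hom.hom h
  apply Spec.map_injective
  have h := Scheme.fromSpecStalk_toSpecΓ X (genericPoint X)
  rw [Spec.map_preimage, Spec.map_comp]
  change _ = Spec.map (X.presheaf.germ ⊤ (genericPoint X) trivial) ≫ _
  rw [← h, Category.assoc, toSpecΓ_comp_SpecMap]

/-- A field over which a normal integral scheme is geometrically connected is algebraically closed
in the function field. -/
lemma exists_toFunctionField_eq_of_isIntegralElem {k : Type u} [Field k] [CharZero k]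
    {X : Scheme.{u}} [IsIntegral X] (hX : IsNormal X) (p : X ⟶ Spec (.of k))
    [GeometricallyConnected p] (x : X.functionField) (hx : (toFunctionField p).IsIntegralElem x) :
    ∃ c, toFunctionField p c = x := by
  let ρ : k →+* Γ(X, ⊤) := ((Scheme.ΓSpecIso (.of k)).inv ≫ p.appTop).hom
  obtain ⟨P, hP, hPx⟩ := hx
  have hx' : (X.germToFunctionField ⊤).hom.IsIntegralElem x :=
    ⟨P.map ρ, hP.map _, by rw [Polynomial.eval₂_map, ← toFunctionField_eq_comp p, hPx]⟩
  obtain ⟨s, rfl⟩ := hX.exists_germToFunctionField_eq_of_isIntegral ⊤ x hx'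
  let : Algebra k Γ(X, ⊤) := ρ.toAlgebra
  have hs : IsIntegral k s := by
    refine ⟨P, hP, X.germToFunctionField_injective ⊤ ?_⟩
    rw [map_zero, ← hPx, toFunctionField_eq_comp p]
    exact Polynomial.hom_eval₂ _ _ _ _
  have hirr : Irreducible (minpoly k s) := minpoly.irreducible hs
  have : Fact (Irreducible (minpoly k s)) := ⟨hirr⟩
  have : FiniteDimensional k (AdjoinRoot (minpoly k s)) := (minpoly.monic hs).finite_adjoinRoot
  let ψ : AdjoinRoot (minpoly k s) →ₐ[k] Γ(X, ⊤) :=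
    AdjoinRoot.liftAlgHom _ (Algebra.ofId _ _) s (minpoly.aeval k s)
  obtain ⟨c, hc⟩ := mem_range_of_geometricallyConnected p
    (X.toSpecΓ ≫ Spec.map (CommRingCat.ofHom ψ.toRingHom)) (by
      rw [Category.assoc, ← Spec.map_comp, ← CommRingCat.ofHom_comp, AlgHom.toRingHom_eq_coe,
        AlgHom.comp_algebraMap]
      exact toSpecΓ_comp_SpecMap p) (AdjoinRoot.root (minpoly k s))
  refine ⟨c, ?_⟩
  rw [toFunctionField_eq_comp p]
  change X.germToFunctionField ⊤ (algebraMap k _ c) = _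
  rw [← ψ.commutes, hc]
  exact congrArg (X.germToFunctionField ⊤) (AdjoinRoot.liftAlgHom_root ..)

end Connected

/-! ### Density of rational points -/

section DensityOfRationalPoints

variable {k : Type u} [Field k]

lemma isNoetherianRing_of_locallyOfFiniteType {X : Scheme.{u}} (p : X ⟶ Spec (.of k))
    [LocallyOfFiniteType p] {U : X.Opens} (hU : IsAffineOpen U) : IsNoetherianRing Γ(X, U) := by
  let := (toSections p hU).toAlgebra
  have : Algebra.FiniteType k Γ(X, U) := finiteType_toSections p hU
  exact Algebra.FiniteType.isNoetherianRing k _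

variable [CharZero k] {X : Scheme.{u}} [IsIntegral X]

lemma charZero_functionField (p : X ⟶ Spec (.of k)) : CharZero X.functionField :=
  (toFunctionField p).charZero_iff (toFunctionField p).injective |>.1 inferInstance

/-- A geometrically connected integral scheme with an affine open subset whose coordinate ring is a
field has a rational point which is generic. -/
lemma exists_rationalPoint_of_isField (hX : IsNormal X) (p : X ⟶ Spec (.of k))
    [LocallyOfFiniteType p] [GeometricallyConnected p] {U : X.Opens} (hU : IsAffineOpen U)
    (hgU : genericPoint X ∈ U) (hB : IsField Γ(X, U)) :
    ∃ x : RationalPoint p, x.toPoint = genericPoint X := by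
  have hne : Nonempty U := ⟨⟨_, hgU⟩⟩
  have hbij : Function.Bijective (toSections p hU) := by
    refine ⟨(toSections p hU).injective, fun b ↦ ?_⟩
    let := (toSections p hU).toAlgebra
    have : Algebra.FiniteType k Γ(X, U) := finiteType_toSections p hU
    let := hB.toField
    have hfin : Module.Finite k Γ(X, U) := finite_of_finite_type_of_isJacobsonRing _ _
    obtain ⟨P, hP, hPb⟩ := Algebra.IsIntegral.isIntegral (R := k) b
    obtain ⟨c, hc⟩ := exists_toFunctionField_eq_of_isIntegralElem hX p (X.germToFunctionField U b)
      ⟨P, hP, by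
        rw [← germToFunctionField_comp_toSections p hU]
        refine (Polynomial.hom_eval₂ _ _ _ _).symm.trans ?_
        erw [hPb, map_zero]⟩
    refine ⟨c, X.germToFunctionField_injective U ?_⟩
    rw [← hc, ← germToFunctionField_comp_toSections p hU]
    rfl
  let e := RingEquiv.ofBijective _ hbij
  let x : RationalPoint p := ⟨Spec.map (CommRingCat.ofHom e.symm.toRingHom) ≫ hU.fromSpec, by
    rw [Category.assoc, ← SpecMap_toSections, ← Spec.map_comp, ← CommRingCat.ofHom_comp]
    have : e.symm.toRingHom.comp (toSections p hU) = RingHom.id k := by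
      ext c
      exact e.symm_apply_apply c
    rw [this]
    exact Spec.map_id _⟩
  refine ⟨x, ?_⟩
  obtain ⟨z, hz⟩ : genericPoint X ∈ Set.range hU.fromSpec := by rwa [hU.range_fromSpec]
  rw [← hz]
  let := hB.toField
  have : Subsingleton (PrimeSpectrum Γ(X, U)) := inferInstance
  exact congrArg hU.fromSpec (Subsingleton.elim (α := PrimeSpectrum Γ(X, U)) _ _)

/-- A geometrically connected normal variety with an affine open subset whose coordinate ring is
not a field has a ramified double cover which is normal and geometrically integral. -/
lemma exists_ramified_cover (hX : IsNormal X) (p : X ⟶ Spec (.of k))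
    [LocallyOfFiniteType p] [GeometricallyConnected p] [IsSeparated p] [CompactSpace X]
    {U : X.Opens} (hU : IsAffineOpen U)
    (hgU : genericPoint X ∈ U) (hB : ¬ IsField Γ(X, U)) :
    ∃ (Y : Scheme.{u}) (π : Y ⟶ X), IsFinite π ∧ Surjective π ∧ IsRamified π ∧
      GeometricallyIntegral (π ≫ p) ∧ IsNormal Y := by
  have hne : Nonempty U := ⟨⟨_, hgU⟩⟩
  have := isNoetherianRing_of_locallyOfFiniteType p hU
  have := hX.isIntegrallyClosed U hU
  obtain ⟨q, hq, b, hR, hb⟩ := exists_valuationRing_uniformizer Γ(X, U) hB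
  let R := Localization.AtPrime q
  let K := X.functionField
  have := functionField_isFractionRing_of_isAffineOpen X U hU
  have hle : q.primeCompl ≤ nonZeroDivisors Γ(X, U) := Ideal.primeCompl_le_nonZeroDivisors _
  have hdom : IsDomain R := IsLocalization.isDomain_of_le_nonZeroDivisors R hle
  have : IsIntegrallyClosed R := isIntegrallyClosed_of_isLocalization R _ hle
  let : Algebra R X.functionField :=
    (IsLocalization.lift (M := q.primeCompl) (g := algebraMap Γ(X, U) X.functionField)
      fun s ↦ IsUnit.mk0 _ (by
        simpa using nonZeroDivisors.ne_zero (hle s.2))).toAlgebra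
  have hT : IsScalarTower Γ(X, U) R X.functionField := .of_algebraMap_eq fun x ↦
    (IsLocalization.lift_eq _ _).symm
  have hfr : IsFractionRing R X.functionField :=
    IsFractionRing.isFractionRing_of_isDomain_of_isLocalization q.primeCompl R X.functionField
  have := charZero_functionField p
  let : Algebra k Γ(X, U) := (toSections p hU).toAlgebra
  let : Algebra k X.functionField := (toFunctionField p).toAlgebra
  have : IsScalarTower k R X.functionField := .of_algebraMap_eq fun x ↦ by
    rw [IsScalarTower.algebraMap_apply k Γ(X, U) R, ← IsScalarTower.algebraMap_apply Γ(X, U) R]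
    exact (DFunLike.congr_fun (germToFunctionField_comp_toSections p hU) x).symm
  have h2 : IsUnit (2 : R) := by
    have := (Ne.isUnit (two_ne_zero (α := k))).map (algebraMap k R)
    rwa [map_ofNat] at this
  obtain ⟨L, _, _, _, h, σ, hh, hσ, hL⟩ := exists_quadratic_extension
    (algebraMap R X.functionField (algebraMap _ R b)) (fun w hw ↦ by
      have hw0 : w ≠ 0 := by
        rintro rfl
        rw [zero_pow two_ne_zero, eq_comm, ← map_zero (algebraMap R X.functionField)] at hw
        exact hb.ne_zero (IsFractionRing.injective R X.functionField hw)
      refine not_isUnit_of_mul_sq hb 1 w⁻¹ ?_ isUnit_one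
      rw [← hw, map_one, inv_pow, mul_inv_cancel₀ (pow_ne_zero 2 hw0)])
  have : QuasiSeparatedSpace X := quasiSeparatedSpace_of_quasiSeparated p
  have hfinite := isFinite_fromNormalization L hX
    fun V hV ↦ isNoetherianRing_of_locallyOfFiniteType p hV
  refine ⟨_, (fromSpecExtension (X := X) L).fromNormalization, hfinite,
    ⟨Set.range_eq_univ.1 (range_fromNormalization_eq_univ L)⟩, fun hunr ↦ ?_, ?_,
    isNormal_normalization L⟩
  · have hfu := formallyUnramified_integralClosure L hU hunr.2
    let : Algebra Γ(X, U) L := (sectionsToExtension L U).toAlgebra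
    have : IsScalarTower Γ(X, U) X.functionField L := .of_algebraMap_eq' rfl
    exact not_formallyUnramified_quadratic (R := R) (K := X.functionField) b rfl hb hh hσ
      h2 hL hfu
  · let π := (fromSpecExtension (X := X) L).fromNormalization
    have : CompactSpace (fromSpecExtension (X := X) L).normalization :=
      QuasiCompact.compactSpace_of_compactSpace π
    let : Algebra k L := ((algebraMap X.functionField L).comp (toFunctionField p)).toAlgebra
    have : IsScalarTower k X.functionField L := .of_algebraMap_eq' rfl
    have hcl := isAlgClosedInFunctionField_normalization L p fun x hx ↦
      mem_range_of_isIntegral_quadratic (R := R) (k := k)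
        (fun x hx ↦ exists_toFunctionField_eq_of_isIntegralElem hX p x hx) hb hh hσ hL x hx
    obtain ⟨a, ha, H⟩ := exists_geometricallyIntegral_isNormal_pullback (π ≫ p)
      (isNormal_normalization L) (toFunctionField (π ≫ p)).injective hcl
    refine (H k (RingHom.id k) ha _ (𝟙 _) _ ?_).1
    rw [CommRingCat.ofHom_id, Spec.map_id]
    exact .of_horiz_isIso ⟨by simp [π]⟩

/-- On a normal variety with the very-weak-Hilbert property the rational points are dense. The
property only says something about the rational points as soon as there is one ramified cover, which
`exists_ramified_cover` provides unless the variety is a point. -/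
lemma isZariskiDense_univ (hX : IsNormal X) (p : X ⟶ Spec (.of k))
    [LocallyOfFiniteType p] [GeometricallyConnected p] [IsSeparated p] [CompactSpace X]
    (H : ∀ (Y : Scheme.{u}) (π : Y ⟶ X), IsFinite π → Surjective π → IsRamified π →
      GeometricallyIntegral (π ≫ p) → IsNormal Y →
        IsZariskiDense (Set.range (RationalPoint.map p π))ᶜ) :
    IsZariskiDense (Set.univ : Set (RationalPoint p)) := by
  obtain ⟨U, hU, hgU, -⟩ := exists_isAffineOpen_mem_and_subset (U := ⊤)
      (x := genericPoint X) trivial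
  by_cases hB : IsField Γ(X, U)
  · obtain ⟨x, hx⟩ := exists_rationalPoint_of_isField hX p hU hgU hB
    refine Dense.mono (s₁ := {genericPoint X}) ?_ ?_
    · rw [Set.singleton_subset_iff]
      exact ⟨x, trivial, hx⟩
    · rw [dense_iff_closure_eq]
      exact genericPoint_closure X
  · obtain ⟨Y, π, h₁, h₂, h₃, h₄, h₅⟩ := exists_ramified_cover hX p hU hgU hB
    exact (H Y π h₁ h₂ h₃ h₄ h₅).mono (Set.image_mono (Set.subset_univ _))

end DensityOfRationalPoints

/-! ### Projective schemes are proper -/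

section Projective

attribute [local instance] MvPolynomial.gradedAlgebra

lemma algebraMap_homogeneousSubmodule_zero_surjective (k : Type u) [Field k] (n : ℕ) :
    Function.Surjective (algebraMap k (MvPolynomial.homogeneousSubmodule (Fin (n + 1)) k 0)) := by
  rintro ⟨x, hx⟩
  refine ⟨MvPolynomial.coeff 0 x, Subtype.ext ?_⟩
  have h := MvPolynomial.totalDegree_eq_zero_iff_eq_C.1
    (Nat.le_zero.1 (((MvPolynomial.mem_homogeneousSubmodule 0 x).1 hx).totalDegree_le))
  exact h.symm

/-- A projective `k`-scheme is proper over `k`. -/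
lemma IsProjective.isProper {k : Type u} [Field k] {X : Scheme.{u}} {p : X ⟶ Spec (.of k)}
    (h : IsProjective p) : IsProper p := by
  obtain ⟨n, i, hi, rfl⟩ := h
  have : IsScalarTower k (MvPolynomial.homogeneousSubmodule (Fin (n + 1)) k 0)
      (MvPolynomial (Fin (n + 1)) k) :=
    ⟨fun x y z ↦ smul_mul_assoc x y.1 z⟩
  have : Algebra.FiniteType (MvPolynomial.homogeneousSubmodule (Fin (n + 1)) k 0)
      (MvPolynomial (Fin (n + 1)) k) :=
    .of_restrictScalars_finiteType k _ _
  have : IsClosedImmersion (Spec.map (CommRingCat.ofHom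
      (algebraMap k (MvPolynomial.homogeneousSubmodule (Fin (n + 1)) k 0)))) :=
    IsClosedImmersion.spec_of_surjective _ (algebraMap_homogeneousSubmodule_zero_surjective k n)
  have : IsProper (projectiveSpaceToSpec k n) := by
    unfold projectiveSpaceToSpec
    infer_instance
  infer_instance

end Projective

/-! ### Factorization through a finite extension of the base -/

section SteinFactorization

lemma toFunctionField_toSpecΓ_comp {T : Type u} [CommRing T] {Y : Scheme.{u}} [IsIntegral Y]
    (θ : T →+* Γ(Y, ⊤)) :
    toFunctionField (Y.toSpecΓ ≫ Spec.map (CommRingCat.ofHom θ)) =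
      (Y.germToFunctionField ⊤).hom.comp θ := by
  suffices h : Spec.preimage (Y.fromSpecStalk (genericPoint Y) ≫ Y.toSpecΓ ≫
      Spec.map (CommRingCat.ofHom θ)) = CommRingCat.ofHom θ ≫ Y.germToFunctionField ⊤ from
    congrArg CommRingCat.Hom.hom h
  apply Spec.map_injective
  have h := Scheme.fromSpecStalk_toSpecΓ Y (genericPoint Y)
  rw [Spec.map_preimage, Spec.map_comp, ← Category.assoc, h]

/-- A dominant morphism of finite type `q` from a normal integral scheme to `Spec A` factors through
`Spec T` for a finite extension `T` of `A` whose fraction field is algebraically closed in the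
function field. This plays the role of the Stein factorization, over a dense open subset of the
base, but does not require `q` to be proper. -/
lemma exists_finite_factorization {A : Type u} [CommRing A] [IsDomain A] [CharZero A]
    {Y : Scheme.{u}} [IsIntegral Y] (hn : IsNormal Y) (q : Y ⟶ Spec (.of A)) [LocallyOfFiniteType q]
    (hq : Function.Injective (toFunctionField q)) :
    ∃ (T : Type u) (_ : CommRing T) (_ : IsDomain T) (_ : Algebra A T) (_ : Module.Finite A T)
      (qT : Y ⟶ Spec (.of T)), qT ≫ Spec.map (CommRingCat.ofHom (algebraMap A T)) = q ∧
        Function.Injective (toFunctionField qT) ∧ IsAlgClosedInFunctionField qT := by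
  obtain ⟨U, hU, hyU, -⟩ := exists_isAffineOpen_mem_and_subset (X := Y) (U := ⊤)
    (x := genericPoint Y) trivial
  have hne : Nonempty U := ⟨⟨_, hyU⟩⟩
  let : Algebra A Γ(Y, U) := (toSections q hU).toAlgebra
  let : Algebra A Y.functionField := (toFunctionField q).toAlgebra
  have : IsScalarTower A Γ(Y, U) Y.functionField :=
    .of_algebraMap_eq' (germToFunctionField_comp_toSections q hU).symm
  have : Algebra.FiniteType A Γ(Y, U) := finiteType_toSections q hU
  have := functionField_isFractionRing_of_isAffineOpen Y U hU
  have := hn.isIntegrallyClosed U hU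
  have hinj : Function.Injective (algebraMap A Γ(Y, U)) := by
    have := hq
    rw [← germToFunctionField_comp_toSections q hU, RingHom.coe_comp] at this
    exact this.of_comp
  obtain ⟨T, hT, HT⟩ := exists_finite_subalgebra A Γ(Y, U) Y.functionField hinj
  let G : Γ(Y, ⊤) →+* Y.functionField := (Y.germToFunctionField ⊤).hom
  have hG : Function.Injective G := Scheme.germToFunctionField_injective Y ⊤
  let ρ : A →+* Γ(Y, ⊤) := ((Scheme.ΓSpecIso (.of A)).inv ≫ q.appTop).hom
  have hρ : G.comp ρ = algebraMap A Y.functionField := (toFunctionField_eq_comp q).symm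
  have hmem : ∀ x : T, x.1 ∈ G.range := by
    intro x
    have hx : IsIntegral A x.1 := (Algebra.IsIntegral.isIntegral (R := A) x).map T.val
    obtain ⟨P, hP, hPx⟩ := hx
    exact hn.exists_germToFunctionField_eq_of_isIntegral ⊤ x.1
      ⟨P.map ρ, hP.map _, by rw [Polynomial.eval₂_map, ← hPx, ← hρ]; rfl⟩
  let θ : T →+* Γ(Y, ⊤) :=
    (RingEquiv.ofBijective G.rangeRestrict ⟨fun x y h ↦ hG (congrArg Subtype.val h),
      G.rangeRestrict_surjective⟩).symm.toRingHom.comp (T.val.toRingHom.codRestrict G.range hmem)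
  have hθ : G.comp θ = T.val.toRingHom := by
    ext x
    exact congrArg Subtype.val ((RingEquiv.ofBijective G.rangeRestrict
      ⟨fun x y h ↦ hG (congrArg Subtype.val h), G.rangeRestrict_surjective⟩).apply_symm_apply
        (T.val.toRingHom.codRestrict G.range hmem x))
  have hff : toFunctionField (Y.toSpecΓ ≫ Spec.map (CommRingCat.ofHom θ)) = T.val.toRingHom :=
    (toFunctionField_toSpecΓ_comp θ).trans hθ
  refine ⟨T, inferInstance, inferInstance, inferInstance, hT,
    Y.toSpecΓ ≫ Spec.map (CommRingCat.ofHom θ), ?_, ?_, ?_⟩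
  · have : CommRingCat.ofHom (algebraMap A T) ≫ CommRingCat.ofHom θ =
        (Scheme.ΓSpecIso (.of A)).inv ≫ q.appTop := by
      ext a
      refine hG ?_
      exact (DFunLike.congr_fun hθ (algebraMap A T a)).trans (DFunLike.congr_fun hρ a).symm
    rw [Category.assoc, ← Spec.map_comp, this, toSpecΓ_comp_SpecMap]
  · rw [hff]
    exact Subtype.val_injective
  · rintro x ⟨p, hp, hpx⟩
    rw [hff] at hpx ⊢
    have hx : IsAlgebraic T x := ⟨p, hp, hpx⟩
    have : FaithfulSMul A T := (faithfulSMul_iff_algebraMap_injective A T).2 fun a b h ↦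
      hq (congrArg Subtype.val h)
    obtain ⟨a, ha, hax⟩ := HT x (hx.restrictScalars A)
    refine ⟨⟨_, hax⟩, algebraMap A T a, ?_, (Algebra.smul_def a x).symm⟩
    exact fun h ↦ ha (FaithfulSMul.algebraMap_injective A T (h.trans (map_zero _).symm))

end SteinFactorization

/-! ### Comparison of the fibres of a cover -/

section FibresOfCover

/-- Dominance over `Spec A` can be checked on a single chart. -/
lemma injective_toFunctionField {A B : Type u} [CommRing A] [CommRing B] {Y : Scheme.{u}}
    [IsIntegral Y] (q : Y ⟶ Spec (.of A)) (j : Spec (.of B) ⟶ Y) (φ : A →+* B)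
    (hj : j ≫ q = Spec.map (CommRingCat.ofHom φ)) (hφ : Function.Injective φ) :
    Function.Injective (toFunctionField q) := by
  rw [toFunctionField_eq_comp, RingHom.coe_comp]
  refine (Scheme.germToFunctionField_injective Y ⊤).comp ?_
  have h : ((Scheme.ΓSpecIso (.of A)).inv ≫ q.appTop) ≫ j.appTop =
      CommRingCat.ofHom φ ≫ (Scheme.ΓSpecIso (.of B)).inv := by
    rw [Category.assoc, ← Scheme.Hom.comp_appTop, hj, Scheme.ΓSpecIso_inv_naturality]
  refine Function.Injective.of_comp (f := j.appTop.hom) ?_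
  rw [← RingHom.coe_comp, ← CommRingCat.hom_comp, h, CommRingCat.hom_comp, RingHom.coe_comp]
  exact ((ConcreteCategory.bijective_of_isIso (Scheme.ΓSpecIso (.of B)).inv).1).comp hφ

variable {A T C B κ : Type u} [CommRing A] [CommRing T] [CommRing C] [CommRing B] [Algebra A T]
  [Algebra A C] [Algebra A B] [Algebra T B] [Algebra C B] [IsScalarTower A T B]
  [IsScalarTower A C B] [Field κ] [Algebra A κ] [Algebra T κ] [IsScalarTower A T κ]
  {X Y Z W : Scheme.{u}} {qX : X ⟶ Spec (.of A)} {qT : Y ⟶ Spec (.of T)} {π : Y ⟶ X}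
  (jC : Spec (.of C) ⟶ X) (jB : Spec (.of B) ⟶ Y)
  (hjC : jC ≫ qX = Spec.map (CommRingCat.ofHom (algebraMap A C)))
  (hjB : jB ≫ qT = Spec.map (CommRingCat.ofHom (algebraMap T B)))
  (hj : jB ≫ π = Spec.map (CommRingCat.ofHom (algebraMap C B)) ≫ jC)
  {fst : Z ⟶ X} {snd : Z ⟶ Spec (.of κ)}
  (hZ : IsPullback fst snd qX (Spec.map (CommRingCat.ofHom (algebraMap A κ))))
  {fst' : W ⟶ Y} {snd' : W ⟶ Spec (.of κ)}
  (hW : IsPullback fst' snd' qT (Spec.map (CommRingCat.ofHom (algebraMap T κ))))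
  {ρ : W ⟶ Z} (hρ : ρ ≫ fst = fst' ≫ π) (hρ' : ρ ≫ snd = snd')

include hjC hjB hj hZ hW hρ hρ' in
/-- The map of fibres induced by `π` is dominant as soon as this holds on one pair of charts, since
the fibre `Z` of the target is irreducible. -/
lemma isDominant_of_injective_tensorComparison [IsOpenImmersion jC] [IsIntegral Z]
    [Nontrivial (κ ⊗[A] C)]
    (H : IsDomain (κ ⊗[A] C) → ∀ (g : κ ⊗[A] C →+* κ ⊗[T] B),
        (∀ x, g (x ⊗ₜ 1) = x ⊗ₜ 1) → (∀ c, g (1 ⊗ₜ c) = 1 ⊗ₜ algebraMap C B c) →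
          Function.Injective g) : IsDominant ρ := by
  obtain ⟨w, hw, hwp⟩ := exists_isPullback_Spec_tensor hZ jC hjC
  obtain ⟨v, hv, hvp⟩ := exists_isPullback_Spec_tensor hW jB hjB
  obtain ⟨g, hg₁, hg₂⟩ := exists_tensorComparison A T C B κ
  have : IsOpenImmersion w := MorphismProperty.of_isPullback hwp.flip ‹_›
  have hdom : IsDomain (κ ⊗[A] C) :=
    (affine_isIntegral_iff (.of (κ ⊗[A] C))).1 (isIntegral_of_isOpenImmersion w)
  have hgi := H hdom g hg₁ hg₂
  have hcomm : Spec.map (CommRingCat.ofHom g) ≫ w = v ≫ ρ := by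
    apply hZ.hom_ext
    · rw [Category.assoc, Category.assoc, hρ, hwp.w, reassoc_of% hvp.w, hj, ← Spec.map_comp_assoc,
        ← Spec.map_comp_assoc, ← CommRingCat.ofHom_comp, ← CommRingCat.ofHom_comp]
      congr 3
      ext c
      exact hg₂ c
    · rw [Category.assoc, Category.assoc, hρ', hv, hw, ← Spec.map_comp, ← CommRingCat.ofHom_comp]
      congr 2
      ext x
      exact hg₁ x
  have : IsDominant (Spec.map (CommRingCat.ofHom g)) :=
    ⟨(PrimeSpectrum.denseRange_comap_iff_ker_le_nilRadical g).2
      (((RingHom.injective_iff_ker_eq_bot g).1 hgi).le.trans bot_le)⟩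
  have : IsDominant w :=
    ⟨w.isOpenEmbedding.isOpen_range.dense (Set.range_nonempty _)⟩
  have : IsDominant (v ≫ ρ) := hcomm ▸ inferInstance
  exact .of_comp v ρ

include hjB hj hW hρ in
/-- If the map of fibres induced by `π` is unramified, so is the composite of the fibre of a chart
of the source with the chart of the target, since the fibre `Z` is closed in `X`. -/
lemma formallyUnramified_of_isUnramified [IsClosedImmersion fst] [IsOpenImmersion jB]
    (h : IsUnramified ρ) : ((Algebra.TensorProduct.includeRight : B →ₐ[T] κ ⊗[T] B).toRingHom.comp
      (algebraMap C B)).FormallyUnramified := by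
  obtain ⟨v, hv, hvp⟩ := exists_isPullback_Spec_tensor hW jB hjB
  have : IsOpenImmersion v := MorphismProperty.of_isPullback hvp.flip ‹_›
  have h₁ : FormallyUnramified ρ := h.2
  have h₂ : FormallyUnramified fst := inferInstance
  have h₃ : FormallyUnramified v := inferInstance
  have h₄ : FormallyUnramified (v ≫ ρ ≫ fst) :=
    MorphismProperty.comp_mem _ _ _ h₃ (MorphismProperty.comp_mem _ _ _ h₁ h₂)
  have hcomm : v ≫ ρ ≫ fst = Spec.map (CommRingCat.ofHom
      ((Algebra.TensorProduct.includeRight : B →ₐ[T] κ ⊗[T] B).toRingHom.comp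
        (algebraMap C B))) ≫ jC := by
    rw [hρ, reassoc_of% hvp.w, hj, ← Spec.map_comp_assoc, ← CommRingCat.ofHom_comp]
  have : FormallyUnramified (Spec.map (CommRingCat.ofHom
      ((Algebra.TensorProduct.includeRight : B →ₐ[T] κ ⊗[T] B).toRingHom.comp
        (algebraMap C B))) ≫ jC) := hcomm ▸ h₄
  have h₅ := FormallyUnramified.of_comp (Spec.map (CommRingCat.ofHom
      ((Algebra.TensorProduct.includeRight : B →ₐ[T] κ ⊗[T] B).toRingHom.comp
        (algebraMap C B)))) jC
  exact (HasRingHomProperty.Spec_iff (P := @FormallyUnramified)).1 h₅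

end FibresOfCover

/-! ### General fibres of a finite cover -/

section GenericCover

/-- Let `π : Y ⟶ X` be a finite cover of schemes over `Spec A` with `Y` normal, and suppose that on
some chart there is a differential of `Y` over `X` without `A`-torsion. Then `Y` lives over a finite
extension `T` of `A`, and for a general closed point of `Spec A` with residue field `κ`, the fibre
of `Y` over any `κ`-point of `Spec T` above it is a ramified cover of the fibre of `X` which is
normal and geometrically integral. -/
lemma exists_fibres_of_cover (A C B : Type u) [CommRing A] [IsDomain A] [CharZero A]
    [IsNoetherianRing A] [CommRing C] [IsDomain C] [CommRing B] [IsDomain B] [Algebra A C]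
    [Algebra C B] [Algebra A B] [IsScalarTower A C B] [Module.Finite C B]
    {X Y : Scheme.{u}} [IsIntegral Y] [CompactSpace Y] (hn : IsNormal Y)
    (qX : X ⟶ Spec (.of A)) [LocallyOfFiniteType qX] (π : Y ⟶ X) [IsFinite π]
    (jC : Spec (.of C) ⟶ X) [IsOpenImmersion jC] (jB : Spec (.of B) ⟶ Y) [IsOpenImmersion jB]
    (hjC : jC ≫ qX = Spec.map (CommRingCat.ofHom (algebraMap A C)))
    (hj : jB ≫ π = Spec.map (CommRingCat.ofHom (algebraMap C B)) ≫ jC)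
    (hAC : Function.Injective (algebraMap A C)) (hCB : Function.Injective (algebraMap C B))
    (m : Ω[B⁄C]) (hm : ∀ a : A, algebraMap A B a • m = 0 → a = 0) :
    ∃ (T : Type u) (_ : CommRing T) (_ : Algebra A T) (_ : Module.Finite A T)
      (qT : Y ⟶ Spec (.of T)), qT ≫ Spec.map (CommRingCat.ofHom (algebraMap A T)) = π ≫ qX ∧
      ∃ a : A, a ≠ 0 ∧ ∀ (κ : Type u) [Field κ] (φ : A →+* κ), Function.Surjective φ → φ a ≠ 0 →
        ∀ ψ : T →+* κ, ψ.comp (algebraMap A T) = φ →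
        ∀ (Z : Scheme.{u}) (fst : Z ⟶ X) (snd : Z ⟶ Spec (.of κ)),
          IsPullback fst snd qX (Spec.map (CommRingCat.ofHom φ)) → IsIntegral Z →
        ∀ (W : Scheme.{u}) (fst' : W ⟶ Y) (snd' : W ⟶ Spec (.of κ)),
          IsPullback fst' snd' qT (Spec.map (CommRingCat.ofHom ψ)) →
        ∀ ρ : W ⟶ Z, ρ ≫ fst = fst' ≫ π → ρ ≫ snd = snd' →
          IsFinite ρ ∧ Surjective ρ ∧ IsRamified ρ ∧ GeometricallyIntegral snd' ∧ IsNormal W := by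
  have hAB : Function.Injective (algebraMap A B) := by
    rw [IsScalarTower.algebraMap_eq A C B]
    exact hCB.comp hAC
  have hjAB : jB ≫ π ≫ qX = Spec.map (CommRingCat.ofHom (algebraMap A B)) := by
    rw [← Category.assoc, hj, Category.assoc, hjC, ← Spec.map_comp, ← CommRingCat.ofHom_comp,
      ← IsScalarTower.algebraMap_eq]
  have hq : Function.Injective (toFunctionField (π ≫ qX)) :=
    injective_toFunctionField _ jB _ hjAB hAB
  obtain ⟨T, _, _, _, _, qT, hqT, hqTi, hqTc⟩ := exists_finite_factorization hn (π ≫ qX) hq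
  let : Algebra T B := (Spec.preimage (jB ≫ qT)).hom.toAlgebra
  have hjB : jB ≫ qT = Spec.map (CommRingCat.ofHom (algebraMap T B)) :=
    (Spec.map_preimage _).symm
  have : IsScalarTower A T B := by
    refine .of_algebraMap_eq' ?_
    suffices h : CommRingCat.ofHom (algebraMap A B) = CommRingCat.ofHom (algebraMap A T) ≫
        CommRingCat.ofHom (algebraMap T B) from congrArg CommRingCat.Hom.hom h
    apply Spec.map_injective
    rw [← hjAB, ← hqT, Spec.map_comp, ← hjB, Category.assoc]
  have hAT : Function.Injective (algebraMap A T) := by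
    rw [IsScalarTower.algebraMap_eq A T B, RingHom.coe_comp] at hAB
    exact hAB.of_comp
  have hTB : Function.Injective (algebraMap T B) := by
    rw [injective_iff_map_eq_zero]
    intro τ h
    by_contra hτ
    obtain ⟨a, ha, τ', ha'⟩ := exists_dvd_algebraMap (A := A) hτ
    refine ha (hAB ?_)
    rw [IsScalarTower.algebraMap_apply A T B, ha', map_mul, h, zero_mul, map_zero]
  have : CharZero T := charZero_of_injective_algebraMap hAT
  have : IsNoetherianRing T := IsNoetherianRing.of_finite A T
  have : LocallyOfFiniteType qT := by
    have : LocallyOfFiniteType (qT ≫ Spec.map (CommRingCat.ofHom (algebraMap A T))) := by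
      rw [hqT]
      infer_instance
    exact locallyOfFiniteType_of_comp qT (Spec.map (CommRingCat.ofHom (algebraMap A T)))
  have : Algebra.FiniteType A C := by
    have : LocallyOfFiniteType (Spec.map (CommRingCat.ofHom (algebraMap A C))) := by
      rw [← hjC]
      infer_instance
    exact RingHom.finiteType_algebraMap.1
      ((HasRingHomProperty.Spec_iff (P := @LocallyOfFiniteType)).1 this)
  obtain ⟨τ, hτ, Hτ⟩ := exists_geometricallyIntegral_isNormal_pullback qT hn hqTi hqTc
  obtain ⟨a, ha, τ', ha'⟩ := exists_dvd_algebraMap (A := A) hτ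
  obtain ⟨b, hb, Hb⟩ := exists_nontrivial_tensor_of_injective (A := A) (B := C) hAC
  obtain ⟨c, hc, Hc⟩ := exists_injective_tensorComparison A T C B hTB hCB
  obtain ⟨d, hd, Hd⟩ := exists_not_formallyUnramified_tensor A T C B hAT m hm
  refine ⟨T, inferInstance, inferInstance, inferInstance, qT, hqT, a * b * c * d,
    mul_ne_zero (mul_ne_zero (mul_ne_zero ha hb) hc) hd, ?_⟩
  intro κ _ φ hφ hκ ψ hψ Z fst snd hZ hZi W fst' snd' hW ρ hρ hρ'
  rw [map_mul, map_mul, map_mul, mul_ne_zero_iff, mul_ne_zero_iff, mul_ne_zero_iff] at hκ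
  obtain ⟨⟨⟨hκa, hκb⟩, hκc⟩, hκd⟩ := hκ
  let : Algebra A κ := φ.toAlgebra
  let : Algebra T κ := ψ.toAlgebra
  have : IsScalarTower A T κ := .of_algebraMap_eq' hψ.symm
  have hψs : Function.Surjective ψ := by
    rw [← hψ, RingHom.coe_comp] at hφ
    exact hφ.of_comp
  have : IsClosedImmersion fst := MorphismProperty.of_isPullback hZ.flip
    (IsClosedImmersion.spec_of_surjective (CommRingCat.ofHom φ) hφ)
  have : IsClosedImmersion fst' := MorphismProperty.of_isPullback hW.flip
    (IsClosedImmersion.spec_of_surjective (CommRingCat.ofHom ψ) hψs)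
  have hfin : IsFinite ρ := by
    have : IsFinite (ρ ≫ fst) := by
      rw [hρ]
      infer_instance
    exact IsFinite.of_comp ρ fst
  have := Hb κ hκb
  have hdom : IsDominant ρ := isDominant_of_injective_tensorComparison jC jB hjC hjB hj hZ hW hρ hρ'
    fun hd g ↦ Hc κ hκc hd g
  have hτκ : ψ τ ≠ 0 := fun h0 ↦ hκa (by
    rw [← hψ, RingHom.comp_apply, ha', map_mul, h0, zero_mul])
  refine ⟨hfin, ?_, fun h ↦ Hd κ hκd
    (formallyUnramified_of_isUnramified jC jB hjB hj hW hρ h), Hτ κ ψ hτκ W fst' snd' hW⟩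
  exact surjective_of_isDominant_of_isClosed_range ρ ρ.isClosedMap.isClosed_range

end GenericCover

/-! ### Differentials at branch points -/

section BranchLocus

attribute [local instance] Algebra.TensorProduct.rightAlgebra

/-- If all differentials of `B` over `C` are annihilated by elements of `C` which become invertible
in `κ`, then `κ ⊗ B` is formally unramified over `κ`. -/
lemma formallyUnramified_tensor_of_forall {C B κ : Type*} [CommRing C] [CommRing B] [CommRing κ]
    [Algebra C B] [Algebra C κ]
    (h : ∀ m : Ω[B⁄C], ∃ c : C, IsUnit (algebraMap C κ c) ∧ c • m = 0) :
    Algebra.FormallyUnramified κ (κ ⊗[C] B) := by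
  let e := KaehlerDifferential.tensorKaehlerEquivBase C κ B (κ ⊗[C] B)
  have hzero : ∀ z : κ ⊗[C] Ω[B⁄C], z = 0 := by
    intro z
    induction z with
    | zero => rfl
    | add x y hx hy => rw [hx, hy, add_zero]
    | tmul x m =>
      obtain ⟨c, ⟨v, hv⟩, hm⟩ := h m
      have : x = c • (x * (v⁻¹ : κˣ)) := by
        rw [Algebra.smul_def, mul_comm, mul_assoc, ← hv, Units.inv_mul, mul_one]
      rw [this, smul_tmul, hm, tmul_zero]
  exact ⟨⟨fun x y ↦ e.symm.injective ((hzero _).trans (hzero _).symm)⟩⟩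

lemma formallyUnramified_of_isPullback_Spec {C B κ : Type u} [CommRing C] [CommRing B] [CommRing κ]
    [Algebra C B] [Algebra C κ]
    (h : ∀ m : Ω[B⁄C], ∃ c : C, IsUnit (algebraMap C κ c) ∧ c • m = 0) {F : Scheme.{u}}
    {fst : F ⟶ Spec (.of B)} {snd : F ⟶ Spec (.of κ)}
    (hF : IsPullback fst snd (Spec.map (CommRingCat.ofHom (algebraMap C B)))
      (Spec.map (CommRingCat.ofHom (algebraMap C κ)))) : FormallyUnramified snd := by
  obtain ⟨w, hw, hwp⟩ := exists_isPullback_Spec_tensor hF (𝟙 _) (Category.id_comp _)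
  have : IsIso w := MorphismProperty.of_isPullback (P := .isomorphisms _) hwp.flip
    (inferInstanceAs (IsIso (𝟙 _)))
  have hfu : FormallyUnramified (w ≫ snd) := by
    rw [hw]
    refine (HasRingHomProperty.Spec_iff (P := @FormallyUnramified)).2 ?_
    exact RingHom.formallyUnramified_algebraMap.2 (formallyUnramified_tensor_of_forall h)
  rw [← IsIso.inv_hom_id_assoc w snd]
  exact MorphismProperty.comp_mem _ _ _ (inferInstanceAs (FormallyUnramified (inv w))) hfu

/-- The open chart of an affine morphism over an affine open subset of the target. -/
lemma isPullback_fromSpec_preimage {X Y : Scheme.{u}} (π : Y ⟶ X) [IsAffineHom π] {V : X.Opens}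
    (hV : IsAffineOpen V) :
    IsPullback (hV.preimage π).fromSpec (Spec.map (π.app V)) π hV.fromSpec := by
  refine (IsOpenImmersion.isPullback _ _ _ _ ?_ ?_).flip
  · rw [← IsAffineOpen.SpecMap_appLE_fromSpec π hV (hV.preimage π) le_rfl, Scheme.Hom.app_eq_appLE]
  · rw [hV.opensRange_fromSpec, (hV.preimage π).opensRange_fromSpec]

lemma SpecMap_evaluation_fromSpec {X : Scheme.{u}} {V : X.Opens} (hV : IsAffineOpen V) {x : X}
    (hxV : x ∈ V) :
    Spec.map (X.evaluation V x hxV) ≫ hV.fromSpec = X.fromSpecResidueField x := by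
  rw [Scheme.fromSpecResidueField, ← hV.fromSpecStalk_eq_fromSpecStalk hxV,
    IsAffineOpen.fromSpecStalk, ← Category.assoc, ← Spec.map_comp]
  rfl

/-- Over a neighbourhood of a branch point, some differential is not annihilated by any function
which is invertible at that point. -/
lemma exists_kaehlerDifferential_of_mem_branchLocus {X Y : Scheme.{u}} (π : Y ⟶ X) [IsFinite π]
    {x : X} (hx : x ∈ branchLocus π) {V : X.Opens} (hV : IsAffineOpen V) (hxV : x ∈ V) :
    let := (π.app V).hom.toAlgebra
    ∃ m : Ω[Γ(Y, π ⁻¹ᵁ V)⁄Γ(X, V)], ∀ c : Γ(X, V), c • m = 0 → x ∉ X.basicOpen c := by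
  let : Algebra Γ(X, V) Γ(Y, π ⁻¹ᵁ V) := (π.app V).hom.toAlgebra
  by_contra H
  have hfib : IsPullback (π.fiberι x) (π.fiberToSpecResidueField x) π
      (Spec.map (X.evaluation V x hxV) ≫ hV.fromSpec) := by
    rw [SpecMap_evaluation_fromSpec]
    exact IsPullback.of_hasPullback _ _
  let : Algebra Γ(X, V) (X.residueField x) := (X.evaluation V x hxV).hom.toAlgebra
  have : IsFinite (π.fiberToSpecResidueField x) :=
    inferInstanceAs (IsFinite (pullback.snd π (X.fromSpecResidueField x)))
  refine hx ⟨inferInstance, formallyUnramified_of_isPullback_Spec (C := Γ(X, V))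
    (B := Γ(Y, π ⁻¹ᵁ V)) (κ := X.residueField x) (fun m ↦ ?_)
    (hfib.of_right' (isPullback_fromSpec_preimage π hV))⟩
  obtain ⟨c, hc, hxc⟩ : ∃ c : Γ(X, V), c • m = 0 ∧ x ∈ X.basicOpen c := by
    by_contra! h
    exact H ⟨m, h⟩
  exact ⟨c, ((X.evaluation_ne_zero_iff_mem_basicOpen x hxV c).2 hxc).isUnit, hc⟩

end BranchLocus

/-! ### Generic points and rational points -/

section GenericPoint

variable {X S : Scheme.{u}} [IsIntegral S] (f : X ⟶ S) {x : X} (hx : f x = genericPoint S)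
  {W : S.Opens} {V : X.Opens} (h : V ≤ f ⁻¹ᵁ W) (hxV : x ∈ V)

include hx hxV in
/-- A nonzero function on the base is invertible at all points above the generic point. -/
lemma mem_basicOpen_appLE {a : Γ(S, W)} (ha : a ≠ 0) : x ∈ X.basicOpen (f.appLE W V h a) := by
  rw [Scheme.basicOpen_appLE]
  refine ⟨hxV, ?_⟩
  change f x ∈ S.basicOpen a
  rw [hx]
  have hne : (S.basicOpen a : Set S).Nonempty := by
    rw [Set.nonempty_iff_ne_empty]
    intro h0
    exact ha ((basicOpen_eq_bot_iff a).1 (TopologicalSpace.Opens.ext h0))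
  exact ((genericPoint_spec S).mem_open_set_iff (S.basicOpen a).isOpen).2 (by simpa using hne)

include hx hxV in
lemma appLE_injective : Function.Injective (f.appLE W V h).hom := by
  rw [injective_iff_map_eq_zero]
  intro a h0
  by_contra ha
  have := mem_basicOpen_appLE f hx h hxV ha
  rw [show f.appLE W V h a = 0 from h0, Scheme.basicOpen_zero] at this
  exact this

lemma app_injective_of_surjective {Y X : Scheme.{u}} [IsIntegral X] (π : Y ⟶ X) [Surjective π]
    (V : X.Opens) : Function.Injective (π.app V).hom := by
  rw [injective_iff_map_eq_zero]
  intro c h0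
  have h1 : π ⁻¹ᵁ X.basicOpen c = ⊥ := by
    rw [Scheme.preimage_basicOpen, show π.app V c = 0 from h0, Scheme.basicOpen_zero]
  refine (basicOpen_eq_bot_iff c).1 (eq_bot_iff.2 fun x hx ↦ ?_)
  obtain ⟨y, rfl⟩ := π.surjective x
  have : y ∈ π ⁻¹ᵁ X.basicOpen c := hx
  rwa [h1] at this

lemma apply_genericPoint_of_surjective [IrreducibleSpace X] [Surjective f] :
    f (genericPoint X) = genericPoint S := by
  obtain ⟨x, hx⟩ := f.surjective (genericPoint S)
  have h₁ : f (genericPoint X) ⤳ genericPoint S :=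
    hx ▸ (genericPoint_specializes x).map f.continuous
  exact (h₁.antisymm (genericPoint_specializes _)).eq

end GenericPoint

section FibreMeetsOpen

/-- The general fibres of a dominant morphism meet a given nonempty open subset of the source. -/
lemma exists_nonempty_preimage_fibre {X S : Scheme.{u}} [IsIntegral X] [IsIntegral S] (f : X ⟶ S)
    [LocallyOfFiniteType f] [Surjective f] {W : S.Opens} (hW : IsAffineOpen W) [Nonempty W]
    [IsNoetherianRing Γ(S, W)] [CharZero Γ(S, W)] {O : X.Opens} (hO : (O : Set X).Nonempty) :
    ∃ a : Γ(S, W), a ≠ 0 ∧ ∀ (κ : Type u) [Field κ] (φ : Γ(S, W) →+* κ), φ a ≠ 0 →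
      ∀ (Z : Scheme.{u}) (fst : Z ⟶ X) (snd : Z ⟶ Spec (.of κ)),
        IsPullback fst snd f (Spec.map (CommRingCat.ofHom φ) ≫ hW.fromSpec) →
          (fst ⁻¹ᵁ O : Set Z).Nonempty := by
  have hgen := apply_genericPoint_of_surjective f
  have hmem : genericPoint X ∈ O ⊓ f ⁻¹ᵁ W := by
    refine ⟨((genericPoint_spec X).mem_open_set_iff O.isOpen).2 (by simpa using hO), ?_⟩
    change f (genericPoint X) ∈ W
    rw [hgen]
    exact ((genericPoint_spec S).mem_open_set_iff W.isOpen).2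
      (by simpa using ⟨_, (Classical.arbitrary W).2⟩)
  obtain ⟨V, hV, hxV, hVO⟩ := exists_isAffineOpen_mem_and_subset hmem
  have hVW : V ≤ f ⁻¹ᵁ W := hVO.trans inf_le_right
  let : Algebra Γ(S, W) Γ(X, V) := (f.appLE W V hVW).hom.toAlgebra
  have hinj : Function.Injective (algebraMap Γ(S, W) Γ(X, V)) := appLE_injective f hgen hVW hxV
  have : Algebra.FiniteType Γ(S, W) Γ(X, V) := f.finiteType_appLE hW hV hVW
  obtain ⟨a, ha, H⟩ := exists_nontrivial_tensor_of_injective hinj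
  refine ⟨a, ha, fun κ _ φ hφ Z fst snd hZ ↦ ?_⟩
  let : Algebra Γ(S, W) κ := φ.toAlgebra
  have := H κ hφ
  let v : Spec (.of (κ ⊗[Γ(S, W)] Γ(X, V))) ⟶ Z := hZ.lift
    (Spec.map (CommRingCat.ofHom (Algebra.TensorProduct.includeRight :
      Γ(X, V) →ₐ[Γ(S, W)] κ ⊗[Γ(S, W)] Γ(X, V)).toRingHom) ≫ hV.fromSpec)
    (Spec.map (CommRingCat.ofHom Algebra.TensorProduct.includeLeftRingHom)) (by
      rw [Category.assoc, ← IsAffineOpen.SpecMap_appLE_fromSpec f hW hV hVW, ← Spec.map_comp_assoc,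
        ← Spec.map_comp_assoc]
      congr 2
      ext b
      exact (Algebra.TensorProduct.tmul_one_eq_one_tmul b).symm)
  obtain ⟨p⟩ : Nonempty (Spec (.of (κ ⊗[Γ(S, W)] Γ(X, V)))) := inferInstance
  refine ⟨v p, ?_⟩
  change fst (v p) ∈ O
  have : fst (v p) ∈ V := by
    rw [← Scheme.Hom.comp_apply, hZ.lift_fst, Scheme.Hom.comp_apply]
    exact hV.range_fromSpec.le ⟨_, rfl⟩
  exact (hVO this).1

end FibreMeetsOpen

section RationalPoints

/-- A rational point in an affine open subset is given by a `k`-valued point of its coordinate ring,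
which is surjective because `k` maps to the coordinate ring. -/
lemma exists_ringHom_of_toPoint_mem {k : Type u} [Field k] {S : Scheme.{u}}
    {p : S ⟶ Spec (.of k)} (s : RationalPoint p) {W : S.Opens} (hW : IsAffineOpen W)
    (hs : s.toPoint ∈ W) : ∃ φ : Γ(S, W) →+* k, Function.Surjective φ ∧
      Spec.map (CommRingCat.ofHom φ) ≫ hW.fromSpec = s.1 ∧
      ∀ b, s.toPoint ∈ S.basicOpen b → φ b ≠ 0 := by
  have hrange : Set.range s.1 ⊆ Set.range hW.fromSpec := by
    rw [hW.range_fromSpec]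
    rintro _ ⟨y, rfl⟩
    rwa [Subsingleton.elim (α := PrimeSpectrum k) y (IsLocalRing.closedPoint k)]
  obtain ⟨φ, hφ⟩ : ∃ φ : Γ(S, W) →+* k,
      Spec.map (CommRingCat.ofHom φ) = IsOpenImmersion.lift hW.fromSpec s.1 hrange :=
    ⟨(Spec.preimage (IsOpenImmersion.lift hW.fromSpec s.1 hrange)).hom, Spec.map_preimage _⟩
  have hφs : Spec.map (CommRingCat.ofHom φ) ≫ hW.fromSpec = s.1 := by
    rw [hφ, IsOpenImmersion.lift_fac]
  refine ⟨φ, fun c ↦ ?_, hφs, fun b hb ↦ ?_⟩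
  · have : Spec.preimage (hW.fromSpec ≫ p) ≫ CommRingCat.ofHom φ = 𝟙 _ := by
      apply Spec.map_injective
      rw [Spec.map_comp, Spec.map_preimage, ← Category.assoc, hφs, s.2, Spec.map_id]
    exact ⟨(Spec.preimage (hW.fromSpec ≫ p)).hom c,
      DFunLike.congr_fun (congrArg CommRingCat.Hom.hom this) c⟩
  · have h1 : Spec.map (CommRingCat.ofHom φ) (IsLocalRing.closedPoint k) ∈
        hW.fromSpec ⁻¹ᵁ S.basicOpen b := by
      change (Spec.map (CommRingCat.ofHom φ) ≫ hW.fromSpec) (IsLocalRing.closedPoint k) ∈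
        S.basicOpen b
      rw [hφs]
      exact hb
    rw [hW.fromSpec_preimage_basicOpen] at h1
    intro h0
    exact h1 (show φ b ∈ IsLocalRing.maximalIdeal k from h0 ▸ zero_mem _)

/-- There are finitely many points of `Spec T` with values in `κ` above a given point of `Spec A`.
-/
lemma finite_ringHom_of_moduleFinite {A T κ : Type*} [CommRing A] [CommRing T] [Algebra A T]
    [Module.Finite A T] [Field κ] (φ : A →+* κ) :
    Finite {ψ : T →+* κ // ψ.comp (algebraMap A T) = φ} := by
  let : Algebra A κ := φ.toAlgebra
  let g : {ψ : T →+* κ // ψ.comp (algebraMap A T) = φ} → (κ ⊗[A] T →ₐ[κ] κ) := fun ψ ↦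
    Algebra.TensorProduct.lift (Algebra.ofId κ κ)
      { ψ.1 with commutes' := DFunLike.congr_fun ψ.2 } fun _ _ ↦ .all _ _
  refine Finite.of_injective g fun ψ ψ' h ↦ Subtype.ext (RingHom.ext fun t ↦ ?_)
  simpa [g] using DFunLike.congr_fun h (1 ⊗ₜ t)

/-- The weak-Hilbert property for a possibly empty finite family of covers. -/
lemma WeakHilbert.dense_of_finite {k : Type u} [Field k] [CharZero k] {X : Scheme.{u}}
    [IsIntegral X] {p : X ⟶ Spec (.of k)} (h : WeakHilbert p) {ι : Type*} [Finite ι]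
    (Y : ι → Scheme.{u}) (π : ∀ i, Y i ⟶ X) (h₁ : ∀ i, IsFinite (π i))
    (h₂ : ∀ i, Surjective (π i)) (h₃ : ∀ i, IsRamified (π i))
    (h₄ : ∀ i, GeometricallyIntegral (π i ≫ p)) (h₅ : ∀ i, IsNormal (Y i)) :
    IsZariskiDense (⋃ i, Set.range (RationalPoint.map p (π i)))ᶜ := by
  obtain ⟨n, ⟨e⟩⟩ := Finite.exists_equiv_fin ι
  rcases Nat.eq_zero_or_pos n with rfl | hn
  · have : IsEmpty ι := e.isEmpty
    have := h.isProjective.isProper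
    have := h.geometricallyConnected
    have : CompactSpace X := QuasiCompact.compactSpace_of_compactSpace p
    rw [Set.iUnion_of_empty, Set.compl_empty]
    refine isZariskiDense_univ h.isNormal p fun Y π h₁ h₂ h₃ h₄ h₅ ↦ ?_
    have := h.dense 1 le_rfl (fun _ ↦ Y) (fun _ ↦ π) (fun _ ↦ h₁) (fun _ ↦ h₂) (fun _ ↦ h₃)
      (fun _ ↦ h₄) fun _ ↦ h₅
    rwa [Set.iUnion_const] at this
  · have := h.dense n hn (fun i ↦ Y (e.symm i)) (fun i ↦ π (e.symm i)) (fun _ ↦ h₁ _)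
      (fun _ ↦ h₂ _) (fun _ ↦ h₃ _) (fun _ ↦ h₄ _) fun _ ↦ h₅ _
    rwa [e.symm.surjective.iUnion_comp fun i ↦ Set.range (RationalPoint.map p (π i))] at this

end RationalPoints

/-! ### Covers of the fibres over rational points -/

section CoversOfFibres

/-- Let `π : Y ⟶ X` be a finite cover with a branch point over the generic point of `S`. For a
general rational point `s` of `S`, the rational points of the fibre `X_s` that lift to `Y` lift to
one of finitely many ramified covers of `X_s` which are normal and geometrically integral. The
covers are indexed by the rational points above `s` of a finite cover of an open subset of `S`,
through which `Y` factors. -/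
lemma exists_covers_of_rational_fibres {k : Type u} [Field k] {X S Y : Scheme.{u}}
    [CharZero k] [IsIntegral S] [IsIntegral Y] [IsIntegral X] (hn : IsNormal Y)
    (f : X ⟶ S) [LocallyOfFiniteType f] [QuasiCompact f] (π : Y ⟶ X) [IsFinite π] [Surjective π]
    {x : X} (hx : x ∈ branchLocus π) (hfx : f x = genericPoint S) (pS : S ⟶ Spec (.of k))
    {W : S.Opens} (hW : IsAffineOpen W) [Nonempty W] [IsNoetherianRing Γ(S, W)]
    [CharZero Γ(S, W)] :
    ∃ a : Γ(S, W), a ≠ 0 ∧ ∀ s : RationalPoint pS, s.toPoint ∈ S.basicOpen a →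
      IsIntegral (pullback f s.1) →
      ∃ (ι : Type u) (_ : Finite ι) (Z : ι → Scheme.{u}) (ρ : ∀ i, Z i ⟶ pullback f s.1),
        (∀ i, IsFinite (ρ i) ∧ Surjective (ρ i) ∧ IsRamified (ρ i) ∧
          GeometricallyIntegral (ρ i ≫ pullback.snd f s.1) ∧ IsNormal (Z i)) ∧
        ∀ z : RationalPoint (pullback.snd f s.1),
          (∃ y : Spec (.of k) ⟶ Y, y ≫ π = z.1 ≫ pullback.fst f s.1) →
            ∃ i, z ∈ Set.range (RationalPoint.map (pullback.snd f s.1) (ρ i)) := by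
  -- the restrictions of `X` and `Y` to the affine open subset `W` of the base
  let X₀ := pullback f hW.fromSpec
  let iX : X₀ ⟶ X := pullback.fst f hW.fromSpec
  let qX : X₀ ⟶ Spec Γ(S, W) := pullback.snd f hW.fromSpec
  let Y₀ := pullback π iX
  let iY : Y₀ ⟶ Y := pullback.fst π iX
  let π₀ : Y₀ ⟶ X₀ := pullback.snd π iX
  have hX₀ : IsPullback iX qX f hW.fromSpec := .of_hasPullback _ _
  have hY₀ : IsPullback iY π₀ π iX := .of_hasPullback _ _
  have : IsOpenImmersion iX := inferInstanceAs (IsOpenImmersion (pullback.fst _ _))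
  have : IsOpenImmersion iY := inferInstanceAs (IsOpenImmersion (pullback.fst _ _))
  have : IsFinite π₀ := inferInstanceAs (IsFinite (pullback.snd _ _))
  have : LocallyOfFiniteType qX := inferInstanceAs (LocallyOfFiniteType (pullback.snd _ _))
  have : QuasiCompact qX := inferInstanceAs (QuasiCompact (pullback.snd _ _))
  have : CompactSpace Y₀ := QuasiCompact.compactSpace_of_compactSpace (π₀ ≫ qX)
  -- an affine chart around the given branch point over the generic point of the base
  have hxW : x ∈ f ⁻¹ᵁ W := by
    change f x ∈ W
    rw [hfx]
    exact ((genericPoint_spec S).mem_open_set_iff W.isOpen).2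
      (by simpa using ⟨_, (Classical.arbitrary W).2⟩)
  obtain ⟨V, hV, hxV, hVW⟩ := exists_isAffineOpen_mem_and_subset hxW
  have hVW : V ≤ f ⁻¹ᵁ W := hVW
  have hV' : IsAffineOpen (π ⁻¹ᵁ V) := hV.preimage π
  obtain ⟨y, rfl⟩ := π.surjective x
  have hyV : y ∈ π ⁻¹ᵁ V := hxV
  have hVne : Nonempty V := ⟨⟨_, hxV⟩⟩
  have hdom : IsDomain Γ(X, V) := inferInstance
  have hdom' : IsDomain Γ(Y, π ⁻¹ᵁ V) :=
    have : Nonempty (π ⁻¹ᵁ V : Y.Opens) := ⟨⟨y, hyV⟩⟩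
    inferInstance
  let : Algebra Γ(S, W) Γ(X, V) := (f.appLE W V hVW).hom.toAlgebra
  let : Algebra Γ(X, V) Γ(Y, π ⁻¹ᵁ V) := (π.app V).hom.toAlgebra
  let : Algebra Γ(S, W) Γ(Y, π ⁻¹ᵁ V) := ((π.app V).hom.comp (f.appLE W V hVW).hom).toAlgebra
  have : IsScalarTower Γ(S, W) Γ(X, V) Γ(Y, π ⁻¹ᵁ V) := .of_algebraMap_eq' rfl
  have : Module.Finite Γ(X, V) Γ(Y, π ⁻¹ᵁ V) := π.finite_app V hV
  obtain ⟨m, hm⟩ := exists_kaehlerDifferential_of_mem_branchLocus π hx hV hxV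
  let jC : Spec Γ(X, V) ⟶ X₀ := hX₀.lift hV.fromSpec (Spec.map (f.appLE W V hVW))
    (IsAffineOpen.SpecMap_appLE_fromSpec f hW hV hVW).symm
  have hjC₁ : jC ≫ iX = hV.fromSpec := hX₀.lift_fst _ _ _
  have hjC₂ : jC ≫ qX = Spec.map (f.appLE W V hVW) := hX₀.lift_snd _ _ _
  have hsq := (isPullback_fromSpec_preimage π hV).w
  let jB : Spec Γ(Y, π ⁻¹ᵁ V) ⟶ Y₀ := hY₀.lift hV'.fromSpec (Spec.map (π.app V) ≫ jC) (by
    rw [Category.assoc, hjC₁, hsq])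
  have hjB₁ : jB ≫ iY = hV'.fromSpec := hY₀.lift_fst _ _ _
  have hjB₂ : jB ≫ π₀ = Spec.map (π.app V) ≫ jC := hY₀.lift_snd _ _ _
  have : IsOpenImmersion jC :=
    have : IsOpenImmersion (jC ≫ iX) := hjC₁ ▸ inferInstance
    IsOpenImmersion.of_comp jC iX
  have : IsOpenImmersion jB :=
    have : IsOpenImmersion (jB ≫ iY) := hjB₁ ▸ inferInstance
    IsOpenImmersion.of_comp jB iY
  have : Nonempty Y₀ := ⟨jB (Classical.arbitrary (PrimeSpectrum Γ(Y, π ⁻¹ᵁ V)))⟩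
  have : IsIntegral Y₀ := isIntegral_of_isOpenImmersion iY
  obtain ⟨T, _, _, _, qT, hqT, a, ha, H⟩ := exists_fibres_of_cover Γ(S, W) Γ(X, V) Γ(Y, π ⁻¹ᵁ V)
    (hn.of_isOpenImmersion iY) qX π₀ jC jB hjC₂ hjB₂ (appLE_injective f hfx hVW hxV)
    (app_injective_of_surjective π V) m (fun a ha ↦ by
      by_contra h
      exact hm (f.appLE W V hVW a) ((algebraMap_smul Γ(Y, π ⁻¹ᵁ V) _ m).symm.trans ha)
        (mem_basicOpen_appLE f hfx hVW hxV h))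
  refine ⟨a, ha, fun s hs hi ↦ ?_⟩
  obtain ⟨φ, hφ, hφs, hφa⟩ := exists_ringHom_of_toPoint_mem s hW (S.basicOpen_le a hs)
  have hXs : IsPullback (pullback.fst f s.1) (pullback.snd f s.1) f
      (Spec.map (CommRingCat.ofHom φ) ≫ hW.fromSpec) := by
    rw [hφs]
    exact .of_hasPullback _ _
  have hZ := hXs.of_right' hX₀
  set fst := hX₀.lift (pullback.fst f s.1) (pullback.snd f s.1 ≫ Spec.map (CommRingCat.ofHom φ))
    (by rw [hXs.w, Category.assoc]) with hfst
  have hfst' : fst ≫ iX = pullback.fst f s.1 := hX₀.lift_fst _ _ _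
  -- the rational points of `Spec T` above `s`, the fibres of `Y` over them, and their maps to `X_s`
  let ι := {ψ : T →+* k // ψ.comp (algebraMap Γ(S, W) T) = φ}
  let Z (ψ : ι) : Scheme.{u} := pullback qT (Spec.map (CommRingCat.ofHom ψ.1))
  have hZψ (ψ : ι) : IsPullback (pullback.fst qT (Spec.map (CommRingCat.ofHom ψ.1)))
    (pullback.snd qT (Spec.map (CommRingCat.ofHom ψ.1))) qT (Spec.map (CommRingCat.ofHom ψ.1)) :=
    .of_hasPullback _ _
  have hψ (ψ : ι) : Spec.map (CommRingCat.ofHom ψ.1) ≫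
      Spec.map (CommRingCat.ofHom (algebraMap Γ(S, W) T)) = Spec.map (CommRingCat.ofHom φ) := by
    rw [← Spec.map_comp, ← CommRingCat.ofHom_comp, ψ.2]
  let ρ (ψ : ι) : Z ψ ⟶ pullback f s.1 := hZ.lift
    (pullback.fst qT (Spec.map (CommRingCat.ofHom ψ.1)) ≫ π₀)
    (pullback.snd qT (Spec.map (CommRingCat.ofHom ψ.1))) (by
      rw [Category.assoc, ← hqT, reassoc_of% (hZψ ψ).w, hψ])
  have hρ₁ (ψ : ι) : ρ ψ ≫ fst = pullback.fst qT (Spec.map (CommRingCat.ofHom ψ.1)) ≫ π₀ :=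
    hZ.lift_fst _ _ _
  have hρ₂ (ψ : ι) : ρ ψ ≫ pullback.snd f s.1 =
    pullback.snd qT (Spec.map (CommRingCat.ofHom ψ.1)) := hZ.lift_snd _ _ _
  refine ⟨ι, finite_ringHom_of_moduleFinite φ, Z, ρ, fun ψ ↦ ?_, ?_⟩
  · have := H k φ hφ (hφa a hs) ψ.1 ψ.2 _ fst _ hZ hi _ _ _ (hZψ ψ) (ρ ψ) (hρ₁ ψ) (hρ₂ ψ)
    rwa [← hρ₂ ψ] at this
  · rintro z ⟨y, hy⟩
    -- a rational point of `Y` above `z` lies over a rational point of `Spec T`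
    let y₀ : Spec (.of k) ⟶ Y₀ := hY₀.lift y (z.1 ≫ fst) (by rw [hy, Category.assoc, hfst'])
    have hy₀ : y₀ ≫ π₀ = z.1 ≫ fst := hY₀.lift_snd _ _ _
    obtain ⟨ψ, hψy⟩ : ∃ ψ : T →+* k, Spec.map (CommRingCat.ofHom ψ) = y₀ ≫ qT :=
      ⟨(Spec.preimage (y₀ ≫ qT)).hom, Spec.map_preimage _⟩
    have hψφ : ψ.comp (algebraMap Γ(S, W) T) = φ := by
      suffices h : CommRingCat.ofHom (algebraMap Γ(S, W) T) ≫ CommRingCat.ofHom ψ =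
          CommRingCat.ofHom φ from congrArg CommRingCat.Hom.hom h
      apply Spec.map_injective
      rw [Spec.map_comp, hψy, Category.assoc, hqT, reassoc_of% hy₀, hZ.w, ← Category.assoc, z.2,
        Category.id_comp]
    let i : ι := ⟨ψ, hψφ⟩
    let w : Spec (.of k) ⟶ Z i := (hZψ i).lift y₀ (𝟙 _) (by rw [Category.id_comp, ← hψy])
    have hw₁ : w ≫ pullback.fst qT (Spec.map (CommRingCat.ofHom i.1)) = y₀ := (hZψ i).lift_fst _ _ _
    have hw₂ : w ≫ pullback.snd qT (Spec.map (CommRingCat.ofHom i.1)) = 𝟙 _ :=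
      (hZψ i).lift_snd _ _ _
    refine ⟨i, ⟨w, by rw [hρ₂, hw₂]⟩, Subtype.ext ?_⟩
    change w ≫ ρ i = z.1
    apply hZ.hom_ext
    · rw [Category.assoc, hρ₁, reassoc_of% hw₁, hy₀]
    · rw [Category.assoc, hρ₂, hw₂, z.2]

end CoversOfFibres

end Geometry

end HilbertProperty

theorem theorem2p3 {k : Type u} [Field k] [CharZero k]
    {X S Y : AlgebraicGeometry.Scheme.{u}}
    (pX : X ⟶ AlgebraicGeometry.Spec (.of k)) (pS : S ⟶ AlgebraicGeometry.Spec (.of k))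
    (hXs : AlgebraicGeometry.Smooth pX) (hXp : HilbertProperty.IsProjective pX)
    (hXi : AlgebraicGeometry.IsIntegral X)
    (hSs : AlgebraicGeometry.Smooth pS) (hSp : HilbertProperty.IsProjective pS)
    (hSi : AlgebraicGeometry.IsIntegral S)
    (f : X ⟶ S) (hf : f ≫ pS = pX)
    (π : Y ⟶ X) (hYi : AlgebraicGeometry.IsIntegral Y) (hYn : HilbertProperty.IsNormal Y)
    (hπf : AlgebraicGeometry.IsFinite π) (hπs : AlgebraicGeometry.Surjective π)
    (hπr : HilbertProperty.IsRamified π)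
    (U : S.Opens) (hU : Dense (U : Set S))
    (h1 : HilbertProperty.VeryWeakHilbert pS)
    (h2 : ∀ s : HilbertProperty.RationalPoint pS, s.toPoint ∈ U →
      HilbertProperty.IsNormal (pullback f s.1) ∧
      AlgebraicGeometry.IsIntegral (pullback f s.1) ∧
      HilbertProperty.WeakHilbert (pullback.snd f s.1))
    (h3 : f '' HilbertProperty.branchLocus π = Set.univ) :
    HilbertProperty.IsZariskiDense
      (Set.range (HilbertProperty.RationalPoint.map pX π))ᶜ := by
  open AlgebraicGeometry HilbertProperty in
  have := hSp.isProper
  have := hXp.isProper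
  have : IsProper (f ≫ pS) := hf ▸ inferInstance
  have : IsProper f := IsProper.of_comp f pS
  have : CompactSpace S := QuasiCompact.compactSpace_of_compactSpace pS
  have := h1.geometricallyConnected
  have hS : IsZariskiDense (Set.univ : Set (RationalPoint pS)) :=
    isZariskiDense_univ h1.isNormal pS h1.dense
  have : Surjective f := ⟨fun s ↦ by
    obtain ⟨x, -, hx⟩ := h3.ge (Set.mem_univ s)
    exact ⟨x, hx⟩⟩
  obtain ⟨x, hx, hfx⟩ := h3.ge (Set.mem_univ (genericPoint S))
  have hgU : genericPoint S ∈ U :=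
    ((genericPoint_spec S).mem_open_set_iff U.isOpen).2 (by simpa using hU.nonempty)
  obtain ⟨W, hW, hgW, hWU⟩ := exists_isAffineOpen_mem_and_subset hgU
  have hWne : Nonempty W := ⟨⟨_, hgW⟩⟩
  have := isNoetherianRing_of_locallyOfFiniteType pS hW
  have : CharZero Γ(S, W) :=
    charZero_of_injective_ringHom (toSections pS hW).injective
  -- shrinking the base once for the covers of the fibres, and once more for the fibres to meet the
  -- given open subset `O`
  obtain ⟨a, ha, Ha⟩ := exists_covers_of_rational_fibres hYn f π hx hfx pS hW
  change Dense _
  rw [dense_iff_inter_open]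
  intro O hO hOne
  obtain ⟨b, hb, Hb⟩ := exists_nonempty_preimage_fibre f hW (O := ⟨O, hO⟩) hOne
  have hab : (S.basicOpen (a * b) : Set S).Nonempty := by
    rw [Set.nonempty_iff_ne_empty]
    intro h0
    exact mul_ne_zero ha hb ((basicOpen_eq_bot_iff _).1 (TopologicalSpace.Opens.ext h0))
  obtain ⟨_, hs, s, -, rfl⟩ := hS.inter_open_nonempty _ (S.basicOpen (a * b)).isOpen hab
  have hsab : s.toPoint ∈ S.basicOpen a ⊓ S.basicOpen b := by
    rw [← Scheme.basicOpen_mul]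
    exact hs
  have hsW : s.toPoint ∈ W := S.basicOpen_le a hsab.1
  obtain ⟨-, hsi, hsw⟩ := h2 s (hWU hsW)
  obtain ⟨ι, _, Z, ρ, hρ, Hρ⟩ := Ha s hsab.1 hsi
  obtain ⟨φ, -, hφs, hφ⟩ := exists_ringHom_of_toPoint_mem s hW hsW
  have hne := Hb k φ (hφ b hsab.2) (pullback f s.1) (pullback.fst f s.1) (pullback.snd f s.1)
    (by rw [hφs]; exact .of_hasPullback _ _)
  have hdense := hsw.dense_of_finite Z ρ (fun i ↦ (hρ i).1) (fun i ↦ (hρ i).2.1)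
    (fun i ↦ (hρ i).2.2.1) (fun i ↦ (hρ i).2.2.2.1) fun i ↦ (hρ i).2.2.2.2
  obtain ⟨_, hzO, z, hz, rfl⟩ := hdense.inter_open_nonempty _
    (pullback.fst f s.1 ⁻¹ᵁ ⟨O, hO⟩).isOpen hne
  refine ⟨_, hzO, ⟨z.1 ≫ pullback.fst f s.1, ?_⟩, ?_, rfl⟩
  · rw [Category.assoc, ← hf, reassoc_of% (pullback.condition (f := f) (g := s.1)), s.2,
      Category.comp_id, z.2]
  · rintro ⟨y, hy⟩
    exact hz (Set.mem_iUnion.2 (Hρ z ⟨y.1, congrArg Subtype.val hy⟩))
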